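/- Let $d\ge 1$, let $\Omega=C_0([0,1];\mathbb R^d)$ be the space of continuous paths $\gamma$ with $\gamma(0)=0$, and let $\nu$ be Wiener measure on $\Omega$. Let $Z$ be the set of cylindrical functions $F(\gamma)=f(\gamma(s_1),\dots,\gamma(s_k))$, $k\ge1$, $0<s_1<\dots<s_k=1$, where $f:(\mathbb R^d)^k\to\mathbb R$ is smooth and $f$ and all its partial derivatives have polynomial growth; let $Y\subset Z$ be the set of those $F$ that have such a representation with all $s_i$ dyadic, i.e. $s_i\in\{l2^{-n}:1\le l\le 2^n\}$ for some $n$. For $F\in Z$ put $$D_sF(\gamma)=\sum_{i=1}^k (s_i\wedge s)\,(\nabla_{s_i}f)(\gamma(s_1),\dots,\gamma(s_k)),\qquad s\in[0,1],$$ where $\nabla_{s_i}f$ is the gradient of $f$ in its $i$-th variable, and let $\langle \phi,\psi\rangle_{\mathbb H}=\int_0^1\langle \phi'(x),\psi'(x)\rangle_{\mathbb R^d}\,dx$ be the Cameron--Martin inner product. Let $(H_r)_{r\ge1}$ be the Haar functions on $[0,1]$: $H_1=1$, and for $m\ge0$, $1\le k\le 2^m$, $H_{2^m+k}$ equals $2^{m/2}$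 on $[\frac{k-1}{2^m},\frac{2k-1}{2^{m+1}})$, $-2^{m/2}$ on $[\frac{2k-1}{2^{m+1}},\frac{k}{2^m})$ and $0$ elsewhere. Put $g_{d(r-1)+j}=H_r e_j$ for $r\ge1$, $1\le j\le d$, with $(e_j)$ the standard basis of $\mathbb R^d$, and $S_n(s)=\int_0^s g_n(u)\,du$. Let $0<\lambda_1\le\lambda_2\le\cdots$, let $\varphi:\Omega\to\mathbb R$ be measurable with $0<\varphi\le C$ ($\nu$-a.e.) for some constant $C$, and suppose that $f/\varphi\in L^1(\nu)$ for all $f\in Z$. Set $$\mathcal E(F,G)=\sum_{i=1}^\infty\lambda_i\int\langle S_i,DF\rangle_{\mathbb H}\langle S_i,DG\rangle_{\mathbb H}\,\varphi\,d\nu .$$ A form $(\mathcal E,V)$, $V\subset L^2(\varphi\nu)$, is called closable in $L^2(\varphi\nu)$ if $\mathcal E(F_n,F_n)\to0$ whenever $F_n\in V$, $F_n\to0$ in $L^2(\varphi\nu)$ and $\mathcal E(F_n-F_m,F_n-F_m)\to0$ as $n,m\to\infty$. The domain $D_V(\mathcal E)$ of its closure consists of all $u\in L^2(\varphi\nu)$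 for which there are $F_n\in V$ with $F_n\to u$ in $L^2(\varphi\nu)$ and $\mathcal E(F_n-F_m,F_n-F_m)\to0$, and the closure takes the value $\lim_n\mathcal E(F_n,G_n)$ at $(u,v)$ for such sequences $F_n\to u$, $G_n\to v$. Let $c_0=0$, let $c_1,c_2,\ldots\in\{0,1\}$ be arbitrary, and for $p\ge1$, $1\le j\le d$ put $i_{p,j}=2^{p-1}(d+j-1)+1+\sum_{q=0}^{p-1}c_q2^{p-q-1}$. Consider the condition $$\sum_{p=1}^\infty\frac{\lambda_{i_{p,j}}}{2^p}<\infty\quad\text{for all } j\in\{1,\dots,d\}.\tag{$*$}$$ Then: (a) $\mathcal E$ is well defined on $Y\subset L^2(\varphi\nu)$, and $(\mathcal E,Y)$ is closable in $L^2(\varphi\nu)$. (b) If $(*)$ holds, then $\mathcal E$ is well defined on $Z\subset L^2(\varphi\nu)$, $(\mathcal E,Z)$ is closable in $L^2(\varphi\nu)$, and the closures of $(\mathcal E,Z)$ and $(\mathcal E,Y)$ coincide; in particular $D_Z(\mathcal E)=D_Y(\mathcal E)$. (c) $Z\subset D_Y(\mathcal E)$ if and only if $(*)$ holds. -/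

import Mathlib

open MeasureTheory ProbabilityTheory Filter Topology

noncomputable section

namespace WienerForm

/-! ### Path space and Wiener measure -/

/-- `ℝ^d` with its Euclidean structure. -/
abbrev E (d : ℕ) : Type := EuclideanSpace ℝ (Fin d)

/-- `Ω = C₀([0,1]; ℝ^d)`: continuous paths started at the origin. -/
abbrev PathSpace (d : ℕ) : Type := {γ : C(unitInterval, E d) // γ 0 = 0}

/-- The σ-algebra on `Ω` generated by the evaluations `γ ↦ γ(t)`
(it is the Borel σ-algebra of uniform convergence). -/
instance instMeasurableSpacePathSpace (d : ℕ) : MeasurableSpace (PathSpace d) :=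
  ⨆ t : unitInterval, MeasurableSpace.comap (fun γ : PathSpace d => γ.1 t) inferInstance

/-- `ν` is Wiener measure on `Ω`: a probability measure under which the coordinate process has
independent increments and, for `s ≤ t`, the `d` coordinates of `γ(t) - γ(s)` are independent
centred Gaussians of variance `t - s`. -/
structure IsWienerMeasure {d : ℕ} (ν : Measure (PathSpace d)) : Prop where
  isProbabilityMeasure : IsProbabilityMeasure ν
  indepIncrements :
    HasIndepIncrements (fun (t : unitInterval) (γ : PathSpace d) => γ.1 t) ν
  map_increment : ∀ s t : unitInterval, s ≤ t →
    ν.map (fun (γ : PathSpace d) (j : Fin d) => γ.1 t j - γ.1 s j) =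
      Measure.pi (fun _ : Fin d => gaussianReal 0 (Real.toNNReal ((t : ℝ) - (s : ℝ))))

/-! ### Cylindrical functions and their gradient -/

/-- A presentation `γ ↦ f(γ(s₁), …, γ(s_k))` of a cylindrical function, with
`0 < s₁ < ⋯ < s_k = 1`, `k ≥ 1`, and `f` smooth such that `f` and all its derivatives have
polynomial growth. The number of time points is `n + 1`. -/
structure Cyl (d : ℕ) where
  /-- the number of time points, minus one -/
  n : ℕ
  /-- the time points -/
  s : Fin (n + 1) → unitInterval
  strictMono : StrictMono s
  pos : 0 < s 0
  last : s (Fin.last n) = 1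
  /-- the function of the values at the time points -/
  f : (Fin (n + 1) → E d) → ℝ
  growth : Function.HasTemperateGrowth f

/-- The function on `Ω` given by a presentation. -/
def Cyl.toFun {d : ℕ} (R : Cyl d) (γ : PathSpace d) : ℝ :=
  R.f (fun i => γ.1 (R.s i))

/-- The gradient of `f` relative to the `i`-th variable, the others being held fixed, at
`(γ(s₁), …, γ(s_k))`. -/
def Cyl.partialGrad {d : ℕ} (R : Cyl d) (γ : PathSpace d) (i : Fin (R.n + 1)) : E d :=
  gradient (fun y : E d => R.f (Function.update (fun l => γ.1 (R.s l)) i y)) (γ.1 (R.s i))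

/-- `D_s F(γ) = ∑ᵢ (sᵢ ∧ s) (∇_{sᵢ} f)(γ)`. -/
def Cyl.grad {d : ℕ} (R : Cyl d) (γ : PathSpace d) (s : ℝ) : E d :=
  ∑ i, min (R.s i : ℝ) s • R.partialGrad γ i

/-- All time points are dyadic: they lie in `{l / 2^m : 1 ≤ l ≤ 2^m}` for some `m`. -/
def Cyl.IsDyadic {d : ℕ} (R : Cyl d) : Prop :=
  ∃ m : ℕ, ∀ i, ∃ l : ℕ, 1 ≤ l ∧ l ≤ 2 ^ m ∧ (R.s i : ℝ) = (l : ℝ) / 2 ^ m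

/-- `Z`: all cylindrical functions. -/
def Z (d : ℕ) : Set (PathSpace d → ℝ) := {F | ∃ R : Cyl d, R.toFun = F}

/-- `Y`: the cylindrical functions based on dyadic times. -/
def Y (d : ℕ) : Set (PathSpace d → ℝ) := {F | ∃ R : Cyl d, R.IsDyadic ∧ R.toFun = F}

open Classical in
/-- The gradient `D F` of a cylindrical function, `s ↦ D_s F(γ)`, computed from a presentation
of `F`; by `D_toFun` it does not depend on the presentation. -/
def D {d : ℕ} (F : PathSpace d → ℝ) (γ : PathSpace d) : ℝ → E d :=
  if h : ∃ R : Cyl d, R.toFun = F then h.choose.grad γ else 0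

/-- The path `γ + t (s ∧ ·) v`. -/
def shift {d : ℕ} (γ : PathSpace d) (s : unitInterval) (v : E d) (t : ℝ) : PathSpace d :=
  ⟨γ.1 + ⟨fun u : unitInterval => (t * min (u : ℝ) (s : ℝ)) • v, by fun_prop⟩, by
    rw [ContinuousMap.add_apply, γ.2, zero_add]
    change (t * min ((0 : unitInterval) : ℝ) (s : ℝ)) • v = 0
    rw [Set.Icc.coe_zero, min_eq_left s.2.1, mul_zero, zero_smul]⟩

lemma Cyl.hasDerivAt_shift {d : ℕ} (R : Cyl d) (γ : PathSpace d) (s : unitInterval) (v : E d) :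
    HasDerivAt (fun t => R.toFun (shift γ s v t)) (inner ℝ (R.grad γ s) v) 0 := by
  have hdiff : DifferentiableAt ℝ R.f (fun i => γ.1 (R.s i)) :=
    (R.growth.1.differentiable (by simp)).differentiableAt
  have hcurve : HasDerivAt
      (fun (t : ℝ) (i : Fin (R.n + 1)) => γ.1 (R.s i) + (t * min (R.s i : ℝ) (s : ℝ)) • v)
      (fun i => min (R.s i : ℝ) (s : ℝ) • v) 0 := by
    rw [hasDerivAt_pi]
    intro i
    have h1 : HasDerivAt (fun t : ℝ => t * min (R.s i : ℝ) (s : ℝ))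
        (min (R.s i : ℝ) (s : ℝ)) 0 := by
      simpa using (hasDerivAt_id (0 : ℝ)).mul_const (min (R.s i : ℝ) (s : ℝ))
    exact (h1.smul_const v).const_add _
  have h0 : (fun i => γ.1 (R.s i) + ((0 : ℝ) * min (R.s i : ℝ) (s : ℝ)) • v)
      = fun i => γ.1 (R.s i) := by
    funext i; simp
  have hcomp := HasFDerivAt.comp_hasDerivAt (0 : ℝ)
    (l := R.f) (l' := fderiv ℝ R.f (fun i => γ.1 (R.s i)))
    (by rw [h0]; exact hdiff.hasFDerivAt) hcurve
  have hpart : ∀ i (w : E d), inner ℝ (R.partialGrad γ i) w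
      = fderiv ℝ R.f (fun i => γ.1 (R.s i)) (Pi.single i w) := by
    intro i w
    have hu : HasFDerivAt (fun y : E d => Function.update (fun l => γ.1 (R.s l)) i y)
        (ContinuousLinearMap.pi (Pi.single i (ContinuousLinearMap.id ℝ (E d))))
        (γ.1 (R.s i)) := hasFDerivAt_update (E := fun _ => E d) _ _
    have hself : Function.update (fun l => γ.1 (R.s l)) i (γ.1 (R.s i))
        = fun l => γ.1 (R.s l) := Function.update_eq_self i (fun l => γ.1 (R.s l))
    have hc := HasFDerivAt.comp (γ.1 (R.s i)) (g := R.f)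
      (g' := fderiv ℝ R.f (fun i => γ.1 (R.s i)))
      (by rw [hself]; exact hdiff.hasFDerivAt) hu
    have hg : inner ℝ (R.partialGrad γ i) w = fderiv ℝ
        (R.f ∘ fun y : E d => Function.update (fun l => γ.1 (R.s l)) i y) (γ.1 (R.s i)) w := by
      unfold Cyl.partialGrad gradient
      rw [InnerProductSpace.toDual_symm_apply]
      rfl
    rw [hg, hc.fderiv, ContinuousLinearMap.comp_apply]
    congr 1
    funext l
    by_cases hl : l = i
    · subst hl; simp
    · simp [hl]
  suffices hval : inner ℝ (R.grad γ s) v = fderiv ℝ R.f (fun i => γ.1 (R.s i))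
      (fun i => min (R.s i : ℝ) (s : ℝ) • v) by
    rw [hval]; exact hcomp
  unfold Cyl.grad
  rw [sum_inner]
  have hsum : (fun i => min (R.s i : ℝ) (s : ℝ) • v)
      = ∑ i, Pi.single (M := fun _ : Fin (R.n + 1) => E d) i (min (R.s i : ℝ) (s : ℝ) • v) :=
    (Finset.univ_sum_single _).symm
  rw [hsum, map_sum]
  refine Finset.sum_congr rfl fun i _ => ?_
  rw [← hpart, real_inner_smul_left, real_inner_smul_right]

/-- The gradient is independent of the presentation. -/
theorem D_toFun {d : ℕ} (R : Cyl d) (γ : PathSpace d) (s : unitInterval) :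
    D R.toFun γ s = R.grad γ s := by
  have h : ∃ R' : Cyl d, R'.toFun = R.toFun := ⟨R, rfl⟩
  have hD : D R.toFun γ = h.choose.grad γ := by
    unfold D
    rw [dif_pos h]
  rw [hD]
  refine ext_inner_right ℝ fun v => ?_
  have h1 := h.choose.hasDerivAt_shift γ s v
  rw [h.choose_spec] at h1
  exact h1.unique (R.hasDerivAt_shift γ s v)

/-! ### Cameron–Martin inner product, Haar and Schauder functions -/

/-- The Cameron–Martin inner product `∫₀¹ ⟨φ'(x), ψ'(x)⟩ dx`. -/
def cmInner {d : ℕ} (φ ψ : ℝ → E d) : ℝ :=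
  ∫ x in (0 : ℝ)..1, inner ℝ (deriv φ x) (deriv ψ x)

/-- The Haar functions `H₁, H₂, …`: `H₁ = 1`, and for `n = 2^m + k` with `1 ≤ k ≤ 2^m` the value is
`2^{m/2}` on `[(k-1)/2^m, (2k-1)/2^{m+1})`, `-2^{m/2}` on `[(2k-1)/2^{m+1}, k/2^m)`,
and `0` elsewhere. (For `n ≥ 2`, `m` is the integer part of `log₂ (n - 1)`.) -/
def haar (n : ℕ) (t : ℝ) : ℝ :=
  if n ≤ 1 then 1
  else
    let m : ℕ := Nat.log 2 (n - 1)
    let k : ℝ := (n : ℝ) - 2 ^ m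
    if (k - 1) / 2 ^ m ≤ t ∧ t < (2 * k - 1) / 2 ^ (m + 1) then (2 : ℝ) ^ ((m : ℝ) / 2)
    else if (2 * k - 1) / 2 ^ (m + 1) ≤ t ∧ t < k / 2 ^ m then -(2 : ℝ) ^ ((m : ℝ) / 2)
    else 0

/-- `g_{d(r-1)+j} = H_r e_j`, `r ≥ 1`, `1 ≤ j ≤ d`; see `g_eq`. -/
def g (d : ℕ) [NeZero d] (n : ℕ) (u : ℝ) : E d :=
  haar ((n - 1) / d + 1) u • EuclideanSpace.single (Fin.ofNat d (n - 1)) (1 : ℝ)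

theorem g_eq (d : ℕ) [NeZero d] (r : ℕ) (hr : 1 ≤ r) (j : Fin d) (u : ℝ) :
    g d (d * (r - 1) + ((j : ℕ) + 1)) u = haar r u • EuclideanSpace.single j (1 : ℝ) := by
  obtain ⟨q, rfl⟩ : ∃ q, r = q + 1 := ⟨r - 1, by omega⟩
  have hd : 0 < d := NeZero.pos d
  have h1 : d * (q + 1 - 1) + ((j : ℕ) + 1) - 1 = d * q + (j : ℕ) := by simp [← add_assoc]
  have h2 : (d * q + (j : ℕ)) / d = q := by
    rw [Nat.mul_add_div hd, Nat.div_eq_of_lt j.2, add_zero]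
  have h3 : Fin.ofNat d (d * q + (j : ℕ)) = j := by
    apply Fin.ext
    simp [Fin.ofNat, Nat.mod_eq_of_lt j.2]
  unfold g
  rw [h1, h2, h3]

/-- The Schauder functions `S_n(s) = ∫₀ˢ g_n(u) du`, `n ≥ 1`. -/
def S (d : ℕ) [NeZero d] (n : ℕ) (s : ℝ) : E d := ∫ u in (0 : ℝ)..s, g d n u

/-! ### The form -/

/-- `𝓔(F, G) = ∑_{i ≥ 1} λ_i ∫ ⟨S_i, DF⟩ ⟨S_i, DG⟩ dμ`, with inner products in the
Cameron–Martin space; `μ` is the measure `φ ν`. -/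
def form {d : ℕ} [NeZero d] (lam : ℕ → ℝ) (μ : Measure (PathSpace d))
    (F G : PathSpace d → ℝ) : ℝ :=
  ∑' i : ℕ, lam (i + 1) *
    ∫ γ, cmInner (S d (i + 1)) (D F γ) * cmInner (S d (i + 1)) (D G γ) ∂μ

/-- `𝓔` is well defined on `V ⊆ L²(μ)`: all integrals exist and the series converges. -/
def FormWellDefined {d : ℕ} [NeZero d] (lam : ℕ → ℝ) (μ : Measure (PathSpace d))
    (V : Set (PathSpace d → ℝ)) : Prop :=
  (∀ F ∈ V, MemLp F 2 μ) ∧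
  ∀ F ∈ V, ∀ G ∈ V,
    (∀ i : ℕ, Integrable
      (fun γ => cmInner (S d (i + 1)) (D F γ) * cmInner (S d (i + 1)) (D G γ)) μ) ∧
    Summable (fun i : ℕ => lam (i + 1) *
      ∫ γ, cmInner (S d (i + 1)) (D F γ) * cmInner (S d (i + 1)) (D G γ) ∂μ)

/-! ### Closability and closure of a form on `L²(μ)` -/

section Closure

variable {X : Type*} [MeasurableSpace X]

/-- `(F_n)` is a sequence in `V` that is Cauchy for the form `Q` and converges to `u`
in `L²(μ)`. -/
structure IsApprox (μ : Measure X) (V : Set (X → ℝ)) (Q : (X → ℝ) → (X → ℝ) → ℝ)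
    (u : X → ℝ) (F : ℕ → X → ℝ) : Prop where
  mem : ∀ n, F n ∈ V
  tendsto : Tendsto (fun n => eLpNorm (F n - u) 2 μ) atTop (𝓝 0)
  cauchy : Tendsto (fun p : ℕ × ℕ => Q (F p.1 - F p.2) (F p.1 - F p.2)) atTop (𝓝 0)

/-- The form `(Q, V)` is closable in `L²(μ)`: if `F_n ∈ V` is `Q`-Cauchy and `F_n → 0` in
`L²(μ)`, then `Q(F_n, F_n) → 0`. -/
def IsClosable (μ : Measure X) (V : Set (X → ℝ)) (Q : (X → ℝ) → (X → ℝ) → ℝ) : Prop :=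
  ∀ F : ℕ → X → ℝ, IsApprox μ V Q 0 F → Tendsto (fun n => Q (F n) (F n)) atTop (𝓝 0)

/-- The domain of the closure of `(Q, V)` in `L²(μ)`, as the set of all representatives of its
elements. -/
def closureDomain (μ : Measure X) (V : Set (X → ℝ)) (Q : (X → ℝ) → (X → ℝ) → ℝ) :
    Set (X → ℝ) :=
  {u | MemLp u 2 μ ∧ ∃ F, IsApprox μ V Q u F}

/-- The graph of the closure of `(Q, V)`: all `(u, v, a)` with `u, v` in the domain of the closure
and `a = lim Q(F_n, G_n)` for approximating sequences `F_n → u`, `G_n → v` in `V`. -/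
def closureGraph (μ : Measure X) (V : Set (X → ℝ)) (Q : (X → ℝ) → (X → ℝ) → ℝ) :
    Set ((X → ℝ) × (X → ℝ) × ℝ) :=
  {w | MemLp w.1 2 μ ∧ MemLp w.2.1 2 μ ∧ ∃ F G, IsApprox μ V Q w.1 F ∧ IsApprox μ V Q w.2.1 G ∧
    Tendsto (fun n => Q (F n) (G n)) atTop (𝓝 w.2.2)}

end Closure

/-! ### The summability condition -/

/-- `i_{p,j} = 2^{p-1}(d+j-1) + 1 + ∑_{q=0}^{p-1} c_q 2^{p-q-1}`, for `p ≥ 1` and `j ≥ 1`. -/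
def idx (d : ℕ) (c : ℕ → ℕ) (p j : ℕ) : ℕ :=
  2 ^ (p - 1) * (d + j - 1) + 1 + ∑ q ∈ Finset.range p, c q * 2 ^ (p - q - 1)

/-- `∑_{p ≥ 1} λ_{i_{p,j}} / 2^p < ∞` for all `j ∈ {1, …, d}`. -/
def SummabilityCond (d : ℕ) (lam : ℕ → ℝ) (c : ℕ → ℕ) : Prop :=
  ∀ j : ℕ, 1 ≤ j → j ≤ d →
    Summable (fun p : ℕ => lam (idx d c (p + 1) j) / 2 ^ (p + 1))

end WienerForm

end

/-! Closability reduces to one direction at a time. Write ∂_i F = ⟨S_i, DF⟩ and μ = φν. Under Wiener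
measure ∂_i has an adjoint on cylindrical functions, ∂_i* G = G X − ∂_i G, where X is the Wiener
integral of g_i, and it maps Z into Z. If F_n → 0 and ∂_i F_n → w in L²(μ), pair with G/φ: this lies
in L²(μ) because ∫ (G/φ)² dμ = ∫ G²/φ dν is finite, and the weight cancels, so ∫ w G dν = lim ∫ F_n
(∂_i* G) dν = 0 for every G in Z. Since Z contains cosines and sines of linear functionals of
finitely many values, w = 0 (`tendsto_energy`). A Fatou argument over the directions then gives
closability of the sum of all directions (`form_le_of_tendsto_energy`, `isClosable`).

Finiteness of the form is a matter of the size of the tents. By the chain rule, ∂_i F is a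
combination of the numbers S_i(s_k) at the times s_k of F. At each level m at most one Schauder
function is nonzero at a given time, and its square is at most 2^(-m). By monotonicity of λ, summing
over levels compares the energy with ∑ λ_{d 2^p} / 2^p, and d 2^p ≤ i_{p+1,j} ≤ d 2^(p+1) shows that
this series converges exactly when (∗) holds, whatever the digits c_q (`summabilityCond_iff`). At
dyadic times all tents of high level vanish, so on Y the series is a finite sum and (∗) is not
needed.

If (∗) holds, round the times of F in Z down to dyadic times. Each fixed direction converges by
continuity in L², and the tail over high levels is small uniformly in the times; hence Y is dense in
Z for the form (`exists_dyadic_approx`) and the closures agree (`closure_eq`). Conversely, the point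
1/3 lies at a distance comparable to 2^(-m) from the grid of every level m. If the first coordinate
of γ(1/3) belongs to the closure of Y, lower semicontinuity makes its energy finite, and this energy
dominates a multiple of ∑ λ_{d 2^p} / 2^p (`summable_of_Z_subset`). -/

noncomputable section

namespace WienerForm

/-! ### Primitives of the Haar functions -/

/-- The primitive of the Haar function `H_r`. -/
def schauder (r : ℕ) (s : ℝ) : ℝ := ∫ u in (0 : ℝ)..s, haar r u

/-- The position inside a level is counted from zero: k = l + 1, so the support of the function is
[l/2^m, (l+1)/2^m). -/
lemma haar_level {m l : ℕ} (hl : l < 2 ^ m) (t : ℝ) :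
    haar (2 ^ m + l + 1) t = (2 : ℝ) ^ ((m : ℝ) / 2) *
      ((Set.Ico ((l : ℝ) / 2 ^ m) ((2 * l + 1) / 2 ^ (m + 1))).indicator 1 t -
        (Set.Ico ((2 * l + 1 : ℝ) / 2 ^ (m + 1)) ((l + 1) / 2 ^ m)).indicator 1 t) := by
  have hlog : Nat.log 2 (2 ^ m + l) = m := by
    rw [Nat.log_eq_iff (Or.inr ⟨by norm_num, by positivity⟩)]
    exact ⟨by omega, by rw [pow_succ]; omega⟩
  have h2 : 0 < 2 ^ m := by positivity
  unfold haar
  rw [if_neg (by omega)]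
  simp only [Nat.add_sub_cancel, hlog]
  push_cast
  have e1 : ((2 : ℝ) ^ m + l + 1 - 2 ^ m - 1) = l := by ring
  have e2 : (2 * ((2 : ℝ) ^ m + l + 1 - 2 ^ m) - 1) = 2 * l + 1 := by ring
  have e3 : ((2 : ℝ) ^ m + l + 1 - 2 ^ m) = l + 1 := by ring
  rw [e1, e2, e3]
  by_cases h : (l : ℝ) / 2 ^ m ≤ t ∧ t < (2 * l + 1) / 2 ^ (m + 1)
  · have h' : t ∉ Set.Ico ((2 * l + 1 : ℝ) / 2 ^ (m + 1)) ((l + 1) / 2 ^ m) :=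
      fun h' => absurd h.2 (not_lt.mpr h'.1)
    rw [if_pos h, Set.indicator_of_mem (show t ∈ Set.Ico _ _ from h), Set.indicator_of_notMem h']
    simp
  · rw [if_neg h, Set.indicator_of_notMem (show t ∉ Set.Ico _ _ from h)]
    by_cases h' : (2 * l + 1 : ℝ) / 2 ^ (m + 1) ≤ t ∧ t < (l + 1) / 2 ^ m
    · rw [if_pos h', Set.indicator_of_mem (show t ∈ Set.Ico _ _ from h')]
      simp
    · rw [if_neg h', Set.indicator_of_notMem (show t ∉ Set.Ico _ _ from h')]
      simp

lemma exists_level {r : ℕ} (hr : 2 ≤ r) : ∃ m l : ℕ, l < 2 ^ m ∧ r = 2 ^ m + l + 1 := by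
  have h1 : 2 ^ Nat.log 2 (r - 1) ≤ r - 1 := Nat.pow_log_le_self 2 (by omega)
  have h2 : r - 1 < 2 ^ (Nat.log 2 (r - 1) + 1) := Nat.lt_pow_succ_log_self (by norm_num) _
  refine ⟨Nat.log 2 (r - 1), r - 1 - 2 ^ Nat.log 2 (r - 1), ?_, ?_⟩
  · rw [pow_succ] at h2; omega
  · omega

lemma haar_one (t : ℝ) : haar 1 t = 1 := by simp [haar]

lemma intervalIntegrable_indicator_Ico (x y a b : ℝ) :
    IntervalIntegrable ((Set.Ico x y).indicator (1 : ℝ → ℝ)) volume a b := by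
  have h : Integrable ((Set.Ico x y).indicator (1 : ℝ → ℝ)) volume :=
    (integrable_indicator_iff measurableSet_Ico).mpr
      (integrable_const (1 : ℝ) : Integrable (fun _ => (1 : ℝ)) (volume.restrict (Set.Ico x y)))
  exact h.intervalIntegrable

lemma integral_indicator_Ico {x y s : ℝ} (hx : 0 ≤ x) (hxy : x ≤ y) (hs : 0 ≤ s) :
    ∫ u in (0 : ℝ)..s, (Set.Ico x y).indicator (1 : ℝ → ℝ) u = min s y - min s x := by
  rw [intervalIntegral.integral_of_le hs, setIntegral_indicator measurableSet_Ico]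
  have h1 : (Set.Ioc 0 s ∩ Set.Ico x y : Set ℝ) =ᵐ[volume] (Set.Ioc 0 s ∩ Set.Ioc x y : Set ℝ) :=
    (ae_eq_refl _).inter Ico_ae_eq_Ioc
  rw [setIntegral_congr_set h1, Set.Ioc_inter_Ioc]
  simp only [Pi.one_apply, integral_const, MeasurableSet.univ, measureReal_restrict_apply,
    Set.univ_inter, smul_eq_mul, mul_one, Real.volume_real_Ioc]
  have h2 : (0 : ℝ) ⊔ x = x := max_eq_right hx
  rw [h2]
  rcases le_total s x with h | h
  · rw [min_eq_left h, min_eq_left (h.trans hxy)]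
    simp [h]
  · rw [min_eq_right h, max_eq_left]
    exact sub_nonneg.mpr (le_min h hxy)

lemma intervalIntegrable_haar (r : ℕ) (hr : 1 ≤ r) (a b : ℝ) :
    IntervalIntegrable (haar r) volume a b := by
  rcases eq_or_lt_of_le hr with rfl | hr
  · have : haar 1 = fun _ => 1 := funext haar_one
    rw [this]
    exact intervalIntegrable_const
  · obtain ⟨m, l, hl, rfl⟩ := exists_level hr
    have : haar (2 ^ m + l + 1) = fun t => _ := funext (haar_level hl)
    rw [this]
    exact ((intervalIntegrable_indicator_Ico _ _ _ _).sub
      (intervalIntegrable_indicator_Ico _ _ _ _)).const_mul _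

lemma schauder_one (s : ℝ) : schauder 1 s = s := by
  simp [schauder, haar_one]

/-- The primitive of the indicator of [x, y) is (s ∧ y) − (s ∧ x). The tent is therefore a second
difference of functions s ∧ t, with t an endpoint or the midpoint of the support. -/
lemma schauder_level {m l : ℕ} (hl : l < 2 ^ m) {s : ℝ} (hs : 0 ≤ s) :
    schauder (2 ^ m + l + 1) s = (2 : ℝ) ^ ((m : ℝ) / 2) *
      (2 * min s ((2 * l + 1) / 2 ^ (m + 1)) - min s (l / 2 ^ m) - min s ((l + 1) / 2 ^ m)) := by
  unfold schauder
  simp_rw [haar_level hl]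
  rw [intervalIntegral.integral_const_mul, intervalIntegral.integral_sub
    (intervalIntegrable_indicator_Ico _ _ _ _) (intervalIntegrable_indicator_Ico _ _ _ _),
    integral_indicator_Ico (by positivity) _ hs, integral_indicator_Ico (by positivity) _ hs]
  · ring
  · rw [div_le_div_iff₀ (by positivity) (by positivity), pow_succ]
    nlinarith [show (0 : ℝ) < 2 ^ m by positivity]
  · rw [div_le_div_iff₀ (by positivity) (by positivity), pow_succ]
    nlinarith [show (0 : ℝ) < 2 ^ m by positivity]

/-- Each Schauder function is a combination of the functions `s ↦ s ∧ t`. -/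
lemma exists_schauder_eq_sum_min (r : ℕ) (hr : 1 ≤ r) :
    ∃ (c : Fin 3 → ℝ) (t : Fin 3 → unitInterval), ∀ s : unitInterval,
      schauder r s = ∑ a, c a * min (s : ℝ) (t a) := by
  rcases eq_or_lt_of_le hr with rfl | hr
  -- On [0,1] the identity is s ∧ 1; the other two terms are padding.
  · refine ⟨![1, 0, 0], ![1, 0, 0], fun s => ?_⟩
    simp [Fin.sum_univ_three, schauder_one, s.2.2]
  · obtain ⟨m, l, hl, rfl⟩ := exists_level hr
    have hl' : (l : ℝ) + 1 ≤ 2 ^ m := by exact_mod_cast hl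
    have h2 : (0 : ℝ) < 2 ^ m := by positivity
    refine ⟨![2 * (2 : ℝ) ^ ((m : ℝ) / 2), -(2 : ℝ) ^ ((m : ℝ) / 2), -(2 : ℝ) ^ ((m : ℝ) / 2)],
      ![⟨(2 * l + 1) / 2 ^ (m + 1), by positivity, ?_⟩, ⟨l / 2 ^ m, by positivity, ?_⟩,
        ⟨(l + 1) / 2 ^ m, by positivity, ?_⟩], fun s => ?_⟩
    · rw [div_le_one (by positivity), pow_succ]; linarith
    · rw [div_le_one (by positivity)]; linarith
    · rw [div_le_one (by positivity)]; linarith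
    · rw [schauder_level hl s.2.1]
      simp [Fin.sum_univ_three]
      ring

lemma continuous_schauder (r : ℕ) (hr : 1 ≤ r) : Continuous (schauder r) :=
  intervalIntegral.continuous_primitive (intervalIntegrable_haar r hr) 0

lemma schauder_zero (r : ℕ) : schauder r 0 = 0 := by simp [schauder]

lemma rpow_half_sq (m : ℕ) : ((2 : ℝ) ^ ((m : ℝ) / 2)) ^ 2 = 2 ^ m := by
  rw [← Real.rpow_natCast, ← Real.rpow_mul (by norm_num)]
  simp

/-- At the level `m`, only the Schauder function whose support contains `s` is nonzero at `s`. -/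
lemma schauder_eq_zero {m l : ℕ} (hl : l < 2 ^ m) {s : ℝ} (hs : 0 ≤ s)
    (h : l ≠ ⌊s * 2 ^ m⌋₊) : schauder (2 ^ m + l + 1) s = 0 := by
  rw [schauder_level hl hs]
  have h2 : (0 : ℝ) < 2 ^ m := by positivity
  rcases lt_or_gt_of_ne h with h | h
  · have h3 : ((l + 1 : ℕ) : ℝ) ≤ s * 2 ^ m := (Nat.le_floor_iff (by positivity)).mp h
    push_cast at h3
    have h4 : ((l : ℝ) + 1) / 2 ^ m ≤ s := by rwa [div_le_iff₀ h2]
    have h5 : (2 * (l : ℝ) + 1) / 2 ^ (m + 1) ≤ s := by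
      rw [div_le_iff₀ (by positivity), pow_succ]; linarith
    have h6 : (l : ℝ) / 2 ^ m ≤ s := by rw [div_le_iff₀ h2]; linarith
    rw [min_eq_right h4, min_eq_right h5, min_eq_right h6, pow_succ]
    field_simp
    ring
  · have h3 : s * 2 ^ m < l := (Nat.floor_lt (by positivity)).mp h
    have h4 : s ≤ ((l : ℝ) + 1) / 2 ^ m := by rw [le_div_iff₀ h2]; linarith
    have h5 : s ≤ (2 * (l : ℝ) + 1) / 2 ^ (m + 1) := by
      rw [le_div_iff₀ (by positivity), pow_succ]; linarith
    have h6 : s ≤ (l : ℝ) / 2 ^ m := by rw [le_div_iff₀ h2]; linarith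
    rw [min_eq_left h4, min_eq_left h5, min_eq_left h6]
    ring

/-- The second difference is at most δ = 2^(-m), the length of the support, and the normalisation
contributes 2^m to the square. The constant is not optimal; only the order 2^(-m) matters. -/
lemma schauder_sq_le {m l : ℕ} (hl : l < 2 ^ m) {s : ℝ} (hs : 0 ≤ s) :
    schauder (2 ^ m + l + 1) s ^ 2 ≤ 1 / 2 ^ m := by
  rw [schauder_level hl hs, mul_pow, rpow_half_sq]
  have h2 : (0 : ℝ) < 2 ^ m := by positivity
  set a : ℝ := l / 2 ^ m
  have hb : ((l : ℝ) + 1) / 2 ^ m = a + 1 / 2 ^ m := by rw [add_div]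
  have hm : (2 * (l : ℝ) + 1) / 2 ^ (m + 1) = a + 1 / 2 ^ m / 2 := by
    simp only [a, pow_succ]; field_simp
  rw [hb, hm]
  set δ : ℝ := 1 / 2 ^ m with hδ
  have hδ0 : 0 < δ := by positivity
  have hx : (2 * min s (a + δ / 2) - min s a - min s (a + δ)) ^ 2 ≤ δ ^ 2 := by
    apply sq_le_sq'
    · rcases min_cases s (a + δ / 2) with h | h <;> rcases min_cases s a with h' | h' <;>
      rcases min_cases s (a + δ) with h'' | h'' <;> rw [h.1, h'.1, h''.1] <;> linarith
    · rcases min_cases s (a + δ / 2) with h | h <;> rcases min_cases s a with h' | h' <;>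
      rcases min_cases s (a + δ) with h'' | h'' <;> rw [h.1, h'.1, h''.1] <;> linarith
  calc (2 : ℝ) ^ m * _ ≤ 2 ^ m * δ ^ 2 := by gcongr
    _ = δ := by rw [hδ]; field_simp

/-- Schauder functions of a high level vanish at dyadic points. -/
lemma schauder_dyadic_eq_zero {m l n k : ℕ} (hl : l < 2 ^ m) (hnm : n ≤ m) {s : ℝ}
    (hs : s = k / 2 ^ n) : schauder (2 ^ m + l + 1) s = 0 := by
  have hs0 : 0 ≤ s := by rw [hs]; positivity
  by_cases h : l = ⌊s * 2 ^ m⌋₊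
  · obtain ⟨j, rfl⟩ := Nat.exists_eq_add_of_le hnm
    have h1 : s * 2 ^ (n + j) = ((k * 2 ^ j : ℕ) : ℝ) := by
      rw [hs, pow_add]; push_cast; field_simp
    rw [h1, Nat.floor_natCast] at h
    -- As n ≤ m, the point s belongs to the grid of level m, so it is the left endpoint of its
    -- interval and all three minima equal s.
    have h3 : (l : ℝ) = s * 2 ^ (n + j) := by rw [h1, h]
    have h4 : (0 : ℝ) < 2 ^ (n + j) := by positivity
    rw [schauder_level hl hs0, min_eq_left, min_eq_left, min_eq_left]
    · ring
    · rw [le_div_iff₀ h4]; linarith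
    · rw [le_div_iff₀ h4]; linarith
    · rw [le_div_iff₀ (by positivity), pow_succ]; linarith
  · exact schauder_eq_zero hl hs0 h

/-- The point `1/3` stays away from all dyadic points, relative to their level. -/
lemma schauder_one_third_sq (m : ℕ) :
    2 ^ m / 3 < 2 ^ m ∧ schauder (2 ^ m + 2 ^ m / 3 + 1) (1 / 3) ^ 2 = 1 / 2 ^ m / 9 := by
  have h0 : 0 < 2 ^ m := by positivity
  have hl : 2 ^ m / 3 < 2 ^ m := Nat.div_lt_self h0 (by norm_num)
  refine ⟨hl, ?_⟩
  -- The remainder r of 2^m modulo 3 gives the relative position r/3 of the point 1/3 in its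
  -- interval of level m. In both cases the nearer endpoint is at distance 2^(-m)/3, whence the
  -- factor 1/9 after squaring.
  have hmod : 2 ^ m % 3 = 1 ∨ 2 ^ m % 3 = 2 := by
    have h3 : ¬ 3 ∣ 2 ^ m := by
      intro h
      have := Nat.Prime.dvd_of_dvd_pow Nat.prime_three h
      omega
    omega
  have hdiv : 3 * (2 ^ m / 3) + 2 ^ m % 3 = 2 ^ m := Nat.div_add_mod _ _
  have hdiv' : 3 * (((2 ^ m / 3 : ℕ) : ℕ) : ℝ) + ((2 ^ m % 3 : ℕ) : ℝ) = 2 ^ m := by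
    exact_mod_cast hdiv
  have h2 : (0 : ℝ) < 2 ^ m := by positivity
  rw [schauder_level hl (by norm_num), mul_pow, rpow_half_sq]
  set q : ℝ := ((2 ^ m / 3 : ℕ) : ℝ)
  rcases hmod with h | h
  · rw [h] at hdiv'
    push_cast at hdiv'
    rw [min_eq_left, min_eq_right, min_eq_left]
    · have hq : q = (2 ^ m - 1) / 3 := by linarith
      rw [hq]; field_simp; ring
    · rw [le_div_iff₀ h2]; linarith
    · rw [div_le_iff₀ h2]; linarith
    · rw [le_div_iff₀ (by positivity), pow_succ]; linarith
  · rw [h] at hdiv'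
    push_cast at hdiv'
    rw [min_eq_right, min_eq_right, min_eq_left]
    · have hq : q = (2 ^ m - 2) / 3 := by linarith
      rw [hq, pow_succ]; field_simp; ring
    · rw [le_div_iff₀ h2]; linarith
    · rw [div_le_iff₀ h2]; linarith
    · rw [div_le_iff₀ (by positivity), pow_succ]; linarith

/-- With i counted from zero, the quotient of i by d is the Haar index minus one and the remainder
is the coordinate. -/
lemma S_eq (d : ℕ) [NeZero d] (i : ℕ) (s : ℝ) :
    S d (i + 1) s = schauder (i / d + 1) s • EuclideanSpace.single (Fin.ofNat d i) (1 : ℝ) := by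
  unfold S schauder g
  simp only [Nat.add_sub_cancel]
  exact intervalIntegral.integral_smul_const _ _

end WienerForm

namespace WienerForm

variable {d : ℕ}

/-! ### Cylindrical functions with arbitrary time points -/

/-- The values of a path at finitely many time points, in any order and possibly repeated. -/
def ev {ι : Type*} (s : ι → unitInterval) (γ : PathSpace d) : ι → E d := fun i => γ.1 (s i)

/-- Discard the time 0, where paths vanish, adjoin the time 1, and sort. Each original value is a
linear function of the sorted values, and temperate growth survives composition with a linear map.
Sums and products can then be formed without regard to the order of the times; the second clause
keeps track of dyadicity. -/
lemma exists_cyl_toFun_eq {ι : Type*} [Fintype ι] (s : ι → unitInterval) {f : (ι → E d) → ℝ}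
    (hf : f.HasTemperateGrowth) :
    ∃ R : Cyl d, R.toFun = (fun γ => f (ev s γ)) ∧
      ∀ k, R.s k = 1 ∨ ∃ i, R.s k = s i := by
  classical
  let T : Finset unitInterval := insert 1 ((Finset.univ.image s).erase 0)
  have h1 : (1 : unitInterval) ∈ T := Finset.mem_insert_self _ _
  have h0 : (0 : unitInterval) ∉ T := by simp [T]
  obtain ⟨n, hn⟩ : ∃ n, T.card = n + 1 :=
    ⟨T.card - 1, by have := Finset.card_pos.mpr ⟨1, h1⟩; omega⟩
  let e := T.orderEmbOfFin hn
  have he : ∀ t ∈ T, ∃ k, e k = t := fun t ht => by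
    have : t ∈ Set.range e := by rw [Finset.range_orderEmbOfFin]; exact ht
    exact this
  have heT : ∀ k, e k ∈ T := fun k => Finset.orderEmbOfFin_mem T hn k
  have hL : ∀ i, ∃ L : (Fin (n + 1) → E d) →L[ℝ] E d, ∀ γ : PathSpace d, L (ev e γ) = γ.1 (s i) := by
    intro i
    by_cases hi : s i = 0
    · exact ⟨0, fun γ => by simp [hi, γ.2]⟩
    · obtain ⟨k, hk⟩ := he (s i) (by simp [T, hi])
      exact ⟨ContinuousLinearMap.proj k, fun γ => by simp [ev, hk]⟩
  choose L hL using hL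
  refine ⟨⟨n, e, e.strictMono, ?_, ?_, f ∘ ContinuousLinearMap.pi L, ?_⟩, ?_, ?_⟩
  · exact lt_of_le_of_ne (unitInterval.nonneg' ) (fun h => h0 (h ▸ heT 0))
  · obtain ⟨k, hk⟩ := he 1 h1
    refine le_antisymm unitInterval.le_one' ?_
    rw [← hk]
    exact e.monotone (Fin.le_last k)
  · exact hf.comp (ContinuousLinearMap.hasTemperateGrowth _)
  · funext γ
    change f (fun i => L i (ev e γ)) = f (ev s γ)
    simp_rw [hL]
    rfl
  · intro k
    have := heT k
    simp only [T, Finset.mem_insert, Finset.mem_erase, Finset.mem_image, Finset.mem_univ,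
      true_and] at this
    rcases this with h | ⟨-, i, hi⟩
    · exact Or.inl h
    · exact Or.inr ⟨i, hi.symm⟩

lemma mem_Z_of_temperate {ι : Type*} [Fintype ι] (s : ι → unitInterval) {f : (ι → E d) → ℝ}
    (hf : f.HasTemperateGrowth) : (fun γ => f (ev s γ)) ∈ Z d :=
  let ⟨R, hR, _⟩ := exists_cyl_toFun_eq s hf
  ⟨R, hR⟩

/-- A dyadic time, `0` included. -/
def IsDyadicTime (t : unitInterval) : Prop := ∃ m l : ℕ, (t : ℝ) = l / 2 ^ m

lemma IsDyadicTime.exists_of_le {t : unitInterval} {m l n : ℕ} (h : (t : ℝ) = l / 2 ^ m)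
    (hmn : m ≤ n) : ∃ l' : ℕ, (t : ℝ) = l' / 2 ^ n := by
  obtain ⟨j, rfl⟩ := Nat.exists_eq_add_of_le hmn
  exact ⟨l * 2 ^ j, by rw [h, pow_add]; push_cast; field_simp⟩

/-- Finitely many dyadic times have a common denominator. -/
lemma exists_common_level {ι : Type*} [Finite ι] {s : ι → unitInterval}
    (hs : ∀ i, IsDyadicTime (s i)) : ∃ m : ℕ, ∀ i, ∃ l : ℕ, (s i : ℝ) = l / 2 ^ m := by
  have := Fintype.ofFinite ι
  choose m l h using hs
  exact ⟨Finset.univ.sup m, fun i => IsDyadicTime.exists_of_le (h i)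
    (Finset.le_sup (Finset.mem_univ i))⟩

lemma mem_Y_of_temperate {ι : Type*} [Fintype ι] (s : ι → unitInterval)
    (hs : ∀ i, IsDyadicTime (s i)) {f : (ι → E d) → ℝ}
    (hf : f.HasTemperateGrowth) : (fun γ => f (ev s γ)) ∈ Y d := by
  obtain ⟨R, hR, hRs⟩ := exists_cyl_toFun_eq s hf
  refine ⟨R, ?_, hR⟩
  have hd : ∀ k, IsDyadicTime (R.s k) := by
    intro k
    rcases hRs k with h | ⟨i, h⟩
    · exact ⟨0, 1, by simp [h]⟩
    · rw [h]; exact hs i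
  obtain ⟨m, hm⟩ := exists_common_level hd
  refine ⟨m, fun k => ?_⟩
  obtain ⟨l, hl⟩ := hm k
  have h2 : (0 : ℝ) < 2 ^ m := by positivity
  have hpos : (0 : ℝ) < R.s k := lt_of_lt_of_le R.pos (R.strictMono.monotone (Fin.zero_le k))
  refine ⟨l, ?_, ?_, hl⟩
  · rcases Nat.eq_zero_or_pos l with h | h
    · rw [hl, h] at hpos; simp at hpos
    · exact h
  · have := (R.s k).2.2
    rw [hl, div_le_one h2] at this
    exact_mod_cast this

lemma exists_rep_of_mem_Z {F : PathSpace d → ℝ} (hF : F ∈ Z d) :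
    ∃ (n : ℕ) (s : Fin n → unitInterval) (f : (Fin n → E d) → ℝ), f.HasTemperateGrowth ∧
      F = fun γ => f (ev s γ) := by
  obtain ⟨R, rfl⟩ := hF
  exact ⟨R.n + 1, R.s, R.f, R.growth, rfl⟩

lemma exists_rep_of_mem_Y {F : PathSpace d → ℝ} (hF : F ∈ Y d) :
    ∃ (n : ℕ) (s : Fin n → unitInterval) (f : (Fin n → E d) → ℝ), f.HasTemperateGrowth ∧
      (∀ i, IsDyadicTime (s i)) ∧ F = fun γ => f (ev s γ) := by
  obtain ⟨R, ⟨m, hm⟩, rfl⟩ := hF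
  exact ⟨R.n + 1, R.s, R.f, R.growth, fun i => by
    obtain ⟨l, -, -, h⟩ := hm i
    exact ⟨m, l, h⟩, rfl⟩

lemma Y_subset_Z : Y d ⊆ Z d := by
  rintro F ⟨R, -, h⟩
  exact ⟨R, h⟩

/-- Two functions of values at finitely many times are functions of the values at a common set
of times. -/
lemma temperate_comp_inl {ι κ : Type*} [Fintype ι] [Fintype κ] {f : (ι → E d) → ℝ}
    (hf : f.HasTemperateGrowth) :
    (fun x : ι ⊕ κ → E d => f (fun i => x (Sum.inl i))).HasTemperateGrowth :=
  hf.comp (ContinuousLinearMap.hasTemperateGrowth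
    (ContinuousLinearMap.pi fun i => ContinuousLinearMap.proj (R := ℝ) (φ := fun _ => E d)
      (Sum.inl i : ι ⊕ κ)))

lemma temperate_comp_inr {ι κ : Type*} [Fintype ι] [Fintype κ] {f : (κ → E d) → ℝ}
    (hf : f.HasTemperateGrowth) :
    (fun x : ι ⊕ κ → E d => f (fun i => x (Sum.inr i))).HasTemperateGrowth :=
  hf.comp (ContinuousLinearMap.hasTemperateGrowth
    (ContinuousLinearMap.pi fun i => ContinuousLinearMap.proj (R := ℝ) (φ := fun _ => E d)
      (Sum.inr i : ι ⊕ κ)))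

lemma sub_mem_Z {F G : PathSpace d → ℝ} (hF : F ∈ Z d) (hG : G ∈ Z d) : F - G ∈ Z d := by
  obtain ⟨n, s, f, hf, rfl⟩ := exists_rep_of_mem_Z hF
  obtain ⟨m, t, g, hg, rfl⟩ := exists_rep_of_mem_Z hG
  exact mem_Z_of_temperate (Sum.elim s t)
    ((temperate_comp_inl (κ := Fin m) hf).sub (temperate_comp_inr (ι := Fin n) hg))

lemma mul_mem_Z {F G : PathSpace d → ℝ} (hF : F ∈ Z d) (hG : G ∈ Z d) : F * G ∈ Z d := by
  obtain ⟨n, s, f, hf, rfl⟩ := exists_rep_of_mem_Z hF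
  obtain ⟨m, t, g, hg, rfl⟩ := exists_rep_of_mem_Z hG
  exact mem_Z_of_temperate (Sum.elim s t)
    ((temperate_comp_inl (κ := Fin m) hf).mul (temperate_comp_inr (ι := Fin n) hg))

lemma const_mem_Z (c : ℝ) : (fun _ => c) ∈ Z d :=
  mem_Z_of_temperate (ι := Fin 0) (fun _ => 0) (f := fun _ => c) (.const c)

lemma sub_mem_Y {F G : PathSpace d → ℝ} (hF : F ∈ Y d) (hG : G ∈ Y d) : F - G ∈ Y d := by
  obtain ⟨n, s, f, hf, hs, rfl⟩ := exists_rep_of_mem_Y hF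
  obtain ⟨m, t, g, hg, ht, rfl⟩ := exists_rep_of_mem_Y hG
  exact mem_Y_of_temperate (Sum.elim s t) (by rintro (i | i); exacts [hs i, ht i])
    ((temperate_comp_inl (κ := Fin m) hf).sub (temperate_comp_inr (ι := Fin n) hg))

/-- The linear functionals `γ ↦ ⟨γ(t), e_j⟩` are cylindrical. -/
lemma coord_mem_Z (t : unitInterval) (j : Fin d) : (fun γ : PathSpace d => γ.1 t j) ∈ Z d :=
  mem_Z_of_temperate (ι := Fin 1) (fun _ => t) (f := fun x => x 0 j)
    (ContinuousLinearMap.hasTemperateGrowth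
      ((EuclideanSpace.proj j).comp (ContinuousLinearMap.proj (R := ℝ) (φ := fun _ : Fin 1 => E d) 0)))

lemma sum_coord_mem_Z {α : Type*} [Fintype α] (c : α → ℝ) (t : α → unitInterval) (j : Fin d) :
    (fun γ : PathSpace d => ∑ a, c a * γ.1 (t a) j) ∈ Z d :=
  mem_Z_of_temperate t (f := fun x => ∑ a, c a * x a j)
    (.sum fun a _ => (Function.HasTemperateGrowth.const _).mul
      (ContinuousLinearMap.hasTemperateGrowth
      ((EuclideanSpace.proj j).comp (ContinuousLinearMap.proj (R := ℝ) (φ := fun _ => E d) a))))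

lemma measurable_eval (t : unitInterval) : Measurable (fun γ : PathSpace d => γ.1 t) := by
  intro A hA
  have : MeasurableSpace.comap (fun γ : PathSpace d => γ.1 t) inferInstance ≤
    (instMeasurableSpacePathSpace d) := le_iSup (fun t : unitInterval =>
      MeasurableSpace.comap (fun γ : PathSpace d => γ.1 t) inferInstance) t
  exact this _ ⟨A, hA, rfl⟩

lemma measurable_ev {ι : Type*} (s : ι → unitInterval) : Measurable (ev (d := d) s) :=
  measurable_pi_lambda _ fun i => measurable_eval (s i)

lemma measurable_of_mem_Z {F : PathSpace d → ℝ} (hF : F ∈ Z d) : Measurable F := by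
  obtain ⟨n, s, f, hf, rfl⟩ := exists_rep_of_mem_Z hF
  exact hf.1.continuous.measurable.comp (measurable_ev s)

/-! ### Directional derivatives -/

/-- The path `γ + t h`. -/
def translate (γ h : PathSpace d) (t : ℝ) : PathSpace d :=
  ⟨γ.1 + t • h.1, by simp [γ.2, h.2]⟩

lemma translate_zero (γ h : PathSpace d) : translate γ h 0 = γ :=
  Subtype.ext (ContinuousMap.ext fun u => by simp [translate])

lemma hasDerivAt_translate {ι : Type*} [Fintype ι] (s : ι → unitInterval) {f : (ι → E d) → ℝ}
    (hf : f.HasTemperateGrowth) (γ h : PathSpace d) :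
    HasDerivAt (fun t => f (ev s (translate γ h t))) (fderiv ℝ f (ev s γ) (ev s h)) 0 := by
  have hdiff : DifferentiableAt ℝ f (ev s γ) := (hf.1.differentiable (by simp)).differentiableAt
  have hcurve : HasDerivAt (fun t : ℝ => ev s γ + t • ev s h) (ev s h) 0 := by
    simpa using ((hasDerivAt_id (0 : ℝ)).smul_const (ev s h)).const_add (ev s γ)
  exact HasFDerivAt.comp_hasDerivAt (0 : ℝ) (l := f) (f := fun t : ℝ => ev s γ + t • ev s h)
    (by simpa using hdiff.hasFDerivAt) hcurve

/-- The Schauder function `S_{i+1}` as a path. -/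
def schauderPath (d : ℕ) [NeZero d] (i : ℕ) : PathSpace d :=
  ⟨⟨fun u : unitInterval => S d (i + 1) u, by
    simp_rw [S_eq]
    exact ((continuous_schauder _ (Nat.le_add_left 1 _)).comp continuous_subtype_val).smul continuous_const⟩,
   by simp [S_eq, schauder_zero]⟩

/-- The derivative `⟨S_{i+1}, DF⟩` of `F` in the direction `S_{i+1}`. -/
def cmDeriv (d : ℕ) [NeZero d] (i : ℕ) (F : PathSpace d → ℝ) (γ : PathSpace d) : ℝ :=
  cmInner (S d (i + 1)) (D F γ)

lemma Cyl.inner_partialGrad (R : Cyl d) (γ : PathSpace d) (i : Fin (R.n + 1)) (w : E d) :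
    inner ℝ (R.partialGrad γ i) w = fderiv ℝ R.f (ev R.s γ) (Pi.single i w) := by
  have hdiff : DifferentiableAt ℝ R.f (ev R.s γ) :=
    (R.growth.1.differentiable (by simp)).differentiableAt
  have hu : HasFDerivAt (fun y : E d => Function.update (ev R.s γ) i y)
      (ContinuousLinearMap.pi (Pi.single i (ContinuousLinearMap.id ℝ (E d))))
      (γ.1 (R.s i)) := hasFDerivAt_update (E := fun _ => E d) _ _
  have hself : Function.update (ev R.s γ) i (γ.1 (R.s i)) = ev R.s γ :=
    Function.update_eq_self i (ev R.s γ)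
  have hc := HasFDerivAt.comp (γ.1 (R.s i)) (g := R.f) (g' := fderiv ℝ R.f (ev R.s γ))
    (by rw [hself]; exact hdiff.hasFDerivAt) hu
  have hg : inner ℝ (R.partialGrad γ i) w = fderiv ℝ
      (R.f ∘ fun y : E d => Function.update (ev R.s γ) i y) (γ.1 (R.s i)) w := by
    unfold Cyl.partialGrad gradient
    rw [InnerProductSpace.toDual_symm_apply]
    rfl
  rw [hg, hc.fderiv, ContinuousLinearMap.comp_apply]
  congr 1
  funext l
  by_cases hl : l = i
  · subst hl; simp
  · simp [hl]

lemma fderiv_apply_eq_sum {ι : Type*} [Fintype ι] [DecidableEq ι] (f : (ι → E d) → ℝ)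
    (x v : ι → E d) : fderiv ℝ f x v = ∑ i, fderiv ℝ f x (Pi.single i (v i)) := by
  rw [← map_sum, Finset.univ_sum_single]

lemma Cyl.hasDerivAt_grad (R : Cyl d) (γ : PathSpace d) {x : ℝ} (hx : ∀ i, x ≠ R.s i) :
    HasDerivAt (R.grad γ) (∑ i, (Set.Iio (R.s i : ℝ)).indicator (fun _ => R.partialGrad γ i) x)
      x := by
  have hfun : R.grad γ = fun s => ∑ i, min (R.s i : ℝ) s • R.partialGrad γ i := rfl
  rw [hfun]
  refine HasDerivAt.fun_sum fun i _ => ?_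
  rcases lt_or_gt_of_ne (hx i) with h | h
  · rw [Set.indicator_of_mem (Set.mem_Iio.mpr h)]
    have h1 : HasDerivAt (fun s : ℝ => min (R.s i : ℝ) s) 1 x := by
      refine (hasDerivAt_id x).congr_of_eventuallyEq ?_
      filter_upwards [Iio_mem_nhds h] with y hy using min_eq_right (le_of_lt hy)
    simpa using h1.smul_const (R.partialGrad γ i)
  · rw [Set.indicator_of_notMem (by simpa using h.le)]
    have h1 : HasDerivAt (fun s : ℝ => min (R.s i : ℝ) s) 0 x := by
      refine (hasDerivAt_const x (R.s i : ℝ)).congr_of_eventuallyEq ?_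
      filter_upwards [Ioi_mem_nhds h] with y hy using min_eq_left (le_of_lt hy)
    simpa using h1.smul_const (R.partialGrad γ i)

lemma intervalIntegrable_g [NeZero d] (n : ℕ) (a b : ℝ) :
    IntervalIntegrable (g d n) volume a b := by
  have h := intervalIntegrable_haar ((n - 1) / d + 1) (Nat.le_add_left 1 _) a b
  rw [intervalIntegrable_iff] at h ⊢
  exact h.smul_const _

/-- Reproducing property of the kernel s ∧ t: the derivative of x ↦ s_k ∧ x is the indicator of x <
s_k, so integrating g against it evaluates the Schauder function at s_k. The result is the
derivative of F along the Schauder path. -/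
lemma cmDeriv_toFun [NeZero d] (i : ℕ) (R : Cyl d) (γ : PathSpace d) :
    cmDeriv d i R.toFun γ = fderiv ℝ R.f (ev R.s γ) (ev R.s (schauderPath d i)) := by
  unfold cmDeriv cmInner
  have hInt := intervalIntegrable_g (d := d) (i + 1) 0 1
  have key : ∀ᵐ x ∂volume, x ∈ Set.uIoc (0 : ℝ) 1 →
      inner ℝ (deriv (S d (i + 1)) x) (deriv (D R.toFun γ) x) =
        ∑ k, (Set.Iio (R.s k : ℝ)).indicator
          (fun x => inner ℝ (g d (i + 1) x) (R.partialGrad γ k)) x := by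
    have hae : ∀ᵐ x : ℝ ∂volume, ∀ k, x ≠ R.s k := by
      rw [ae_all_iff]
      intro k
      exact Measure.ae_ne volume _
    filter_upwards [hInt.ae_hasDerivAt_integral, hae] with x hx hxs hx01
    rw [Set.uIoc_of_le zero_le_one] at hx01
    have hx1 : x < 1 := by
      refine lt_of_le_of_ne hx01.2 ?_
      have := hxs (Fin.last R.n)
      rwa [R.last] at this
    have h1 : deriv (S d (i + 1)) x = g d (i + 1) x := by
      refine (hx ?_ 0 ?_).deriv
      · rw [Set.uIcc_of_le zero_le_one]; exact ⟨hx01.1.le, hx01.2⟩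
      · simp
    -- Independence of the presentation is available on [0,1] only, so the derivatives are compared
    -- at interior points.
    have h2 : D R.toFun γ =ᶠ[𝓝 x] R.grad γ := by
      filter_upwards [Ioo_mem_nhds hx01.1 hx1] with y hy
      exact D_toFun R γ ⟨y, hy.1.le, hy.2.le⟩
    rw [h1, h2.deriv_eq, (R.hasDerivAt_grad γ hxs).deriv, inner_sum]
    refine Finset.sum_congr rfl fun k _ => ?_
    by_cases hk : x ∈ Set.Iio (R.s k : ℝ)
    · simp only [Set.indicator_of_mem hk]
    · simp only [Set.indicator_of_notMem hk, inner_zero_right]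
  rw [intervalIntegral.integral_congr_ae key]
  have hInt' : ∀ k, IntervalIntegrable
      (fun x => inner ℝ (g d (i + 1) x) (R.partialGrad γ k)) volume 0 1 := by
    intro k
    rw [intervalIntegrable_iff] at hInt ⊢
    exact hInt.inner_const _
  rw [intervalIntegral.integral_finsetSum, fderiv_apply_eq_sum]
  · refine Finset.sum_congr rfl fun k _ => ?_
    rw [← R.inner_partialGrad]
    change _ = inner ℝ (R.partialGrad γ k) (S d (i + 1) (R.s k))
    have hk0 := (R.s k).2.1
    have hk1 := (R.s k).2.2
    rw [intervalIntegral.integral_of_le zero_le_one, setIntegral_indicator measurableSet_Iio]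
    have hset : (Set.Ioc (0 : ℝ) 1 ∩ Set.Iio (R.s k : ℝ) : Set ℝ) =ᵐ[volume]
        (Set.Ioc (0 : ℝ) (R.s k) : Set ℝ) := by
      have : (Set.Ioc (0 : ℝ) 1 ∩ Set.Iic (R.s k : ℝ) : Set ℝ) = Set.Ioc (0 : ℝ) (R.s k) := by
        rw [Set.Ioc_inter_Iic, min_eq_right hk1]
      rw [← this]
      exact (ae_eq_refl _).inter Iio_ae_eq_Iic
    rw [setIntegral_congr_set hset, ← intervalIntegral.integral_of_le hk0]
    unfold S
    rw [real_inner_comm]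
    have hg := intervalIntegrable_g (d := d) (i + 1) 0 (R.s k)
    rw [intervalIntegral.integral_of_le hk0, intervalIntegral.integral_of_le hk0]
    rw [intervalIntegrable_iff, Set.uIoc_of_le hk0] at hg
    simp_rw [real_inner_comm (R.partialGrad γ k)]
    exact integral_inner hg _
  · intro k _
    have := hInt' k
    rw [intervalIntegrable_iff] at this ⊢
    exact this.indicator measurableSet_Iio

/-- A description free of presentations: linearity and the Leibniz rule follow from uniqueness of
derivatives. -/
lemma hasDerivAt_cmDeriv [NeZero d] (i : ℕ) {F : PathSpace d → ℝ} (hF : F ∈ Z d)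
    (γ : PathSpace d) :
    HasDerivAt (fun t => F (translate γ (schauderPath d i) t)) (cmDeriv d i F γ) 0 := by
  obtain ⟨R, rfl⟩ := hF
  rw [cmDeriv_toFun]
  exact hasDerivAt_translate R.s R.growth γ (schauderPath d i)

lemma cmDeriv_ev [NeZero d] (i : ℕ) {ι : Type*} [Fintype ι] (s : ι → unitInterval)
    {f : (ι → E d) → ℝ} (hf : f.HasTemperateGrowth) (γ : PathSpace d) :
    cmDeriv d i (fun γ => f (ev s γ)) γ = fderiv ℝ f (ev s γ) (ev s (schauderPath d i)) :=
  (hasDerivAt_cmDeriv i (mem_Z_of_temperate s hf) γ).unique (hasDerivAt_translate s hf γ _)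

lemma cmDeriv_sub [NeZero d] (i : ℕ) {F G : PathSpace d → ℝ} (hF : F ∈ Z d) (hG : G ∈ Z d) :
    cmDeriv d i (F - G) = cmDeriv d i F - cmDeriv d i G := by
  funext γ
  exact (hasDerivAt_cmDeriv i (sub_mem_Z hF hG) γ).unique
    ((hasDerivAt_cmDeriv i hF γ).sub (hasDerivAt_cmDeriv i hG γ))

lemma cmDeriv_mul [NeZero d] (i : ℕ) {F G : PathSpace d → ℝ} (hF : F ∈ Z d) (hG : G ∈ Z d) :
    cmDeriv d i (F * G) = cmDeriv d i F * G + F * cmDeriv d i G := by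
  funext γ
  have h := (hasDerivAt_cmDeriv i hF γ).mul (hasDerivAt_cmDeriv i hG γ)
  simp only [translate_zero] at h
  exact (hasDerivAt_cmDeriv i (mul_mem_Z hF hG) γ).unique h

lemma temperate_fderiv {V : Type*} [NormedAddCommGroup V] [NormedSpace ℝ V] {f : V → ℝ}
    (hf : f.HasTemperateGrowth) : (fderiv ℝ f).HasTemperateGrowth := by
  refine ⟨hf.1.fderiv_right (by simp), fun n => ?_⟩
  obtain ⟨k, C, h⟩ := hf.2 (n + 1)
  exact ⟨k, C, fun x => by rw [norm_iteratedFDeriv_fderiv]; exact h x⟩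

lemma temperate_fderiv_apply {V : Type*} [NormedAddCommGroup V] [NormedSpace ℝ V] {f : V → ℝ}
    (hf : f.HasTemperateGrowth) (v : V) : (fun x => fderiv ℝ f x v).HasTemperateGrowth :=
  (ContinuousLinearMap.hasTemperateGrowth (ContinuousLinearMap.apply ℝ ℝ v)).comp
    (temperate_fderiv hf)

/-- The direction is a fixed path, so the derivative is a function of the same values. This
stability keeps the adjoint of the derivative inside Z. -/
lemma cmDeriv_mem_Z [NeZero d] (i : ℕ) {F : PathSpace d → ℝ} (hF : F ∈ Z d) :
    cmDeriv d i F ∈ Z d := by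
  obtain ⟨n, s, f, hf, rfl⟩ := exists_rep_of_mem_Z hF
  have : cmDeriv d i (fun γ => f (ev s γ)) =
      fun γ => (fun x => fderiv ℝ f x (ev s (schauderPath d i))) (ev s γ) :=
    funext (cmDeriv_ev i s hf)
  rw [this]
  exact mem_Z_of_temperate s (temperate_fderiv_apply hf _)

/-- The derivative in a Schauder direction as a combination of partial derivatives. -/
lemma cmDeriv_ev_eq_sum [NeZero d] (i : ℕ) {ι : Type*} [Fintype ι] [DecidableEq ι]
    (s : ι → unitInterval) {f : (ι → E d) → ℝ} (hf : f.HasTemperateGrowth) (γ : PathSpace d) :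
    cmDeriv d i (fun γ => f (ev s γ)) γ = ∑ k, schauder (i / d + 1) (s k) *
      fderiv ℝ f (ev s γ) (Pi.single k (EuclideanSpace.single (Fin.ofNat d i) (1 : ℝ))) := by
  rw [cmDeriv_ev i s hf, fderiv_apply_eq_sum]
  refine Finset.sum_congr rfl fun k _ => ?_
  have : ev s (schauderPath d i) k =
      schauder (i / d + 1) (s k) • EuclideanSpace.single (Fin.ofNat d i) (1 : ℝ) :=
    S_eq d i (s k)
  rw [this, Pi.single_smul, map_smul, smul_eq_mul]

end WienerForm

namespace WienerForm

variable {d : ℕ}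

/-! ### Gaussian integration by parts -/

/-- The density p of variance v satisfies v p'(x) = −x p(x); integrate by parts on the line. -/
lemma integral_deriv_gaussianReal {v : NNReal} (hv : v ≠ 0) {u u' : ℝ → ℝ}
    (hu : ∀ x, HasDerivAt u (u' x) x) (h0 : Integrable u (gaussianReal 0 v))
    (h1 : Integrable u' (gaussianReal 0 v))
    (h2 : Integrable (fun x => u x * x) (gaussianReal 0 v)) :
    ∫ x, (v : ℝ) * u' x ∂gaussianReal 0 v = ∫ x, u x * x ∂gaussianReal 0 v := by
  have hv' : (v : ℝ) ≠ 0 := by exact_mod_cast hv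
  have hp : ∀ x, HasDerivAt (gaussianPDFReal 0 v) (-(x / v) * gaussianPDFReal 0 v x) x := by
    intro x
    rw [gaussianPDFReal_def]
    have h : HasDerivAt (fun x : ℝ => -(x - 0) ^ 2 / (2 * (v : ℝ))) (-(x / v)) x := by
      have := (((hasDerivAt_id x).sub_const (0 : ℝ)).pow 2).neg.div_const (2 * (v : ℝ))
      refine this.congr_deriv ?_
      simp
      field_simp
    refine (h.exp.const_mul _).congr_deriv ?_
    ring
  have hi : ∀ w : ℝ → ℝ, Integrable w (gaussianReal 0 v) →
      Integrable (fun x => gaussianPDFReal 0 v x * w x) volume := by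
    intro w hw
    rw [gaussianReal_of_var_ne_zero _ hv] at hw
    rw [integrable_withDensity_iff_integrable_smul₀' (measurable_gaussianPDF 0 v).aemeasurable
      (ae_of_all _ fun x => gaussianPDF_lt_top)] at hw
    simpa using hw
  have key := integral_mul_deriv_eq_deriv_mul_of_integrable (u := u) (v := gaussianPDFReal 0 v)
    (u' := u') (v' := fun x => -(x / v) * gaussianPDFReal 0 v x)
    (fun x _ => hu x) (fun x _ => hp x) ?_ ?_ ?_
  · rw [integral_gaussianReal_eq_integral_smul hv, integral_gaussianReal_eq_integral_smul hv]
    simp only [smul_eq_mul]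
    have e1 : ∫ x, gaussianPDFReal 0 v x * (v * u' x) = v * ∫ x, u' x * gaussianPDFReal 0 v x := by
      rw [← integral_const_mul]
      congr 1; funext x; ring
    have e2 : ∫ x, gaussianPDFReal 0 v x * (u x * x) =
        -(v * ∫ x, u x * (-(x / v) * gaussianPDFReal 0 v x)) := by
      rw [← integral_const_mul, ← integral_neg]
      congr 1; funext x; field_simp
    rw [e1, e2, key]
    ring
  · refine ((hi _ h2).const_mul (-(v : ℝ)⁻¹)).congr (ae_of_all _ fun x => ?_)
    simp only [Pi.mul_apply]
    field_simp
  · refine (hi _ h1).congr (ae_of_all _ fun x => ?_)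
    simp only [Pi.mul_apply]; ring
  · refine (hi _ h0).congr (ae_of_all _ fun x => ?_)
    simp only [Pi.mul_apply]; ring

/-! ### Wiener measure as a Gaussian measure -/

namespace IsWienerMeasure

variable {ν : Measure (PathSpace d)}

lemma measurable_coord (t : unitInterval) (j : Fin d) :
    Measurable (fun γ : PathSpace d => γ.1 t j) :=
  (EuclideanSpace.proj (𝕜 := ℝ) j).continuous.measurable.comp (measurable_eval t)

lemma map_coord_increment (hν : IsWienerMeasure ν) {s t : unitInterval} (hst : s ≤ t) (j : Fin d) :
    ν.map (fun γ => γ.1 t j - γ.1 s j) = gaussianReal 0 (Real.toNNReal ((t : ℝ) - s)) := by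
  have h := (measurePreserving_eval
    (fun _ : Fin d => gaussianReal 0 (Real.toNNReal ((t : ℝ) - (s : ℝ)))) j).map_eq
  have hm : Measurable (fun (γ : PathSpace d) (j : Fin d) => γ.1 t j - γ.1 s j) :=
    measurable_pi_lambda _ fun j => (measurable_coord t j).sub (measurable_coord s j)
  rw [← hν.map_increment s t hst, Measure.map_map (measurable_pi_apply j) hm] at h
  exact h

lemma map_coord (hν : IsWienerMeasure ν) (t : unitInterval) (j : Fin d) :
    ν.map (fun γ => γ.1 t j) = gaussianReal 0 (Real.toNNReal (t : ℝ)) := by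
  have h := hν.map_coord_increment (unitInterval.nonneg' : 0 ≤ t) j
  have e : (fun γ : PathSpace d => γ.1 t j - γ.1 0 j) = fun γ => γ.1 t j := by
    funext γ; simp [γ.2]
  rw [e] at h
  simpa using h

lemma iIndepFun_coord (hν : IsWienerMeasure ν) (t : unitInterval) :
    iIndepFun (fun (j : Fin d) (γ : PathSpace d) => γ.1 t j) ν := by
  have := hν.isProbabilityMeasure
  rw [iIndepFun_iff_map_fun_eq_pi_map fun j => (measurable_coord t j).aemeasurable]
  have h := hν.map_increment 0 t unitInterval.nonneg'
  have e : (fun (γ : PathSpace d) (j : Fin d) => γ.1 t j - γ.1 0 j) = fun γ j => γ.1 t j := by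
    funext γ j; simp [γ.2]
  rw [e] at h
  rw [h]
  simp_rw [hν.map_coord]
  simp

lemma hasGaussianLaw_coord (hν : IsWienerMeasure ν) (t : unitInterval) (j : Fin d) :
    HasGaussianLaw (fun γ => γ.1 t j) ν where
  isGaussian_map := by rw [hν.map_coord]; infer_instance

lemma hasGaussianLaw_eval (hν : IsWienerMeasure ν) (t : unitInterval) :
    HasGaussianLaw (fun γ : PathSpace d => γ.1 t) ν :=
  ((hν.iIndepFun_coord t).hasGaussianLaw (hν.hasGaussianLaw_coord t)).toLp_pi 2

lemma isGaussianProcess_eval (hν : IsWienerMeasure ν) :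
    IsGaussianProcess (fun (t : unitInterval) (γ : PathSpace d) => γ.1 t) ν :=
  HasIndepIncrements.isGaussianProcess hν.hasGaussianLaw_eval (ae_of_all _ fun γ => γ.2)
    hν.indepIncrements

lemma hasGaussianLaw_ev (hν : IsWienerMeasure ν) {ι : Type*} [Fintype ι] (s : ι → unitInterval) :
    HasGaussianLaw (ev (d := d) s) ν := by
  classical
  have h := hν.isGaussianProcess_eval.hasGaussianLaw (Finset.univ.image s)
  exact h.map_fun (ContinuousLinearMap.pi fun i => ContinuousLinearMap.proj (R := ℝ)
    (φ := fun _ : Finset.univ.image s => E d) ⟨s i, by simp⟩)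

lemma memLp_coord (hν : IsWienerMeasure ν) (t : unitInterval) (j : Fin d) :
    MemLp (fun γ => γ.1 t j) 2 ν := (hν.hasGaussianLaw_coord t j).memLp_two

lemma covariance_coord_self (hν : IsWienerMeasure ν) (t : unitInterval) (a b : Fin d) :
    cov[fun γ => γ.1 t a, fun γ => γ.1 t b; ν] = if a = b then (t : ℝ) else 0 := by
  have := hν.isProbabilityMeasure
  split_ifs with h
  · subst h
    rw [covariance_self (measurable_coord t a).aemeasurable]
    have hm := (measurable_coord t a).aemeasurable (μ := ν)
    have : Var[fun γ => γ.1 t a; ν] = Var[fun x => x; ν.map (fun γ => γ.1 t a)] := by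
      rw [variance_map (X := fun x => x) (by fun_prop) hm]; rfl
    rw [this, hν.map_coord, variance_fun_id_gaussianReal, Real.coe_toNNReal _ t.2.1]
  · exact ((hν.iIndepFun_coord t).indepFun h).covariance_eq_zero (hν.memLp_coord t a)
      (hν.memLp_coord t b)

/-- Write γ(t) as γ(s) plus an increment independent of γ(s). -/
lemma covariance_coord_of_le (hν : IsWienerMeasure ν) {s t : unitInterval} (hst : s ≤ t)
    (a b : Fin d) :
    cov[fun γ => γ.1 s a, fun γ => γ.1 t b; ν] = if a = b then (s : ℝ) else 0 := by
  have := hν.isProbabilityMeasure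
  have hind := hν.indepIncrements.indepFun_eval_sub (unitInterval.nonneg' : 0 ≤ s) hst
    (ae_of_all _ fun γ => γ.2)
  have hind' : IndepFun (fun γ : PathSpace d => γ.1 s a)
      ((fun γ : PathSpace d => γ.1 t b) - (fun γ : PathSpace d => γ.1 s b)) ν :=
    hind.comp (φ := fun x : E d => x a) (ψ := fun x : E d => x b)
      (EuclideanSpace.proj (𝕜 := ℝ) a).continuous.measurable
      (EuclideanSpace.proj (𝕜 := ℝ) b).continuous.measurable
  have h0 := hind'.covariance_eq_zero (hν.memLp_coord s a)
    ((hν.memLp_coord t b).sub (hν.memLp_coord s b))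
  rw [covariance_sub_right (hν.memLp_coord s a) (hν.memLp_coord t b) (hν.memLp_coord s b),
    hν.covariance_coord_self] at h0
  linarith

lemma covariance_coord (hν : IsWienerMeasure ν) (s t : unitInterval) (a b : Fin d) :
    cov[fun γ => γ.1 s a, fun γ => γ.1 t b; ν] = if a = b then min (s : ℝ) t else 0 := by
  rcases le_total s t with h | h
  · rw [hν.covariance_coord_of_le h, min_eq_left (show (s : ℝ) ≤ t from h)]
  · rw [covariance_comm, hν.covariance_coord_of_le h, min_eq_right (show (t : ℝ) ≤ s from h)]
    simp [eq_comm]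

/-- The path `γ` minus its projection on `γ_j(t)` is independent of `γ_j(t)`. -/
lemma indepFun_bridge (hν : IsWienerMeasure ν) {ι : Type*} [Fintype ι] (s : ι → unitInterval)
    {t : unitInterval} (ht : (t : ℝ) ≠ 0) (j : Fin d) :
    IndepFun (fun γ : PathSpace d => γ.1 t j)
      (fun γ => ev s γ - γ.1 t j • fun k =>
        EuclideanSpace.single j (min (s k : ℝ) t / t)) ν := by
  have := hν.isProbabilityMeasure
  -- The index `none` carries the time t. Both variables are then linear images of one Gaussian
  -- vector, and independence reduces to vanishing covariances.
  have hG := hν.hasGaussianLaw_ev (fun o : Option ι => o.elim t s)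
  let P : Option ι → Fin d → ((Option ι → E d) →L[ℝ] ℝ) := fun o a =>
    (EuclideanSpace.proj (𝕜 := ℝ) a).comp
      (ContinuousLinearMap.proj (R := ℝ) (φ := fun _ : Option ι => E d) o)
  let c : ι × Fin d → ℝ := fun p =>
    (EuclideanSpace.single j (min (s p.1 : ℝ) t / t) : E d) p.2
  let L : (Option ι → E d) →L[ℝ] ((Unit → ℝ) × (ι × Fin d → ℝ)) :=
    (ContinuousLinearMap.pi fun _ => P none j).prod
      (ContinuousLinearMap.pi fun p => P (some p.1) p.2 - c p • P none j)
  have hL := hG.map_fun L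
  have hind := HasGaussianLaw.indepFun_of_covariance_eval
    (X := fun (_ : Unit) (γ : PathSpace d) => γ.1 t j)
    (Y := fun (p : ι × Fin d) (γ : PathSpace d) => γ.1 (s p.1) p.2 - c p * γ.1 t j) hL ?_
  · have hψ : Measurable (fun (y : ι × Fin d → ℝ) (k : ι) =>
        (WithLp.toLp 2 (fun a => y (k, a)) : E d)) := by
      refine measurable_pi_lambda _ fun k => ?_
      exact (PiLp.continuous_toLp 2 _).measurable.comp (measurable_pi_lambda _ fun a =>
        measurable_pi_apply _)
    have hφ : Measurable (fun x : Unit → ℝ => x ()) := measurable_pi_apply ()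
    have := hind.comp hφ hψ
    convert this using 1
    · rfl
    · funext γ k
      ext a
      simp [ev, c, mul_comm]
  -- For a = j the covariance is (s_k ∧ t) − ((s_k ∧ t)/t) t = 0; for a ≠ j both terms vanish.
  · rintro - ⟨k, a⟩
    have hmul : MemLp (fun γ : PathSpace d => c (k, a) * γ.1 t j) 2 ν :=
      (hν.memLp_coord t j).const_mul _
    have e : (fun γ : PathSpace d => γ.1 (s k) a - c (k, a) * γ.1 t j) =
      (fun γ : PathSpace d => γ.1 (s k) a) - (fun γ : PathSpace d => c (k, a) * γ.1 t j) := rfl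
    rw [e, covariance_sub_right (hν.memLp_coord t j) (hν.memLp_coord (s k) a) hmul,
      covariance_const_mul_right, hν.covariance_coord, hν.covariance_coord]
    by_cases h : j = a
    · subst h
      simp only [↓reduceIte, min_self, c, PiLp.single_apply]
      rw [div_mul_cancel₀ _ ht, min_comm, sub_self]
    · simp [h, c, Ne.symm h]

/-- Integration by parts in the direction of `s ↦ (s ∧ t) e_j`. -/
lemma integral_fderiv_min (hν : IsWienerMeasure ν) (hInt : ∀ F ∈ Z d, Integrable F ν)
    {ι : Type*} [Fintype ι] (s : ι → unitInterval) {f : (ι → E d) → ℝ}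
    (hf : f.HasTemperateGrowth) (t : unitInterval) (j : Fin d) :
    ∫ γ, fderiv ℝ f (ev s γ) (fun k => EuclideanSpace.single j (min (s k : ℝ) t)) ∂ν =
      ∫ γ, f (ev s γ) * γ.1 t j ∂ν := by
  have := hν.isProbabilityMeasure
  by_cases ht : (t : ℝ) = 0
  · have ht' : t = 0 := Subtype.ext ht
    have h1 : (fun k => EuclideanSpace.single j (min (s k : ℝ) t)) = (0 : ι → E d) := by
      funext k
      simp [ht, (s k).2.1]
    have h2 : ∀ γ : PathSpace d, γ.1 t j = 0 := fun γ => by rw [ht', γ.2]; rfl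
    simp [h1, h2]
  set h : ι → E d := fun k => EuclideanSpace.single j (min (s k : ℝ) t / t) with hh
  have hth : (fun k => EuclideanSpace.single j (min (s k : ℝ) t)) = (t : ℝ) • h := by
    funext k
    rw [Pi.smul_apply, hh]
    ext a
    simp only [PiLp.single_apply, PiLp.smul_apply, smul_eq_mul]
    split_ifs
    · field_simp
    · simp
  have hind := hν.indepFun_bridge s ht j
  rw [← hh] at hind
  have hXm := (measurable_coord t j).aemeasurable (μ := ν)
  have hWm : AEMeasurable (fun γ : PathSpace d => ev s γ - γ.1 t j • h) ν :=
    ((measurable_ev s).sub ((measurable_coord t j).smul_const h)).aemeasurable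
  rw [indepFun_iff_map_prod_eq_prod_map_map hXm hWm, hν.map_coord] at hind
  set W := ν.map (fun γ : PathSpace d => ev s γ - γ.1 t j • h)
  set v := Real.toNNReal (t : ℝ)
  have hv : v ≠ 0 := by
    simp only [v, ne_eq, Real.toNNReal_eq_zero, not_le]
    exact lt_of_le_of_ne t.2.1 (Ne.symm ht)
  have hvt : (v : ℝ) = t := Real.coe_toNNReal _ t.2.1
  have hpair : AEMeasurable (fun γ : PathSpace d => (γ.1 t j, ev s γ - γ.1 t j • h)) ν :=
    hXm.prodMk hWm
  have hWprob : IsProbabilityMeasure W := Measure.isProbabilityMeasure_map hWm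
  -- The values of the path are w + x h with w of law W, x centred Gaussian of variance t, and both
  -- independent; expectations become iterated integrals.
  have tr : ∀ G : (ι → E d) → ℝ → ℝ, Continuous (Function.uncurry G) →
      Integrable (fun γ => G (ev s γ) (γ.1 t j)) ν →
      Integrable (fun p : ℝ × (ι → E d) => G (p.2 + p.1 • h) p.1) ((gaussianReal 0 v).prod W) ∧
      ∫ γ, G (ev s γ) (γ.1 t j) ∂ν =
        ∫ w, ∫ x, G (w + x • h) x ∂gaussianReal 0 v ∂W := by
    intro G hG hGi
    have hc : Continuous (fun p : ℝ × (ι → E d) => G (p.2 + p.1 • h) p.1) :=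
      hG.comp ((continuous_snd.add (continuous_fst.smul continuous_const)).prodMk continuous_fst)
    have e : (fun γ : PathSpace d => G (ev s γ) (γ.1 t j)) =
        (fun p : ℝ × (ι → E d) => G (p.2 + p.1 • h) p.1) ∘
          (fun γ : PathSpace d => (γ.1 t j, ev s γ - γ.1 t j • h)) := by
      funext γ; simp
    have hi : Integrable (fun p : ℝ × (ι → E d) => G (p.2 + p.1 • h) p.1)
        ((gaussianReal 0 v).prod W) := by
      rw [← hind, integrable_map_measure hc.aestronglyMeasurable hpair, ← e]
      exact hGi
    refine ⟨hi, ?_⟩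
    rw [← integral_prod_symm _ hi, ← hind, integral_map hpair hc.aestronglyMeasurable]
    simp
  have hfc := hf.1.continuous
  have hf'c : Continuous (fun x => fderiv ℝ f x h) :=
    (temperate_fderiv_apply hf h).1.continuous
  have m0 : Integrable (fun γ => f (ev s γ)) ν := hInt _ (mem_Z_of_temperate s hf)
  have m1 : Integrable (fun γ => fderiv ℝ f (ev s γ) h) ν :=
    hInt _ (mem_Z_of_temperate s (temperate_fderiv_apply hf h))
  have m2 : Integrable (fun γ => f (ev s γ) * γ.1 t j) ν :=
    hInt _ (mul_mem_Z (mem_Z_of_temperate s hf) (coord_mem_Z t j))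
  obtain ⟨i0, -⟩ := tr (fun w _ => f w) (hfc.comp continuous_fst) m0
  obtain ⟨i1, e1⟩ := tr (fun w _ => fderiv ℝ f w h) (hf'c.comp continuous_fst) m1
  obtain ⟨i2, e2⟩ := tr (fun w x => f w * x) ((hfc.comp continuous_fst).mul continuous_snd) m2
  rw [hth]
  simp only [map_smul, smul_eq_mul]
  rw [integral_const_mul, e1, e2, ← integral_const_mul]
  -- For almost every w, apply the one-dimensional formula to x ↦ f(w + x h).
  refine integral_congr_ae ?_
  filter_upwards [i0.prod_left_ae, i1.prod_left_ae, i2.prod_left_ae] with w h0 h1 h2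
  rw [← integral_const_mul, ← hvt]
  refine integral_deriv_gaussianReal hv (fun x => ?_) h0 h1 h2
  have hcurve : HasDerivAt (fun x : ℝ => w + x • h) h x := by
    simpa using ((hasDerivAt_id x).smul_const h).const_add w
  exact HasFDerivAt.comp_hasDerivAt x (l := f)
    ((hf.1.differentiable (by simp)).differentiableAt.hasFDerivAt) hcurve

/-- The Wiener integral `∫ g_{i+1} dγ` and the integration by parts formula in the direction of
a Schauder function. -/
lemma exists_integral_cmDeriv [NeZero d] (hν : IsWienerMeasure ν)
    (hInt : ∀ F ∈ Z d, Integrable F ν) (i : ℕ) :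
    ∃ X ∈ Z d, ∀ F ∈ Z d, ∫ γ, cmDeriv d i F γ ∂ν = ∫ γ, F γ * X γ ∂ν := by
  obtain ⟨c, t, h⟩ := exists_schauder_eq_sum_min (i / d + 1) (Nat.le_add_left 1 _)
  set j := Fin.ofNat d i
  -- The direction (· ∧ t_a) e_j has weight γ_j(t_a). Since the Schauder function is ∑ c_a (· ∧
  -- t_a), its weight is ∑ c_a γ_j(t_a).
  refine ⟨_, sum_coord_mem_Z c t j, fun F hF => ?_⟩
  obtain ⟨n, s, f, hf, rfl⟩ := exists_rep_of_mem_Z hF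
  have hdir : ev s (schauderPath d i) =
      ∑ a, c a • fun k => EuclideanSpace.single j (min (s k : ℝ) (t a)) := by
    funext k
    have : ev s (schauderPath d i) k =
        schauder (i / d + 1) (s k) • EuclideanSpace.single j (1 : ℝ) := S_eq d i (s k)
    rw [this, h, Finset.sum_apply, Finset.sum_smul]
    refine Finset.sum_congr rfl fun a _ => ?_
    ext b
    simp only [Pi.smul_apply, PiLp.smul_apply, PiLp.single_apply, smul_eq_mul]
    split_ifs <;> ring
  simp_rw [cmDeriv_ev i s hf, hdir, map_sum, map_smul, smul_eq_mul]
  have hi : ∀ a, Integrable (fun γ => fderiv ℝ f (ev s γ)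
      (fun k => EuclideanSpace.single j (min (s k : ℝ) (t a)))) ν := fun a =>
    hInt _ (mem_Z_of_temperate s (temperate_fderiv_apply hf _))
  have hi' : ∀ a, Integrable (fun γ => f (ev s γ) * γ.1 (t a) j) ν := fun a =>
    hInt _ (mul_mem_Z (mem_Z_of_temperate s hf) (coord_mem_Z (t a) j))
  rw [integral_finsetSum _ fun a _ => (hi a).const_mul (c a)]
  have e : ∀ γ : PathSpace d, f (ev s γ) * ∑ a, c a * γ.1 (t a) j =
      ∑ a, c a * (f (ev s γ) * γ.1 (t a) j) := by
    intro γ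
    rw [Finset.mul_sum]
    exact Finset.sum_congr rfl fun a _ => by ring
  simp_rw [e]
  rw [integral_finsetSum _ fun a _ => (hi' a).const_mul (c a)]
  refine Finset.sum_congr rfl fun a _ => ?_
  rw [integral_const_mul, integral_const_mul, hν.integral_fderiv_min hInt s hf]

end IsWienerMeasure

end WienerForm

namespace WienerForm

variable {d : ℕ}

/-! ### Cylindrical functions separate integrable functions -/

lemma temperate_cos : Real.cos.HasTemperateGrowth :=
  ⟨Real.contDiff_cos, fun n => ⟨0, 1, fun x => by
    rw [norm_iteratedFDeriv_eq_norm_iteratedDeriv]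
    simpa using Real.abs_iteratedDeriv_cos_le_one n x⟩⟩

lemma temperate_sin : Real.sin.HasTemperateGrowth :=
  ⟨Real.contDiff_sin, fun n => ⟨0, 1, fun x => by
    rw [norm_iteratedFDeriv_eq_norm_iteratedDeriv]
    simpa using Real.abs_iteratedDeriv_sin_le_one n x⟩⟩

lemma measurableSpace_pathSpace_eq_comap (d : ℕ) :
    instMeasurableSpacePathSpace d =
      MeasurableSpace.comap (fun (γ : PathSpace d) (t : unitInterval) => γ.1 t)
        MeasurableSpace.pi := by
  unfold MeasurableSpace.pi instMeasurableSpacePathSpace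
  rw [MeasurableSpace.comap_iSup]
  simp_rw [MeasurableSpace.comap_comp]
  rfl

/-- Finite-dimensional marginals determine a finite measure on the product over all times, and the
σ-algebra of path space is pulled back from that product. -/
lemma measure_pathSpace_ext {μ₁ μ₂ : Measure (PathSpace d)} [IsFiniteMeasure μ₁]
    [IsFiniteMeasure μ₂]
    (h : ∀ I : Finset unitInterval, μ₁.map (ev (fun t : I => (t : unitInterval))) =
      μ₂.map (ev (fun t : I => (t : unitInterval)))) : μ₁ = μ₂ := by
  let X : PathSpace d → unitInterval → E d := fun γ t => γ.1 t
  have hX : Measurable X := measurable_pi_lambda _ measurable_eval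
  have hlim : ∀ μ : Measure (PathSpace d), ∀ I : Finset unitInterval,
      (μ.map X).map I.restrict = μ.map (ev (fun t : I => (t : unitInterval))) := by
    intro μ I
    rw [Measure.map_map (Finset.measurable_restrict I) hX]
    rfl
  have heq : μ₁.map X = μ₂.map X := by
    refine IsProjectiveLimit.unique
      (P := fun I => μ₂.map (ev (fun t : I => (t : unitInterval)))) (fun I => ?_) (fun I => ?_)
    · rw [hlim, h]
    · rw [hlim]
  ext A hA
  rw [measurableSpace_pathSpace_eq_comap] at hA
  obtain ⟨B, hB, rfl⟩ := hA
  have := congrArg (fun m => m B) heq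
  simpa only [Measure.map_apply hX hB] using this

/-- An integrable function that is orthogonal to all cylindrical functions vanishes. -/
lemma ae_eq_zero_of_forall_integral_mul_eq_zero {ν : Measure (PathSpace d)} [IsFiniteMeasure ν]
    {h : PathSpace d → ℝ} (hh : Integrable h ν)
    (hZ : ∀ G ∈ Z d, ∫ γ, h γ * G γ ∂ν = 0) : h =ᵐ[ν] 0 := by
  have hm := hh.aestronglyMeasurable.aemeasurable
  have hm' : AEMeasurable (fun γ => -h γ) ν := hm.neg
  -- The positive and negative parts of h dν. The claim becomes P = N, which is tested on
  -- characteristic functions.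
  let P : Measure (PathSpace d) := ν.withDensity (fun γ => ENNReal.ofReal (h γ))
  let N : Measure (PathSpace d) := ν.withDensity (fun γ => ENNReal.ofReal (-h γ))
  have hPf : IsFiniteMeasure P := isFiniteMeasure_withDensity_ofReal hh.2
  have hNf : IsFiniteMeasure N := isFiniteMeasure_withDensity_ofReal hh.neg.2
  have hdiff : ∀ G : PathSpace d → ℂ, Measurable G → (∀ γ, ‖G γ‖ ≤ 1) →
      ∫ γ, G γ ∂P - ∫ γ, G γ ∂N = ∫ γ, (h γ : ℂ) * G γ ∂ν := by
    intro G hG hb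
    have i1 : Integrable G P := Integrable.of_bound hG.aestronglyMeasurable 1 (ae_of_all _ hb)
    have i2 : Integrable G N := Integrable.of_bound hG.aestronglyMeasurable 1 (ae_of_all _ hb)
    have t1 : ∀ᵐ γ ∂ν, ENNReal.ofReal (h γ) < ⊤ := ae_of_all _ fun _ => ENNReal.ofReal_lt_top
    have t2 : ∀ᵐ γ ∂ν, ENNReal.ofReal (-h γ) < ⊤ := ae_of_all _ fun _ => ENNReal.ofReal_lt_top
    simp only [P, N] at i1 i2 ⊢
    rw [integrable_withDensity_iff_integrable_smul₀' hm.ennreal_ofReal t1] at i1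
    rw [integrable_withDensity_iff_integrable_smul₀' hm'.ennreal_ofReal t2] at i2
    rw [integral_withDensity_eq_integral_toReal_smul₀ hm.ennreal_ofReal t1,
      integral_withDensity_eq_integral_toReal_smul₀ hm'.ennreal_ofReal t2,
      ← integral_sub i1 i2]
    congr 1
    funext γ
    rw [← sub_smul, ENNReal.toReal_ofReal', ENNReal.toReal_ofReal', max_zero_sub_eq_self]
    simp
  have hPN : P = N := by
    refine measure_pathSpace_ext fun I => ?_
    set e := ev (d := d) (fun t : I => (t : unitInterval))
    have he : Measurable e := measurable_ev _
    refine Measure.ext_of_charFunDual ?_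
    funext L
    have hc : ∀ m : Measure (PathSpace d), charFunDual (m.map e) L =
        ∫ γ, Complex.exp ((L (e γ) : ℂ) * Complex.I) ∂m := by
      intro m
      rw [charFunDual_apply, integral_map he.aemeasurable]
      have : Continuous (fun v : I → E d => Complex.exp ((L v : ℂ) * Complex.I)) := by fun_prop
      exact this.aestronglyMeasurable
    rw [hc, hc, ← sub_eq_zero, hdiff]
    -- The real and imaginary parts of the exponential are cylindrical, hence orthogonal to h.
    · have hL : Function.HasTemperateGrowth (fun x => L x) := L.hasTemperateGrowth
      have zc := hZ _ (mem_Z_of_temperate (fun t : I => (t : unitInterval)) (temperate_cos.comp hL))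
      have zs := hZ _ (mem_Z_of_temperate (fun t : I => (t : unitInterval)) (temperate_sin.comp hL))
      have bd : ∀ u : ℝ → ℝ, Continuous u → (∀ x, |u x| ≤ 1) →
          Integrable (fun γ => h γ * u (L (e γ))) ν := by
        intro u hu hb
        refine hh.mul_bdd (c := 1) ?_ (ae_of_all _ fun γ => by simpa using hb _)
        exact ((hu.comp L.continuous).measurable.comp he).aestronglyMeasurable
      have e1 : ∀ γ, (h γ : ℂ) * Complex.exp ((L (e γ) : ℂ) * Complex.I) =
          ((h γ * Real.cos (L (e γ)) : ℝ) : ℂ) +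
            ((h γ * Real.sin (L (e γ)) : ℝ) : ℂ) * Complex.I := by
        intro γ
        rw [Complex.exp_mul_I]
        push_cast
        ring
      simp_rw [e1]
      rw [integral_add, integral_mul_const, integral_complex_ofReal, integral_complex_ofReal]
      · have zc' : ∫ γ, h γ * Real.cos (L (e γ)) ∂ν = 0 := zc
        have zs' : ∫ γ, h γ * Real.sin (L (e γ)) ∂ν = 0 := zs
        rw [zc', zs']
        simp
      · exact (bd _ Real.continuous_cos Real.abs_cos_le_one).ofReal
      · exact ((bd _ Real.continuous_sin Real.abs_sin_le_one).ofReal (𝕜 := ℂ)).mul_const _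
    · exact ((by fun_prop : Continuous (fun v : I → E d =>
        Complex.exp ((L v : ℂ) * Complex.I))).measurable.comp he)
    · intro γ
      rw [Complex.norm_exp_ofReal_mul_I]
  refine hh.ae_eq_zero_of_forall_setIntegral_eq_zero fun A hA _ => ?_
  have h1 := hdiff (A.indicator 1) ((measurable_const).indicator hA) (fun γ => by
    by_cases hγ : γ ∈ A <;> simp [hγ])
  rw [hPN, sub_self] at h1
  have e2 : ∀ γ, (h γ : ℂ) * A.indicator 1 γ = ((A.indicator h γ : ℝ) : ℂ) := by
    intro γ
    by_cases hγ : γ ∈ A <;> simp [hγ]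
  simp_rw [e2] at h1
  rw [integral_complex_ofReal, integral_indicator hA] at h1
  exact_mod_cast h1.symm

/-! ### Continuity in the time points -/

namespace IsWienerMeasure

variable {ν : Measure (PathSpace d)}

/-- Brownian scaling. It reduces every moment of an increment to the corresponding moment of γ(1).
-/
lemma map_increment_eq_scaling (hν : IsWienerMeasure ν) {s t : unitInterval} (hst : s ≤ t) :
    ν.map (fun γ => γ.1 t - γ.1 s) =
      ν.map (fun γ => Real.sqrt ((t : ℝ) - s) • γ.1 1) := by
  have hst' : (0 : ℝ) ≤ (t : ℝ) - s := sub_nonneg.mpr hst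
  have h1 := hν.map_increment s t hst
  have h2 := hν.map_increment 0 1 unitInterval.nonneg'
  have e0 : (fun (γ : PathSpace d) (j : Fin d) => γ.1 1 j - γ.1 0 j) = fun γ j => γ.1 1 j := by
    funext γ j; simp [γ.2]
  rw [e0] at h2
  set c := Real.sqrt ((t : ℝ) - s) with hc
  have hcm : Measurable (fun (x : Fin d → ℝ) j => c * x j) := by fun_prop
  have m1 : Measurable (fun (γ : PathSpace d) (j : Fin d) => γ.1 1 j) :=
    measurable_pi_lambda _ fun j => measurable_coord 1 j
  have m3 : Measurable (fun (γ : PathSpace d) (j : Fin d) => c * γ.1 1 j) := hcm.comp m1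
  have m2 : Measurable (fun (γ : PathSpace d) (j : Fin d) => γ.1 t j - γ.1 s j) :=
    measurable_pi_lambda _ fun j => (measurable_coord t j).sub (measurable_coord s j)
  have h3 : ν.map (fun (γ : PathSpace d) (j : Fin d) => c * γ.1 1 j) =
      ν.map (fun (γ : PathSpace d) (j : Fin d) => γ.1 t j - γ.1 s j) := by
    have : (fun (γ : PathSpace d) (j : Fin d) => c * γ.1 1 j) =
      (fun (x : Fin d → ℝ) j => c * x j) ∘ (fun γ j => γ.1 1 j) := rfl
    rw [this, ← Measure.map_map hcm m1, h2, h1,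
      Measure.pi_map_pi (f := fun _ x => c * x) (fun _ => by fun_prop)]
    congr 1
    funext j
    rw [gaussianReal_map_const_mul, mul_zero]
    congr 1
    ext
    simp [hc, Real.sq_sqrt hst', hst']
  have mt : Measurable (WithLp.toLp 2 : (Fin d → ℝ) → E d) :=
    (PiLp.continuous_toLp 2 _).measurable
  have h4 := congrArg (fun m => m.map (WithLp.toLp 2 : (Fin d → ℝ) → E d)) h3
  simp only at h4
  rw [Measure.map_map mt m3, Measure.map_map mt m2] at h4
  exact h4.symm

lemma eLpNorm_increment (hν : IsWienerMeasure ν) (s t : unitInterval) (q : ENNReal) :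
    eLpNorm (fun γ => γ.1 t - γ.1 s) q ν =
      ENNReal.ofReal (Real.sqrt |(t : ℝ) - s|) * eLpNorm (fun γ : PathSpace d => γ.1 1) q ν := by
  have main : ∀ s t : unitInterval, s ≤ t → eLpNorm (fun γ => γ.1 t - γ.1 s) q ν =
      ENNReal.ofReal (Real.sqrt |(t : ℝ) - s|) *
        eLpNorm (fun γ : PathSpace d => γ.1 1) q ν := by
    intro s t hst
    rw [abs_of_nonneg (sub_nonneg.mpr hst : (0 : ℝ) ≤ (t : ℝ) - s)]
    have m1 : Measurable (fun γ : PathSpace d => γ.1 t - γ.1 s) :=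
      (measurable_eval t).sub (measurable_eval s)
    have m2 : Measurable (fun γ : PathSpace d => Real.sqrt ((t : ℝ) - s) • γ.1 1) :=
      (measurable_eval 1).const_smul (Real.sqrt ((t : ℝ) - s))
    have h1 := eLpNorm_map_measure (μ := ν) (p := q) (g := (id : E d → E d))
      aestronglyMeasurable_id m1.aemeasurable
    have h2 := eLpNorm_map_measure (μ := ν) (p := q) (g := (id : E d → E d))
      aestronglyMeasurable_id m2.aemeasurable
    rw [hν.map_increment_eq_scaling hst] at h1
    rw [h1] at h2
    have h3 : eLpNorm (fun γ : PathSpace d => γ.1 t - γ.1 s) q ν =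
      eLpNorm (Real.sqrt ((t : ℝ) - s) • fun γ : PathSpace d => γ.1 1) q ν := h2
    rw [h3, eLpNorm_const_smul, Real.enorm_eq_ofReal (Real.sqrt_nonneg _)]
  rcases le_total s t with h | h
  · exact main s t h
  · rw [abs_sub_comm, ← main t s h]
    exact eLpNorm_sub_comm (fun γ : PathSpace d => γ.1 t) (fun γ : PathSpace d => γ.1 s) q ν

/-- Mean value inequality on the centred ball of radius ‖x‖ + ‖y‖, which contains both points. The
exponent k + 1 instead of k is positive even for k = 0, as the later passage to another L^p norm
requires. -/
lemma _root_.WienerForm.exists_norm_sub_le_of_temperate {V : Type*} [NormedAddCommGroup V]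
    [NormedSpace ℝ V] {f : V → ℝ} (hf : f.HasTemperateGrowth) :
    ∃ (k : ℕ) (C : ℝ), 0 ≤ C ∧ ∀ x y, ‖f x - f y‖ ≤ C * ((1 + ‖x‖ + ‖y‖) ^ (k + 1) * ‖x - y‖) := by
  obtain ⟨k, C, h⟩ := hf.2 1
  refine ⟨k, |C|, abs_nonneg C, fun x y => ?_⟩
  set r := ‖x‖ + ‖y‖
  have hb : ∀ z ∈ Metric.closedBall (0 : V) r, ‖fderiv ℝ f z‖ ≤ |C| * (1 + r) ^ (k + 1) := by
    intro z hz
    rw [mem_closedBall_zero_iff] at hz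
    have h1 := h z
    rw [norm_iteratedFDeriv_one] at h1
    have hr : 1 ≤ 1 + r := by
      have : 0 ≤ r := by positivity
      linarith
    calc _ ≤ C * (1 + ‖z‖) ^ k := h1
      _ ≤ |C| * (1 + r) ^ k := by gcongr; exact le_abs_self C
      _ ≤ |C| * (1 + r) ^ (k + 1) := by gcongr; simp
  have := Convex.norm_image_sub_le_of_norm_fderiv_le (𝕜 := ℝ) (f := f)
    (fun z _ => (hf.1.differentiable (by simp)).differentiableAt) hb
    (convex_closedBall (0 : V) r) (x := y) (y := x)
    (by simp [r]) (by simp [r])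
  rw [add_assoc, ← mul_assoc]
  exact this

lemma _root_.WienerForm.aestronglyMeasurable_ev {ι : Type*} [Fintype ι] (s : ι → unitInterval) :
    AEStronglyMeasurable (fun γ => ev (d := d) s γ) ν :=
  (measurable_ev s).aestronglyMeasurable

lemma eLpNorm_norm_ev_sub_le (hν : IsWienerMeasure ν) {ι : Type*} [Fintype ι]
    (s t : ι → unitInterval) {q : ENNReal} (hq : 1 ≤ q) :
    eLpNorm (fun γ => ‖ev (d := d) t γ - ev s γ‖) q ν ≤
      ∑ i, ENNReal.ofReal (Real.sqrt |(t i : ℝ) - s i|) *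
        eLpNorm (fun γ : PathSpace d => γ.1 1) q ν := by
  have mev : ∀ t : unitInterval, AEStronglyMeasurable (fun γ : PathSpace d => γ.1 t) ν := fun t =>
    (measurable_eval t).aestronglyMeasurable
  calc _ ≤ eLpNorm (∑ i, fun γ : PathSpace d => ‖γ.1 (t i) - γ.1 (s i)‖) q ν := by
        refine eLpNorm_mono_real fun γ => ?_
        rw [norm_norm, pi_norm_le_iff_of_nonneg (by
          rw [Finset.sum_apply]; exact Finset.sum_nonneg fun _ _ => norm_nonneg _)]
        intro i
        rw [Finset.sum_apply]
        exact Finset.single_le_sum (f := fun i => ‖γ.1 (t i) - γ.1 (s i)‖)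
          (fun _ _ => norm_nonneg _) (Finset.mem_univ i)
    _ ≤ ∑ i, eLpNorm (fun γ : PathSpace d => ‖γ.1 (t i) - γ.1 (s i)‖) q ν :=
        eLpNorm_sum_le (fun i _ => ((mev _).sub (mev _)).norm) hq
    _ = _ := by
        refine Finset.sum_congr rfl fun i _ => ?_
        rw [eLpNorm_norm (fun γ : PathSpace d => γ.1 (t i) - γ.1 (s i)),
          hν.eLpNorm_increment]

lemma eLpNorm_norm_ev_le (hν : IsWienerMeasure ν) {ι : Type*} [Fintype ι]
    (s : ι → unitInterval) {q : ENNReal} (hq : 1 ≤ q) :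
    eLpNorm (fun γ => ‖ev (d := d) s γ‖) q ν ≤
      ((Fintype.card ι : ℕ) : ENNReal) * eLpNorm (fun γ : PathSpace d => γ.1 1) q ν := by
  have h := hν.eLpNorm_norm_ev_sub_le (fun _ => 0) s hq
  have e : (fun γ => ‖ev (d := d) s γ - ev (fun _ => 0) γ‖) = fun γ => ‖ev s γ‖ := by
    funext γ
    congr 1
    funext i
    simp [ev, γ.2]
  rw [e] at h
  refine h.trans ?_
  calc _ ≤ ∑ _i : ι, 1 * eLpNorm (fun γ : PathSpace d => γ.1 1) q ν := by
        gcongr with i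
        rw [ENNReal.ofReal_le_one]
        simp [abs_of_nonneg (s i).2.1, Real.sqrt_le_one, (s i).2.2]
    _ = _ := by simp

/-- The L^p norm of a (k+1)-st power is a power of the L^(p(k+1)) norm. The point is that the bound
does not depend on the times. -/
lemma eLpNorm_one_add_norm_ev_pow_le (hν : IsWienerMeasure ν) {ι : Type*} [Fintype ι]
    (s t : ι → unitInterval) {p : ENNReal} (hp : 1 ≤ p) (hp' : p ≠ ⊤) (k : ℕ) :
    eLpNorm (fun γ => (1 + ‖ev (d := d) t γ‖ + ‖ev (d := d) s γ‖) ^ (k + 1)) p ν ≤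
      (1 + 2 * (((Fintype.card ι : ℕ) : ENNReal) *
        eLpNorm (fun γ : PathSpace d => γ.1 1) (p * ENNReal.ofReal ((k + 1 : ℕ) : ℝ)) ν)) ^
          ((k + 1 : ℕ) : ℝ) := by
  have := hν.isProbabilityMeasure
  set q : ENNReal := p * ENNReal.ofReal ((k + 1 : ℕ) : ℝ) with hq
  have hq1 : 1 ≤ q := by
    have h1 : (1 : ENNReal) ≤ ENNReal.ofReal ((k + 1 : ℕ) : ℝ) := by
      rw [ENNReal.one_le_ofReal]
      push_cast; linarith [show (0 : ℝ) ≤ k by positivity]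
    calc (1 : ENNReal) = 1 * 1 := by simp
      _ ≤ p * _ := by gcongr
  have hqtop : q ≠ ⊤ := ENNReal.mul_ne_top hp' ENNReal.ofReal_ne_top
  set A : PathSpace d → ℝ := fun γ => 1 + ‖ev (d := d) t γ‖ + ‖ev (d := d) s γ‖ with hAdef
  have m1 : AEStronglyMeasurable (fun γ => ‖ev (d := d) t γ‖) ν := (aestronglyMeasurable_ev t).norm
  have m2 : AEStronglyMeasurable (fun γ => ‖ev (d := d) s γ‖) ν := (aestronglyMeasurable_ev s).norm
  have m0 : AEStronglyMeasurable (fun _ : PathSpace d => (1 : ℝ)) ν := aestronglyMeasurable_const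
  have h0 : eLpNorm (fun _ : PathSpace d => (1 : ℝ)) q ν = 1 := by
    rw [eLpNorm_const' _ (zero_lt_one.trans_le hq1).ne' hqtop]
    simp
  have h1 := eLpNorm_add_le m0 m1 hq1
  have h2 := eLpNorm_add_le (m0.add m1) m2 hq1
  have hA : eLpNorm A q ν ≤ 1 + 2 * (((Fintype.card ι : ℕ) : ENNReal) *
      eLpNorm (fun γ : PathSpace d => γ.1 1) q ν) := by
    refine h2.trans ((add_le_add_left h1 _).trans ?_)
    rw [h0, add_assoc, two_mul]
    gcongr
    · exact hν.eLpNorm_norm_ev_le t hq1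
    · exact hν.eLpNorm_norm_ev_le s hq1
  have h3 := eLpNorm_norm_rpow (μ := ν) (p := p) A (q := ((k + 1 : ℕ) : ℝ)) (by positivity)
  have h4 : (fun γ => ‖A γ‖ ^ ((k + 1 : ℕ) : ℝ)) = fun γ => A γ ^ (k + 1) := by
    funext γ
    rw [Real.rpow_natCast, Real.norm_of_nonneg (by positivity)]
  rw [h4] at h3
  rw [h3]
  exact ENNReal.rpow_le_rpow hA (by positivity)

/-- Hölder with 1/2 = 1/4 + 1/4: the polynomial factor of the mean value bound stays bounded in L⁴,
while the difference of the values tends to zero in L⁴ like the square roots of the differences of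
the times. -/
lemma tendsto_eLpNorm_ev_sub (hν : IsWienerMeasure ν) {ι : Type*} [Fintype ι]
    {s : ι → unitInterval} {sn : ℕ → ι → unitInterval} (hs : ∀ i, Tendsto (fun n => sn n i) atTop
      (𝓝 (s i))) {f : (ι → E d) → ℝ} (hf : f.HasTemperateGrowth) :
    Tendsto (fun n => eLpNorm ((fun γ => f (ev (sn n) γ)) - fun γ => f (ev s γ)) 2 ν) atTop
      (𝓝 0) := by
  obtain ⟨k, C, hC, hfC⟩ := exists_norm_sub_le_of_temperate hf
  set M4 := eLpNorm (fun γ : PathSpace d => γ.1 1) 4 ν with hM4def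
  have hM4 : M4 ≠ ⊤ := ((hν.hasGaussianLaw_eval 1).memLp (by simp)).2.ne
  have hBlim : Tendsto (fun n => ∑ i, ENNReal.ofReal (Real.sqrt |(sn n i : ℝ) - s i|) * M4) atTop
      (𝓝 0) := by
    have : (0 : ENNReal) = ∑ i : ι, 0 * M4 := by simp
    rw [this]
    refine tendsto_finsetSum _ fun i _ => ?_
    refine ENNReal.Tendsto.mul_const ?_ (Or.inr hM4)
    have h1 : Tendsto (fun n => (sn n i : ℝ)) atTop (𝓝 (s i : ℝ)) :=
      (continuous_subtype_val.tendsto _).comp (hs i)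
    have h2 : Tendsto (fun n => Real.sqrt |(sn n i : ℝ) - s i|) atTop (𝓝 0) := by
      have := ((h1.sub_const (s i : ℝ)).abs).sqrt
      simpa using this
    simpa using ENNReal.tendsto_ofReal h2
  have hholder : ENNReal.HolderTriple 4 4 2 := ⟨by
    rw [← two_mul]
    have : (4 : ENNReal) = 2 * 2 := by norm_num
    rw [this, ENNReal.mul_inv (by simp) (by simp), ← mul_assoc,
      ENNReal.mul_inv_cancel (by simp) (by simp), one_mul]⟩
  obtain ⟨K, hK, hKb⟩ : ∃ K : ENNReal, K ≠ ⊤ ∧ ∀ n, eLpNorm (fun γ =>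
      (1 + ‖ev (d := d) (sn n) γ‖ + ‖ev (d := d) s γ‖) ^ (k + 1)) 4 ν ≤ K := by
    refine ⟨_, ?_, fun n => hν.eLpNorm_one_add_norm_ev_pow_le s (sn n) (by norm_num) (by simp) k⟩
    refine ENNReal.rpow_ne_top_of_nonneg (by positivity) ?_
    have hMq := ((hν.hasGaussianLaw_eval 1).memLp (p := 4 * ENNReal.ofReal ((k + 1 : ℕ) : ℝ))
      (ENNReal.mul_ne_top (by simp) ENNReal.ofReal_ne_top)).2.ne
    exact ENNReal.add_ne_top.mpr ⟨by simp, ENNReal.mul_ne_top (by simp)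
      (ENNReal.mul_ne_top (by simp) hMq)⟩
  have hbound : ∀ n, eLpNorm ((fun γ => f (ev (sn n) γ)) - fun γ => f (ev s γ)) 2 ν ≤
      ENNReal.ofReal C * (K * ∑ i, ENNReal.ofReal (Real.sqrt |(sn n i : ℝ) - s i|) * M4) := by
    intro n
    have m1 : AEStronglyMeasurable (fun γ => ‖ev (d := d) (sn n) γ‖) ν :=
      (aestronglyMeasurable_ev _).norm
    have m2 : AEStronglyMeasurable (fun γ => ‖ev (d := d) s γ‖) ν :=
      (aestronglyMeasurable_ev s).norm
    have hBm : AEStronglyMeasurable (fun γ => ‖ev (d := d) (sn n) γ - ev s γ‖) ν :=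
      ((aestronglyMeasurable_ev _).sub (aestronglyMeasurable_ev s)).norm
    have hAm : AEStronglyMeasurable (fun γ =>
        (1 + ‖ev (d := d) (sn n) γ‖ + ‖ev (d := d) s γ‖) ^ (k + 1)) ν :=
      ((aestronglyMeasurable_const.add m1).add m2).pow _
    have h1 : eLpNorm ((fun γ => f (ev (sn n) γ)) - fun γ => f (ev s γ)) 2 ν ≤
        eLpNorm (C • ((fun γ => (1 + ‖ev (d := d) (sn n) γ‖ + ‖ev (d := d) s γ‖) ^ (k + 1)) •
          fun γ => ‖ev (d := d) (sn n) γ - ev s γ‖)) 2 ν :=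
      eLpNorm_mono_real fun γ => hfC _ _
    refine h1.trans ?_
    rw [eLpNorm_const_smul, Real.enorm_eq_ofReal hC]
    refine mul_le_mul_right ((eLpNorm_smul_le_mul_eLpNorm (p := 4) (q := 4) hBm hAm).trans ?_) _
    exact mul_le_mul' (hKb n) (hν.eLpNorm_norm_ev_sub_le s (sn n) (by norm_num))
  refine tendsto_of_tendsto_of_tendsto_of_le_of_le tendsto_const_nhds ?_ (fun n => zero_le)
    hbound
  have := ENNReal.Tendsto.const_mul (a := ENNReal.ofReal C)
    (ENNReal.Tendsto.const_mul (a := K) hBlim (Or.inr hK)) (Or.inr ENNReal.ofReal_ne_top)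
  simpa using this

end IsWienerMeasure

end WienerForm

namespace WienerForm

variable {d : ℕ}

/-! ### The weighted measure -/

/-- The standing assumptions: `ν` is Wiener measure, `μ = φ ν` with `0 < φ ≤ C`, and `F / φ` is
`ν`-integrable for all cylindrical functions `F`. -/
structure IsWeightedWiener (ν μ : Measure (PathSpace d)) (φ : PathSpace d → ℝ) (C : ℝ) :
    Prop where
  wiener : IsWienerMeasure ν
  aemeasurable : AEMeasurable φ ν
  bounds : ∀ᵐ γ ∂ν, 0 < φ γ ∧ φ γ ≤ C
  integrable_div : ∀ f ∈ Z d, Integrable (fun γ => f γ / φ γ) ν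
  eq_withDensity : μ = ν.withDensity (fun γ => ENNReal.ofReal (φ γ))

/-! ### Squares of L² norms as integrals -/

section L2

variable {X : Type*} [MeasurableSpace X] {μ : Measure X}

lemma integral_mul_self_eq_norm_sq {u : X → ℝ} (hu : MemLp u 2 μ) :
    ∫ x, u x * u x ∂μ = ‖hu.toLp u‖ ^ 2 := by
  rw [← real_inner_self_eq_norm_sq, L2.inner_def]
  refine integral_congr_ae ?_
  filter_upwards [hu.coeFn_toLp] with x hx
  simp [hx, sq]

lemma integral_mul_self_eq_eLpNorm {u : X → ℝ} (hu : MemLp u 2 μ) :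
    ∫ x, u x * u x ∂μ = (eLpNorm u 2 μ).toReal ^ 2 := by
  rw [integral_mul_self_eq_norm_sq hu, Lp.norm_toLp]

lemma tendsto_integral_mul_self {α : Type*} {l : Filter α} {u : α → X → ℝ}
    (hu : ∀ n, MemLp (u n) 2 μ) (h : Tendsto (fun n => eLpNorm (u n) 2 μ) l (𝓝 0)) :
    Tendsto (fun n => ∫ x, u n x * u n x ∂μ) l (𝓝 0) := by
  simp_rw [fun n => integral_mul_self_eq_eLpNorm (hu n)]
  have h1 : Tendsto (fun n => (eLpNorm (u n) 2 μ).toReal) l (𝓝 0) := by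
    simpa [Function.comp_def] using (ENNReal.tendsto_toReal ENNReal.zero_ne_top).comp h
  simpa using h1.pow 2

/-- Integrate u² ≤ 2(u − v)² + 2v², which is (u − 2v)² ≥ 0. This replaces the triangle inequality
throughout and avoids square roots. -/
lemma integral_mul_self_le_sub {u v : X → ℝ} (hu : MemLp u 2 μ) (hv : MemLp v 2 μ) :
    ∫ x, u x * u x ∂μ ≤
      2 * ∫ x, (u - v) x * (u - v) x ∂μ + 2 * ∫ x, v x * v x ∂μ := by
  have huv := hu.sub hv
  rw [← integral_const_mul, ← integral_const_mul, ← integral_add]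
  · refine integral_mono (hu.integrable_mul hu) (((huv.integrable_mul huv).const_mul 2).add
      ((hv.integrable_mul hv).const_mul 2)) fun x => ?_
    simp only [Pi.sub_apply]
    nlinarith [sq_nonneg (u x - 2 * v x)]
  · exact (huv.integrable_mul huv).const_mul 2
  · exact (hv.integrable_mul hv).const_mul 2

end L2

/-! ### Comparison of integrals for ν and for φν -/

namespace IsWeightedWiener

variable {ν μ : Measure (PathSpace d)} {φ : PathSpace d → ℝ} {C : ℝ}

lemma integral_eq (h : IsWeightedWiener ν μ φ C) (u : PathSpace d → ℝ) :
    ∫ γ, u γ ∂μ = ∫ γ, φ γ * u γ ∂ν := by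
  rw [h.eq_withDensity, integral_withDensity_eq_integral_toReal_smul₀
    h.aemeasurable.ennreal_ofReal (ae_of_all _ fun _ => ENNReal.ofReal_lt_top)]
  refine integral_congr_ae ?_
  filter_upwards [h.bounds] with γ hγ
  rw [ENNReal.toReal_ofReal hγ.1.le, smul_eq_mul]

lemma integrable_iff (h : IsWeightedWiener ν μ φ C) (u : PathSpace d → ℝ) :
    Integrable u μ ↔ Integrable (fun γ => φ γ * u γ) ν := by
  rw [h.eq_withDensity, integrable_withDensity_iff_integrable_smul₀'
    h.aemeasurable.ennreal_ofReal (ae_of_all _ fun _ => ENNReal.ofReal_lt_top)]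
  refine integrable_congr ?_
  filter_upwards [h.bounds] with γ hγ
  rw [ENNReal.toReal_ofReal hγ.1.le, smul_eq_mul]

lemma absolutelyContinuous (h : IsWeightedWiener ν μ φ C) : μ ≪ ν := by
  rw [h.eq_withDensity]
  exact withDensity_absolutelyContinuous _ _

lemma absolutelyContinuous_symm (h : IsWeightedWiener ν μ φ C) : ν ≪ μ := by
  rw [h.eq_withDensity]
  refine withDensity_absolutelyContinuous' h.aemeasurable.ennreal_ofReal ?_
  filter_upwards [h.bounds] with γ hγ
  simpa using hγ.1

lemma ae_norm_le (h : IsWeightedWiener ν μ φ C) : ∀ᵐ γ ∂ν, ‖φ γ‖ ≤ C := by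
  filter_upwards [h.bounds] with γ hγ
  rw [Real.norm_of_nonneg hγ.1.le]
  exact hγ.2

lemma integrable_mul (h : IsWeightedWiener ν μ φ C) {u : PathSpace d → ℝ} (hu : Integrable u ν) :
    Integrable (fun γ => φ γ * u γ) ν :=
  hu.bdd_mul (c := C) h.aemeasurable.aestronglyMeasurable h.ae_norm_le

lemma integrable_of_mem_Z (h : IsWeightedWiener ν μ φ C) {F : PathSpace d → ℝ} (hF : F ∈ Z d) :
    Integrable F ν := by
  refine (h.integrable_mul (h.integrable_div F hF)).congr ?_
  filter_upwards [h.bounds] with γ hγ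
  have := hγ.1.ne'
  field_simp

lemma memLp_of_mem_Z (h : IsWeightedWiener ν μ φ C) {F : PathSpace d → ℝ} (hF : F ∈ Z d) :
    MemLp F 2 μ := by
  rw [memLp_two_iff_integrable_sq (measurable_of_mem_Z hF).aestronglyMeasurable, h.integrable_iff]
  refine (h.integrable_mul (h.integrable_of_mem_Z (mul_mem_Z hF hF))).congr (ae_of_all _ fun γ => ?_)
  simp only [Pi.mul_apply]
  ring

/-- The square of G/φ times the density φ is G²/φ, and G² is again cylindrical. -/
lemma memLp_div (h : IsWeightedWiener ν μ φ C) {G : PathSpace d → ℝ} (hG : G ∈ Z d) :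
    MemLp (fun γ => G γ / φ γ) 2 μ := by
  have hm : AEStronglyMeasurable (fun γ => G γ / φ γ) ν :=
    (h.integrable_div G hG).aestronglyMeasurable
  rw [memLp_two_iff_integrable_sq (hm.mono_ac h.absolutelyContinuous), h.integrable_iff]
  refine (h.integrable_div _ (mul_mem_Z hG hG)).congr ?_
  filter_upwards [h.bounds] with γ hγ
  have := hγ.1.ne'
  simp only [Pi.mul_apply]
  field_simp

lemma integral_mul_div (h : IsWeightedWiener ν μ φ C) (u G : PathSpace d → ℝ) :
    ∫ γ, u γ * (G γ / φ γ) ∂μ = ∫ γ, u γ * G γ ∂ν := by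
  rw [h.integral_eq]
  refine integral_congr_ae ?_
  filter_upwards [h.bounds] with γ hγ
  have := hγ.1.ne'
  field_simp

/-- The weight cancels: integration against G under ν is a continuous functional on L²(μ),
represented by G/φ. -/
lemma inner_toLp_div (h : IsWeightedWiener ν μ φ C) (u : Lp ℝ 2 μ) {G : PathSpace d → ℝ}
    (hG : G ∈ Z d) : inner ℝ u ((h.memLp_div hG).toLp _) = ∫ γ, u γ * G γ ∂ν := by
  rw [← h.integral_mul_div, L2.inner_def]
  refine integral_congr_ae ?_
  filter_upwards [(h.memLp_div hG).coeFn_toLp] with γ hγ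
  simp [hγ, mul_comm]

/-- The case G = 1: the product of u with 1/φ, which is in L²(μ), is μ-integrable. -/
lemma integrable_of_Lp (h : IsWeightedWiener ν μ φ C) (u : Lp ℝ 2 μ) : Integrable u ν := by
  have h1 := (h.memLp_div (const_mem_Z 1)).integrable_mul (Lp.memLp u)
  rw [h.integrable_iff] at h1
  refine h1.congr ?_
  filter_upwards [h.bounds] with γ hγ
  have := hγ.1.ne'
  simp only [Pi.mul_apply]
  field_simp

lemma measure_le (h : IsWeightedWiener ν μ φ C) : μ ≤ ENNReal.ofReal C • ν := by
  rw [h.eq_withDensity, ← withDensity_const]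
  refine withDensity_mono ?_
  filter_upwards [h.bounds] with γ hγ
  exact ENNReal.ofReal_le_ofReal hγ.2

lemma isFiniteMeasure (h : IsWeightedWiener ν μ φ C) : IsFiniteMeasure μ := by
  have := h.wiener.isProbabilityMeasure
  refine ⟨lt_of_le_of_lt (h.measure_le Set.univ) ?_⟩
  simp

lemma measure_univ_pos (h : IsWeightedWiener ν μ φ C) : 0 < μ.real Set.univ := by
  have := h.wiener.isProbabilityMeasure
  have := h.isFiniteMeasure
  rw [measureReal_def, ENNReal.toReal_pos_iff]
  refine ⟨?_, measure_lt_top _ _⟩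
  rw [pos_iff_ne_zero]
  intro h0
  have := h.absolutelyContinuous_symm h0
  simp at this

lemma tendsto_eLpNorm (h : IsWeightedWiener ν μ φ C) {u : ℕ → PathSpace d → ℝ}
    (hu : Tendsto (fun n => eLpNorm (u n) 2 ν) atTop (𝓝 0)) :
    Tendsto (fun n => eLpNorm (u n) 2 μ) atTop (𝓝 0) := by
  have hb : ∀ n, eLpNorm (u n) 2 μ ≤
      ENNReal.ofReal C ^ (1 / (2 : ENNReal)).toReal * eLpNorm (u n) 2 ν := by
    intro n
    refine (eLpNorm_mono_measure (u n) h.measure_le).trans ?_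
    rw [eLpNorm_smul_measure_of_ne_top (by simp), smul_eq_mul]
  refine tendsto_of_tendsto_of_tendsto_of_le_of_le tendsto_const_nhds ?_ (fun n => zero_le) hb
  have := ENNReal.Tendsto.const_mul (a := ENNReal.ofReal C ^ (1 / (2 : ENNReal)).toReal) hu
    (Or.inr (ENNReal.rpow_ne_top_of_nonneg (by simp) ENNReal.ofReal_ne_top))
  simpa using this

/-! ### Closability of a single directional derivative -/

variable [NeZero d]

/-- Integrate the Leibniz rule for F G by parts. The adjoint applied to G is K = G X − ∂_i G, where
X is the Wiener integral. -/
lemma exists_integral_cmDeriv_mul (h : IsWeightedWiener ν μ φ C) (i : ℕ) {G : PathSpace d → ℝ}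
    (hG : G ∈ Z d) : ∃ K ∈ Z d, ∀ F ∈ Z d,
      ∫ γ, cmDeriv d i F γ * G γ ∂ν = ∫ γ, F γ * K γ ∂ν := by
  obtain ⟨X, hX, hibp⟩ := h.wiener.exists_integral_cmDeriv
    (fun F hF => h.integrable_of_mem_Z hF) i
  refine ⟨G * X - cmDeriv d i G, sub_mem_Z (mul_mem_Z hG hX) (cmDeriv_mem_Z i hG), fun F hF => ?_⟩
  have h1 := hibp _ (mul_mem_Z hF hG)
  rw [cmDeriv_mul i hF hG] at h1
  have i1 := h.integrable_of_mem_Z (mul_mem_Z (cmDeriv_mem_Z i hF) hG)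
  have i2 := h.integrable_of_mem_Z (mul_mem_Z hF (cmDeriv_mem_Z i hG))
  have i3 := h.integrable_of_mem_Z (mul_mem_Z (mul_mem_Z hF hG) hX)
  have e1 : ∫ γ, (cmDeriv d i F * G + F * cmDeriv d i G) γ ∂ν =
      ∫ γ, cmDeriv d i F γ * G γ ∂ν + ∫ γ, (F * cmDeriv d i G) γ ∂ν := integral_add i1 i2
  have e2 : ∫ γ, F γ * (G * X - cmDeriv d i G) γ ∂ν =
      ∫ γ, (F * G * X) γ ∂ν - ∫ γ, (F * cmDeriv d i G) γ ∂ν := by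
    rw [← integral_sub i3 i2]
    congr 1
    funext γ
    simp only [Pi.mul_apply, Pi.sub_apply]
    ring
  rw [e1] at h1
  rw [e2]
  simp only [Pi.mul_apply] at h1 ⊢
  linarith

/-- The derivatives form a Cauchy sequence in L²(μ) with limit w. Pairing with G/φ and moving the
derivative onto G leaves F_n paired with K/φ, which tends to zero; so w is orthogonal under ν to all
cylindrical functions and vanishes. -/
lemma tendsto_energy (h : IsWeightedWiener ν μ φ C) (i : ℕ) {F : ℕ → PathSpace d → ℝ}
    (hF : ∀ n, F n ∈ Z d) (hF0 : Tendsto (fun n => eLpNorm (F n) 2 μ) atTop (𝓝 0))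
    (hc : Tendsto (fun p : ℕ × ℕ => ∫ γ, cmDeriv d i (F p.1 - F p.2) γ *
      cmDeriv d i (F p.1 - F p.2) γ ∂μ) atTop (𝓝 0)) :
    Tendsto (fun n => ∫ γ, cmDeriv d i (F n) γ * cmDeriv d i (F n) γ ∂μ) atTop (𝓝 0) := by
  have := h.wiener.isProbabilityMeasure
  have hm : ∀ n, MemLp (cmDeriv d i (F n)) 2 μ := fun n => h.memLp_of_mem_Z (cmDeriv_mem_Z i (hF n))
  have hmF : ∀ n, MemLp (F n) 2 μ := fun n => h.memLp_of_mem_Z (hF n)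
  let u : ℕ → Lp ℝ 2 μ := fun n => (hm n).toLp _
  have hdist : ∀ p : ℕ × ℕ, dist (u p.1) (u p.2) = Real.sqrt (∫ γ, cmDeriv d i (F p.1 - F p.2) γ *
      cmDeriv d i (F p.1 - F p.2) γ ∂μ) := by
    intro p
    rw [cmDeriv_sub i (hF _) (hF _), integral_mul_self_eq_norm_sq ((hm _).sub (hm _)),
      Real.sqrt_sq (norm_nonneg _), dist_eq_norm, MemLp.toLp_sub]
  have hcauchy : CauchySeq u := by
    rw [cauchySeq_iff_tendsto_dist_atTop_0]
    simp_rw [hdist]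
    simpa using hc.sqrt
  obtain ⟨w, hw⟩ := cauchySeq_tendsto_of_complete hcauchy
  have hF0' : Tendsto (fun n => (hmF n).toLp (F n)) atTop (𝓝 0) := by
    rw [tendsto_zero_iff_norm_tendsto_zero]
    simp_rw [Lp.norm_toLp]
    simpa [Function.comp_def] using (ENNReal.tendsto_toReal ENNReal.zero_ne_top).comp hF0
  have horth : ∀ G ∈ Z d, ∫ γ, w γ * G γ ∂ν = 0 := by
    intro G hG
    obtain ⟨K, hK, hFK⟩ := h.exists_integral_cmDeriv_mul i hG
    rw [← h.inner_toLp_div w hG]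
    have t1 := hw.inner (tendsto_const_nhds (x := (h.memLp_div hG).toLp _)) (𝕜 := ℝ)
    have t2 := hF0'.inner (tendsto_const_nhds (x := (h.memLp_div hK).toLp _)) (𝕜 := ℝ)
    rw [inner_zero_left] at t2
    refine tendsto_nhds_unique t1 (t2.congr fun n => ?_)
    rw [h.inner_toLp_div _ hK, h.inner_toLp_div _ hG]
    -- Representatives agree μ-almost everywhere, hence ν-almost everywhere because φ > 0.
    have a1 : ∫ γ, ((hmF n).toLp (F n)) γ * K γ ∂ν = ∫ γ, F n γ * K γ ∂ν := by
      refine integral_congr_ae ?_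
      filter_upwards [h.absolutelyContinuous_symm.ae_le (hmF n).coeFn_toLp] with γ hγ
      rw [hγ]
    have a2 : ∫ γ, (u n) γ * G γ ∂ν = ∫ γ, cmDeriv d i (F n) γ * G γ ∂ν := by
      refine integral_congr_ae ?_
      filter_upwards [h.absolutelyContinuous_symm.ae_le (hm n).coeFn_toLp] with γ hγ
      rw [hγ]
    rw [a1, a2, hFK _ (hF n)]
  have hw0 : w = 0 := by
    rw [Lp.eq_zero_iff_ae_eq_zero]
    exact h.absolutelyContinuous.ae_le
      (ae_eq_zero_of_forall_integral_mul_eq_zero (h.integrable_of_Lp w) horth)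
  rw [hw0] at hw
  have e : ∀ n, ∫ γ, cmDeriv d i (F n) γ * cmDeriv d i (F n) γ ∂μ = ‖u n‖ ^ 2 := fun n =>
    integral_mul_self_eq_norm_sq (hm n)
  simp_rw [e]
  simpa using hw.norm.pow 2

end IsWeightedWiener

end WienerForm

namespace WienerForm

lemma IsApprox.mono {X : Type*} [MeasurableSpace X] {μ : Measure X} {V W : Set (X → ℝ)}
    {Q : (X → ℝ) → (X → ℝ) → ℝ} (hVW : V ⊆ W) {u : X → ℝ} {F : ℕ → X → ℝ}
    (hF : IsApprox μ V Q u F) : IsApprox μ W Q u F :=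
  ⟨fun n => hVW (hF.mem n), hF.tendsto, hF.cauchy⟩

variable {d : ℕ} [NeZero d]

/-! ### The form on cylindrical functions of finite energy -/

/-- The energy `∫ ⟨S_{i+1}, DF⟩² dμ` in the direction `S_{i+1}`. -/
def energy (i : ℕ) (μ : Measure (PathSpace d)) (F : PathSpace d → ℝ) : ℝ :=
  ∫ γ, cmDeriv d i F γ * cmDeriv d i F γ ∂μ

/-- The series defining `𝓔(F, F)` converges. -/
def FiniteEnergy (lam : ℕ → ℝ) (μ : Measure (PathSpace d)) (F : PathSpace d → ℝ) : Prop :=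
  Summable fun i => lam (i + 1) * energy i μ F

lemma energy_nonneg (i : ℕ) (μ : Measure (PathSpace d)) (F : PathSpace d → ℝ) :
    0 ≤ energy i μ F :=
  integral_nonneg fun _ => mul_self_nonneg _

lemma form_self_eq (lam : ℕ → ℝ) (μ : Measure (PathSpace d)) (F : PathSpace d → ℝ) :
    form lam μ F F = ∑' i, lam (i + 1) * energy i μ F := rfl

namespace IsWeightedWiener

variable {ν μ : Measure (PathSpace d)} {φ : PathSpace d → ℝ} {C : ℝ} {lam : ℕ → ℝ}
  {F G H : PathSpace d → ℝ}

lemma memLp_cmDeriv (h : IsWeightedWiener ν μ φ C) (i : ℕ) (hF : F ∈ Z d) :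
    MemLp (cmDeriv d i F) 2 μ := h.memLp_of_mem_Z (cmDeriv_mem_Z i hF)

lemma integrable_cmDeriv_mul (h : IsWeightedWiener ν μ φ C) (i : ℕ) (hF : F ∈ Z d)
    (hG : G ∈ Z d) : Integrable (fun γ => cmDeriv d i F γ * cmDeriv d i G γ) μ :=
  (h.memLp_cmDeriv i hF).integrable_mul (h.memLp_cmDeriv i hG)

lemma energy_le_sub (h : IsWeightedWiener ν μ φ C) (i : ℕ) (hF : F ∈ Z d) (hG : G ∈ Z d) :
    energy i μ F ≤ 2 * energy i μ (F - G) + 2 * energy i μ G := by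
  unfold energy
  rw [cmDeriv_sub i hF hG]
  exact integral_mul_self_le_sub (h.memLp_cmDeriv i hF) (h.memLp_cmDeriv i hG)

lemma energy_sub_le (h : IsWeightedWiener ν μ φ C) (i : ℕ) (hF : F ∈ Z d) (hG : G ∈ Z d) :
    energy i μ (F - G) ≤ 2 * energy i μ F + 2 * energy i μ G := by
  unfold energy
  have := integral_mul_self_le_sub
    ((h.memLp_cmDeriv i hF).sub (h.memLp_cmDeriv i hG)) (h.memLp_cmDeriv i hG).neg
  rw [cmDeriv_sub i hF hG]
  simpa using this

lemma finiteEnergy_sub (h : IsWeightedWiener ν μ φ C) (hlam : ∀ i, 0 < lam (i + 1))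
    (hF : F ∈ Z d) (hG : G ∈ Z d) (eF : FiniteEnergy lam μ F) (eG : FiniteEnergy lam μ G) :
    FiniteEnergy lam μ (F - G) := by
  refine Summable.of_nonneg_of_le (fun i => mul_nonneg (hlam i).le (energy_nonneg i μ _))
    (fun i => ?_) ((eF.mul_left 2).add (eG.mul_left 2))
  have := mul_le_mul_of_nonneg_left (h.energy_sub_le i hF hG) (hlam i).le
  linarith

lemma form_self_nonneg (hlam : ∀ i, 0 < lam (i + 1)) : 0 ≤ form lam μ F F :=
  tsum_nonneg fun i => mul_nonneg (hlam i).le (energy_nonneg i μ _)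

lemma form_sub_le (h : IsWeightedWiener ν μ φ C) (hlam : ∀ i, 0 < lam (i + 1))
    (hF : F ∈ Z d) (hG : G ∈ Z d) (eF : FiniteEnergy lam μ F) (eG : FiniteEnergy lam μ G) :
    form lam μ (F - G) (F - G) ≤ 2 * form lam μ F F + 2 * form lam μ G G := by
  simp only [form_self_eq]
  rw [← tsum_mul_left, ← tsum_mul_left, ← (eF.mul_left 2).tsum_add (eG.mul_left 2)]
  refine (h.finiteEnergy_sub hlam hF hG eF eG).tsum_le_tsum (fun i => ?_)
    ((eF.mul_left 2).add (eG.mul_left 2))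
  have := mul_le_mul_of_nonneg_left (h.energy_sub_le i hF hG) (hlam i).le
  linarith

lemma form_le_sub (h : IsWeightedWiener ν μ φ C) (hlam : ∀ i, 0 < lam (i + 1))
    (hF : F ∈ Z d) (hG : G ∈ Z d) (eF : FiniteEnergy lam μ F) (eG : FiniteEnergy lam μ G) :
    form lam μ F F ≤ 2 * form lam μ (F - G) (F - G) + 2 * form lam μ G G := by
  have eFG := h.finiteEnergy_sub hlam hF hG eF eG
  simp only [form_self_eq]
  rw [← tsum_mul_left, ← tsum_mul_left, ← (eFG.mul_left 2).tsum_add (eG.mul_left 2)]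
  refine eF.tsum_le_tsum (fun i => ?_) ((eFG.mul_left 2).add (eG.mul_left 2))
  have := mul_le_mul_of_nonneg_left (h.energy_le_sub i hF hG) (hlam i).le
  linarith

/-- Young's inequality; the free parameter η stands in for the Cauchy–Schwarz inequality. -/
lemma abs_integral_cmDeriv_mul_le (h : IsWeightedWiener ν μ φ C) (i : ℕ) (hF : F ∈ Z d)
    (hG : G ∈ Z d) {η : ℝ} (hη : 0 < η) :
    |∫ γ, cmDeriv d i F γ * cmDeriv d i G γ ∂μ| ≤ η * energy i μ F + η⁻¹ * energy i μ G := by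
  unfold energy
  rw [← integral_const_mul, ← integral_const_mul, ← integral_add
    ((h.integrable_cmDeriv_mul i hF hF).const_mul η)
    ((h.integrable_cmDeriv_mul i hG hG).const_mul η⁻¹)]
  refine (abs_integral_le_integral_abs).trans (integral_mono
    (h.integrable_cmDeriv_mul i hF hG).abs (((h.integrable_cmDeriv_mul i hF hF).const_mul η).add
    ((h.integrable_cmDeriv_mul i hG hG).const_mul η⁻¹)) fun γ => ?_)
  set a := cmDeriv d i F γ
  set b := cmDeriv d i G γ
  have h1 : 0 ≤ η * a * a := by nlinarith [mul_self_nonneg a]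
  have h2 : 0 ≤ η⁻¹ * b * b := by nlinarith [mul_self_nonneg b, inv_pos.mpr hη]
  have h3 : 0 ≤ η * (a - η⁻¹ * b) ^ 2 := by positivity
  have h4 : 0 ≤ η * (a + η⁻¹ * b) ^ 2 := by positivity
  have h5 : η * (a - η⁻¹ * b) ^ 2 = η * a * a - 2 * (a * b) + η⁻¹ * b * b := by
    field_simp; ring
  have h6 : η * (a + η⁻¹ * b) ^ 2 = η * a * a + 2 * (a * b) + η⁻¹ * b * b := by
    field_simp; ring
  simp only
  rw [abs_le]
  constructor <;> linarith

lemma summable_form (h : IsWeightedWiener ν μ φ C) (hlam : ∀ i, 0 < lam (i + 1))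
    (hF : F ∈ Z d) (hG : G ∈ Z d) (eF : FiniteEnergy lam μ F) (eG : FiniteEnergy lam μ G) :
    Summable (fun i => lam (i + 1) * ∫ γ, cmDeriv d i F γ * cmDeriv d i G γ ∂μ) := by
  refine Summable.of_norm_bounded (eF.add eG) fun i => ?_
  rw [Real.norm_eq_abs, abs_mul, abs_of_pos (hlam i), ← mul_add]
  refine mul_le_mul_of_nonneg_left ?_ (hlam i).le
  simpa using h.abs_integral_cmDeriv_mul_le i hF hG one_pos

lemma abs_form_le (h : IsWeightedWiener ν μ φ C) (hlam : ∀ i, 0 < lam (i + 1))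
    (hF : F ∈ Z d) (hG : G ∈ Z d) (eF : FiniteEnergy lam μ F) (eG : FiniteEnergy lam μ G)
    {η : ℝ} (hη : 0 < η) :
    |form lam μ F G| ≤ η * form lam μ F F + η⁻¹ * form lam μ G G := by
  have hs := h.summable_form hlam hF hG eF eG
  simp only [form_self_eq]
  rw [← tsum_mul_left, ← tsum_mul_left, ← (eF.mul_left η).tsum_add (eG.mul_left η⁻¹)]
  refine (norm_tsum_le_tsum_norm hs.norm).trans (hs.norm.tsum_le_tsum (fun i => ?_)
    ((eF.mul_left η).add (eG.mul_left η⁻¹)))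
  rw [Real.norm_eq_abs, abs_mul, abs_of_pos (hlam i)]
  have := mul_le_mul_of_nonneg_left (h.abs_integral_cmDeriv_mul_le i hF hG hη) (hlam i).le
  linarith

lemma form_comm : form lam μ F G = form lam μ G F := by
  unfold form
  simp_rw [mul_comm (cmInner _ (D F _))]

lemma form_sub_left (h : IsWeightedWiener ν μ φ C) (hlam : ∀ i, 0 < lam (i + 1))
    (hF : F ∈ Z d) (hG : G ∈ Z d) (hH : H ∈ Z d) (eF : FiniteEnergy lam μ F)
    (eG : FiniteEnergy lam μ G) (eH : FiniteEnergy lam μ H) :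
    form lam μ (F - G) H = form lam μ F H - form lam μ G H := by
  change ∑' i, lam (i + 1) * ∫ γ, cmDeriv d i (F - G) γ * cmDeriv d i H γ ∂μ =
    ∑' i, lam (i + 1) * ∫ γ, cmDeriv d i F γ * cmDeriv d i H γ ∂μ -
      ∑' i, lam (i + 1) * ∫ γ, cmDeriv d i G γ * cmDeriv d i H γ ∂μ
  rw [← (h.summable_form hlam hF hH eF eH).tsum_sub (h.summable_form hlam hG hH eG eH)]
  congr 1
  funext i
  rw [← mul_sub, ← integral_sub (h.integrable_cmDeriv_mul i hF hH)
    (h.integrable_cmDeriv_mul i hG hH), cmDeriv_sub i hF hG]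
  simp only [Pi.sub_apply, sub_mul]

theorem formWellDefined (h : IsWeightedWiener ν μ φ C) (hlam : ∀ i, 0 < lam (i + 1))
    {V : Set (PathSpace d → ℝ)} (hV : V ⊆ Z d) (eV : ∀ F ∈ V, FiniteEnergy lam μ F) :
    FormWellDefined lam μ V :=
  ⟨fun _ hF => h.memLp_of_mem_Z (hV hF), fun F hF G hG =>
    ⟨fun i => h.integrable_cmDeriv_mul i (hV hF) (hV hG),
      h.summable_form hlam (hV hF) (hV hG) (eV F hF) (eV G hG)⟩⟩

/-- A single term of a series of nonnegative terms is at most the sum, and λ_{i+1} > 0 can be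
divided out. -/
lemma tendsto_energy_of_tendsto_form (hlam : ∀ i, 0 < lam (i + 1)) {α : Type*} {l : Filter α}
    {A : α → PathSpace d → ℝ} (eA : ∀ a, FiniteEnergy lam μ (A a))
    (hA : Tendsto (fun a => form lam μ (A a) (A a)) l (𝓝 0)) (i : ℕ) :
    Tendsto (fun a => energy i μ (A a)) l (𝓝 0) := by
  have h1 : Tendsto (fun a => (lam (i + 1))⁻¹ * form lam μ (A a) (A a)) l (𝓝 0) := by
    simpa using hA.const_mul (lam (i + 1))⁻¹
  refine squeeze_zero (fun a => energy_nonneg i μ _) (fun a => ?_) h1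
  rw [inv_mul_eq_div, le_div_iff₀ (hlam i), mul_comm]
  exact (eA a).le_tsum i fun j _ => mul_nonneg (hlam j).le (energy_nonneg j μ _)

/-- Lower semicontinuity: if `G_m → F` in every direction, then the energy of `F` is bounded in
terms of the energies of `G_m`. -/
lemma form_le_of_tendsto_energy (h : IsWeightedWiener ν μ φ C) (hlam : ∀ i, 0 < lam (i + 1))
    (hF : F ∈ Z d) {G : ℕ → PathSpace d → ℝ} (hG : ∀ m, G m ∈ Z d)
    (eG : ∀ m, FiniteEnergy lam μ (G m)) {B : ℝ}
    (hB : ∀ᶠ m in atTop, form lam μ (G m) (G m) ≤ B)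
    (hlim : ∀ i, Tendsto (fun m => energy i μ (F - G m)) atTop (𝓝 0)) :
    FiniteEnergy lam μ F ∧ form lam μ F F ≤ 2 * B := by
  -- Only finitely many directions occur in a partial sum, so m can tend to infinity there. The
  -- factor 2 comes from splitting F into F − G_m and G_m.
  have hpart : ∀ T : Finset ℕ, ∑ i ∈ T, lam (i + 1) * energy i μ F ≤ 2 * B := by
    intro T
    have h1 : Tendsto (fun m => 2 * ∑ i ∈ T, lam (i + 1) * energy i μ (F - G m) + 2 * B) atTop
        (𝓝 (2 * B)) := by
      have : Tendsto (fun m => ∑ i ∈ T, lam (i + 1) * energy i μ (F - G m)) atTop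
          (𝓝 (∑ i ∈ T, lam (i + 1) * 0)) :=
        tendsto_finsetSum _ fun i _ => (hlim i).const_mul _
      simpa using (this.const_mul 2).add_const (2 * B)
    refine ge_of_tendsto h1 ?_
    filter_upwards [hB] with m hm
    have h2 : ∑ i ∈ T, lam (i + 1) * energy i μ (G m) ≤ B :=
      ((eG m).sum_le_tsum T fun j _ => mul_nonneg (hlam j).le (energy_nonneg j μ _)).trans hm
    calc _ ≤ ∑ i ∈ T, (2 * (lam (i + 1) * energy i μ (F - G m)) +
          2 * (lam (i + 1) * energy i μ (G m))) := by
          refine Finset.sum_le_sum fun i _ => ?_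
          have := mul_le_mul_of_nonneg_left (h.energy_le_sub i hF (hG m)) (hlam i).le
          linarith
      _ = 2 * ∑ i ∈ T, lam (i + 1) * energy i μ (F - G m) +
          2 * ∑ i ∈ T, lam (i + 1) * energy i μ (G m) := by
          rw [Finset.sum_add_distrib, Finset.mul_sum, Finset.mul_sum]
      _ ≤ _ := by linarith
  have hnn : ∀ i, 0 ≤ lam (i + 1) * energy i μ F := fun i =>
    mul_nonneg (hlam i).le (energy_nonneg i μ _)
  have hs : FiniteEnergy lam μ F := summable_of_sum_le hnn hpart
  exact ⟨hs, hs.tsum_le_of_sum_le hpart⟩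

/-- Fix n and apply lower semicontinuity to F_n − F_m, which tends to F_n in every direction because
the energies of F_m tend to zero. The Cauchy bound ε/4 turns into ε/2. -/
theorem isClosable (h : IsWeightedWiener ν μ φ C) (hlam : ∀ i, 0 < lam (i + 1))
    {V : Set (PathSpace d → ℝ)} (hV : V ⊆ Z d) (hsub : ∀ F ∈ V, ∀ G ∈ V, F - G ∈ V)
    (eV : ∀ F ∈ V, FiniteEnergy lam μ F) : IsClosable μ V (form lam μ) := by
  intro F hF
  have hsubF : ∀ p : ℕ × ℕ, F p.1 - F p.2 ∈ V := fun p => hsub _ (hF.mem _) _ (hF.mem _)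
  have hdir : ∀ i, Tendsto (fun n => energy i μ (F n)) atTop (𝓝 0) := fun i =>
    h.tendsto_energy i (fun n => hV (hF.mem n)) (by simpa using hF.tendsto)
      (tendsto_energy_of_tendsto_form hlam (fun p : ℕ × ℕ => eV _ (hsubF p)) hF.cauchy i)
  rw [Metric.tendsto_atTop]
  intro ε hε
  obtain ⟨⟨N₁, N₂⟩, hN⟩ := (Metric.tendsto_atTop.mp hF.cauchy) (ε / 4) (by positivity)
  refine ⟨N₁, fun n hn => ?_⟩
  have hb : ∀ᶠ m in atTop, form lam μ (F n - F m) (F n - F m) ≤ ε / 4 := by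
    filter_upwards [eventually_ge_atTop N₂] with m hm
    have := hN (n, m) ⟨hn, hm⟩
    rw [Real.dist_eq, sub_zero] at this
    exact (le_abs_self _).trans this.le
  have h1 := (h.form_le_of_tendsto_energy hlam (hV (hF.mem n)) (fun m => hV (hsubF (n, m)))
    (fun m => eV _ (hsubF (n, m))) hb (fun i => by simpa using hdir i)).2
  rw [Real.dist_eq, sub_zero, abs_of_nonneg (form_self_nonneg hlam)]
  linarith

/-! ### Comparison of closures -/

/-- An approximating sequence can be replaced by a nearby one. -/
lemma isApprox_of_near (h : IsWeightedWiener ν μ φ C) (hlam : ∀ i, 0 < lam (i + 1))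
    {V W : Set (PathSpace d → ℝ)} (hV : V ⊆ Z d) (hW : W ⊆ Z d)
    (eV : ∀ F ∈ V, FiniteEnergy lam μ F) (eW : ∀ F ∈ W, FiniteEnergy lam μ F)
    {u : PathSpace d → ℝ} (hu : MemLp u 2 μ) {F G : ℕ → PathSpace d → ℝ}
    (hF : IsApprox μ V (form lam μ) u F) (hG : ∀ n, G n ∈ W)
    (hFG : Tendsto (fun n => eLpNorm (F n - G n) 2 μ) atTop (𝓝 0))
    (hFG' : Tendsto (fun n => form lam μ (F n - G n) (F n - G n)) atTop (𝓝 0)) :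
    IsApprox μ W (form lam μ) u G := by
  have hFZ : ∀ n, F n ∈ Z d := fun n => hV (hF.mem n)
  have hGZ : ∀ n, G n ∈ Z d := fun n => hW (hG n)
  have eF : ∀ n, FiniteEnergy lam μ (F n) := fun n => eV _ (hF.mem n)
  have eG : ∀ n, FiniteEnergy lam μ (G n) := fun n => eW _ (hG n)
  refine ⟨hG, ?_, ?_⟩
  · have hlim : Tendsto (fun n => eLpNorm (F n - u) 2 μ + eLpNorm (F n - G n) 2 μ) atTop
        (𝓝 0) := by simpa using hF.tendsto.add hFG
    refine tendsto_of_tendsto_of_tendsto_of_le_of_le tendsto_const_nhds hlim (fun n => zero_le)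
      fun n => ?_
    have e : G n - u = (F n - u) - (F n - G n) := by abel
    have hFm := (h.memLp_of_mem_Z (hFZ n)).aestronglyMeasurable
    have hGm := (h.memLp_of_mem_Z (hGZ n)).aestronglyMeasurable
    simp only
    rw [e]
    exact eLpNorm_sub_le (hFm.sub hu.aestronglyMeasurable) (hFm.sub hGm) (by norm_num)
  · have t1 : Tendsto (fun p : ℕ × ℕ => form lam μ (F p.1 - G p.1) (F p.1 - G p.1)) atTop (𝓝 0) := by
      rw [← prod_atTop_atTop_eq]
      exact hFG'.comp tendsto_fst
    have t2 : Tendsto (fun p : ℕ × ℕ => form lam μ (F p.2 - G p.2) (F p.2 - G p.2)) atTop (𝓝 0) := by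
      rw [← prod_atTop_atTop_eq]
      exact hFG'.comp tendsto_snd
    have t3 : Tendsto (fun p : ℕ × ℕ => 2 * form lam μ (F p.1 - F p.2) (F p.1 - F p.2) +
        2 * (2 * form lam μ (F p.1 - G p.1) (F p.1 - G p.1) +
          2 * form lam μ (F p.2 - G p.2) (F p.2 - G p.2))) atTop (𝓝 0) := by
      simpa using (hF.cauchy.const_mul 2).add (((t1.const_mul 2).add (t2.const_mul 2)).const_mul 2)
    refine squeeze_zero (fun p => form_self_nonneg hlam) (fun p => ?_) t3
    have e : G p.1 - G p.2 = (F p.1 - F p.2) - ((F p.1 - G p.1) - (F p.2 - G p.2)) := by abel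
    have z1 := sub_mem_Z (hFZ p.1) (hFZ p.2)
    have z2 := sub_mem_Z (hFZ p.1) (hGZ p.1)
    have z3 := sub_mem_Z (hFZ p.2) (hGZ p.2)
    have e1 := h.finiteEnergy_sub hlam (hFZ p.1) (hFZ p.2) (eF _) (eF _)
    have e2 := h.finiteEnergy_sub hlam (hFZ p.1) (hGZ p.1) (eF _) (eG _)
    have e3 := h.finiteEnergy_sub hlam (hFZ p.2) (hGZ p.2) (eF _) (eG _)
    have i1 := h.form_sub_le hlam z1 (sub_mem_Z z2 z3) e1 (h.finiteEnergy_sub hlam z2 z3 e2 e3)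
    have i2 := h.form_sub_le hlam z2 z3 e2 e3
    rw [← e] at i1
    linarith

lemma isApprox_form_bounded (h : IsWeightedWiener ν μ φ C) (hlam : ∀ i, 0 < lam (i + 1))
    {V : Set (PathSpace d → ℝ)} (hV : V ⊆ Z d) (eV : ∀ F ∈ V, FiniteEnergy lam μ F)
    {u : PathSpace d → ℝ} {F : ℕ → PathSpace d → ℝ} (hF : IsApprox μ V (form lam μ) u F) :
    ∃ B, 0 < B ∧ ∀ᶠ n in atTop, form lam μ (F n) (F n) ≤ B := by
  obtain ⟨⟨N₁, N₂⟩, hN⟩ := (Metric.tendsto_atTop.mp hF.cauchy) 1 one_pos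
  have hb := form_self_nonneg (F := F N₂) (μ := μ) hlam
  refine ⟨2 * 1 + 2 * form lam μ (F N₂) (F N₂), by linarith, ?_⟩
  filter_upwards [eventually_ge_atTop N₁] with n hn
  have h1 := hN (n, N₂) ⟨hn, le_rfl⟩
  rw [Real.dist_eq, sub_zero] at h1
  have h2 := (le_abs_self _).trans h1.le
  have h3 := h.form_le_sub hlam (hV (hF.mem n)) (hV (hF.mem N₂)) (eV _ (hF.mem n))
    (eV _ (hF.mem N₂))
  simp only at h2
  linarith

lemma tendsto_form_zero (h : IsWeightedWiener ν μ φ C) (hlam : ∀ i, 0 < lam (i + 1))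
    {A B : ℕ → PathSpace d → ℝ} (hA : ∀ n, A n ∈ Z d) (hB : ∀ n, B n ∈ Z d)
    (eA : ∀ n, FiniteEnergy lam μ (A n)) (eB : ∀ n, FiniteEnergy lam μ (B n)) {M : ℝ} (hM : 0 < M)
    (hBM : ∀ᶠ n in atTop, form lam μ (B n) (B n) ≤ M)
    (hA0 : Tendsto (fun n => form lam μ (A n) (A n)) atTop (𝓝 0)) :
    Tendsto (fun n => form lam μ (A n) (B n)) atTop (𝓝 0) := by
  rw [Metric.tendsto_atTop]
  intro ε hε
  -- This choice of η in Young's inequality makes the term with B_n at most ε/2.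
  have hη : 0 < 2 * M / ε := by positivity
  have h1 : Tendsto (fun n => 2 * M / ε * form lam μ (A n) (A n)) atTop (𝓝 0) := by
    simpa using hA0.const_mul (2 * M / ε)
  have h2 := h1.eventually (gt_mem_nhds (show (0 : ℝ) < ε / 2 by positivity))
  obtain ⟨N, hN⟩ := eventually_atTop.mp (h2.and hBM)
  refine ⟨N, fun n hn => ?_⟩
  obtain ⟨ha, hb⟩ := hN n hn
  rw [Real.dist_eq, sub_zero]
  have h3 := h.abs_form_le hlam (hA n) (hB n) (eA n) (eB n) hη
  have h4 : (2 * M / ε)⁻¹ * form lam μ (B n) (B n) ≤ (2 * M / ε)⁻¹ * M :=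
    mul_le_mul_of_nonneg_left hb (by positivity)
  have h5 : (2 * M / ε)⁻¹ * M = ε / 2 := by field_simp
  linarith

/-- If every element of `Z` can be approximated by elements of `Y`, then the closures of the form
on `Z` and on `Y` coincide. -/
theorem closure_eq (h : IsWeightedWiener ν μ φ C) (hlam : ∀ i, 0 < lam (i + 1))
    (eZ : ∀ F ∈ Z d, FiniteEnergy lam μ F)
    (happrox : ∀ F ∈ Z d, ∃ G : ℕ → PathSpace d → ℝ, (∀ n, G n ∈ Y d) ∧
      Tendsto (fun n => eLpNorm (F - G n) 2 μ) atTop (𝓝 0) ∧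
      Tendsto (fun n => form lam μ (F - G n) (F - G n)) atTop (𝓝 0)) :
    closureDomain μ (Z d) (form lam μ) = closureDomain μ (Y d) (form lam μ) ∧
    closureGraph μ (Z d) (form lam μ) = closureGraph μ (Y d) (form lam μ) := by
  have eY : ∀ F ∈ Y d, FiniteEnergy lam μ F := fun F hF => eZ F (Y_subset_Z hF)
  -- Diagonal choice: the n-th element is approximated within 1/(n+1) in both senses.
  have hnear : ∀ F : ℕ → PathSpace d → ℝ, (∀ n, F n ∈ Z d) → ∃ G : ℕ → PathSpace d → ℝ,
      (∀ n, G n ∈ Y d) ∧ Tendsto (fun n => eLpNorm (F n - G n) 2 μ) atTop (𝓝 0) ∧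
      Tendsto (fun n => form lam μ (F n - G n) (F n - G n)) atTop (𝓝 0) := by
    intro F hF
    have hex : ∀ n : ℕ, ∃ G ∈ Y d, eLpNorm (F n - G) 2 μ ≤ ((n : ENNReal) + 1)⁻¹ ∧
        form lam μ (F n - G) (F n - G) ≤ 1 / ((n : ℝ) + 1) := by
      intro n
      obtain ⟨G, hG, h1, h2⟩ := happrox (F n) (hF n)
      have a1 := h1.eventually (gt_mem_nhds (show (0 : ENNReal) < ((n : ENNReal) + 1)⁻¹ by simp))
      have a2 := h2.eventually (gt_mem_nhds (show (0 : ℝ) < 1 / ((n : ℝ) + 1) by positivity))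
      obtain ⟨m, hm1, hm2⟩ := (a1.and a2).exists
      exact ⟨G m, hG m, hm1.le, hm2.le⟩
    choose G hG h1 h2 using hex
    refine ⟨G, hG, ?_, squeeze_zero (fun n => form_self_nonneg hlam) h2
      tendsto_one_div_add_atTop_nhds_zero_nat⟩
    refine tendsto_of_tendsto_of_tendsto_of_le_of_le tendsto_const_nhds ?_ (fun n => zero_le) h1
    have := (tendsto_add_atTop_iff_nat 1).mpr ENNReal.tendsto_inv_nat_nhds_zero
    simpa using this
  constructor
  · ext u
    constructor
    · rintro ⟨hu, F, hF⟩
      obtain ⟨G, hG, h1, h2⟩ := hnear F hF.mem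
      exact ⟨hu, G, h.isApprox_of_near hlam subset_rfl Y_subset_Z eZ eY hu hF hG h1 h2⟩
    · rintro ⟨hu, F, hF⟩
      exact ⟨hu, F, hF.mono Y_subset_Z⟩
  · ext ⟨u, v, a⟩
    constructor
    · rintro ⟨hu, hv, F, G, hF, hG, hlim⟩
      simp only at hu hv hF hG hlim
      obtain ⟨F', hF', f1, f2⟩ := hnear F hF.mem
      obtain ⟨G', hG', g1, g2⟩ := hnear G hG.mem
      have aF := h.isApprox_of_near hlam subset_rfl Y_subset_Z eZ eY hu hF hF' f1 f2
      have aG := h.isApprox_of_near hlam subset_rfl Y_subset_Z eZ eY hv hG hG' g1 g2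
      refine ⟨hu, hv, F', G', aF, aG, ?_⟩
      have zF := hF.mem
      have zG := hG.mem
      have zF' : ∀ n, F' n ∈ Z d := fun n => Y_subset_Z (hF' n)
      have zG' : ∀ n, G' n ∈ Z d := fun n => Y_subset_Z (hG' n)
      have eF := fun n => eZ _ (zF n)
      have eG := fun n => eZ _ (zG n)
      have eF' := fun n => eZ _ (zF' n)
      have eG' := fun n => eZ _ (zG' n)
      -- With 𝓔 the form, 𝓔(F', G') = 𝓔(F, G) − 𝓔(F − F', G') − 𝓔(G − G', F). The last two terms
      -- vanish in the limit because G' and F are bounded for the form.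
      obtain ⟨B₁, hB₁, b1⟩ := h.isApprox_form_bounded hlam Y_subset_Z eY aG
      obtain ⟨B₂, hB₂, b2⟩ := h.isApprox_form_bounded hlam subset_rfl eZ hF
      have t1 := h.tendsto_form_zero hlam (fun n => sub_mem_Z (zF n) (zF' n)) zG'
        (fun n => eZ _ (sub_mem_Z (zF n) (zF' n))) eG' hB₁ b1 f2
      have t2 := h.tendsto_form_zero hlam (fun n => sub_mem_Z (zG n) (zG' n)) zF
        (fun n => eZ _ (sub_mem_Z (zG n) (zG' n))) eF hB₂ b2 g2
      have t3 := (hlim.sub t1).sub t2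
      simp only [sub_zero] at t3
      refine t3.congr fun n => ?_
      rw [h.form_sub_left hlam (zF n) (zF' n) (zG' n) (eF n) (eF' n) (eG' n),
        h.form_sub_left hlam (zG n) (zG' n) (zF n) (eG n) (eG' n) (eF n),
        form_comm (F := G n), form_comm (F := G' n)]
      ring
    · rintro ⟨hu, hv, F, G, hF, hG, hlim⟩
      exact ⟨hu, hv, F, G, hF.mono Y_subset_Z, hG.mono Y_subset_Z, hlim⟩

end IsWeightedWiener

end WienerForm

namespace WienerForm

lemma IsApprox.cauchy_swap {X : Type*} [MeasurableSpace X] {μ : Measure X} {V : Set (X → ℝ)}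
    {Q : (X → ℝ) → (X → ℝ) → ℝ} {u : X → ℝ} {F : ℕ → X → ℝ} (hF : IsApprox μ V Q u F) :
    Tendsto (fun p : ℕ × ℕ => Q (F p.2 - F p.1) (F p.2 - F p.1)) atTop (𝓝 0) := by
  have h1 : Tendsto (Prod.swap : ℕ × ℕ → ℕ × ℕ) atTop atTop := by
    rw [← prod_atTop_atTop_eq]
    exact tendsto_prod_swap
  exact hF.cauchy.comp h1

/-! ### The summability condition -/

/-- As c_0 = 0, the binary sum is at most 2^p − 1, so the index lies strictly above 2^p (d+j−1) and
is at most 2^p (d+j). Now use 1 ≤ j ≤ d. -/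
lemma idx_bounds {d : ℕ} {c : ℕ → ℕ} (hc0 : c 0 = 0) (hc : ∀ q, c q = 0 ∨ c q = 1) (p : ℕ) {j : ℕ}
    (hj : 1 ≤ j) (hjd : j ≤ d) :
    d * 2 ^ p ≤ idx d c (p + 1) j ∧ idx d c (p + 1) j ≤ d * 2 ^ (p + 1) := by
  unfold idx
  simp only [Nat.add_sub_cancel]
  have hsum : ∑ q ∈ Finset.range (p + 1), c q * 2 ^ (p + 1 - q - 1) + 1 ≤ 2 ^ p := by
    rw [Finset.sum_range_succ', hc0, zero_mul, add_zero]
    have h1 : ∑ q ∈ Finset.range p, c (q + 1) * 2 ^ (p + 1 - (q + 1) - 1) ≤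
        ∑ q ∈ Finset.range p, 2 ^ (p - 1 - q) := by
      refine Finset.sum_le_sum fun q _ => ?_
      have e : p + 1 - (q + 1) - 1 = p - 1 - q := by omega
      rw [e]
      rcases hc (q + 1) with h | h <;> simp [h]
    rw [Finset.sum_range_reflect (fun q => 2 ^ q) p] at h1
    have h2 : ∑ q ∈ Finset.range p, 2 ^ q < 2 ^ p := by
      have := Nat.geomSum_lt (m := 2) (n := p) (s := Finset.range p) le_rfl (by simp)
      exact this
    omega
  have h3 : 2 ^ p * d ≤ 2 ^ p * (d + j - 1) := Nat.mul_le_mul_left _ (by omega)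
  have h4 : 2 ^ p * (d + j - 1) + 2 ^ p ≤ 2 ^ p * (2 * d) := by
    have : 2 ^ p * (d + j - 1) + 2 ^ p = 2 ^ p * (d + j - 1 + 1) := by ring
    rw [this]
    exact Nat.mul_le_mul_left _ (by omega)
  constructor
  · rw [mul_comm d]; omega
  · rw [pow_succ]
    have : d * (2 ^ p * 2) = 2 ^ p * (2 * d) := by ring
    omega

section Summability

variable {d : ℕ} [NeZero d] {lam : ℕ → ℝ}

/-- The summability condition only depends on the values of `λ` at the indices `d 2^p`. -/
lemma summabilityCond_iff (hpos : ∀ i, 1 ≤ i → 0 < lam i)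
    (hmono : ∀ i k, 1 ≤ i → i ≤ k → lam i ≤ lam k) {c : ℕ → ℕ} (hc0 : c 0 = 0)
    (hc : ∀ q, c q = 0 ∨ c q = 1) :
    SummabilityCond d lam c ↔ Summable (fun p : ℕ => lam (d * 2 ^ p) / 2 ^ p) := by
  have hd : 1 ≤ d := NeZero.one_le
  have hd2 : ∀ p : ℕ, 1 ≤ d * 2 ^ p := fun p => Nat.mul_pos hd (by positivity)
  constructor
  · intro h
    -- The case j = 1 suffices; the factor 2 makes up for the denominator 2^(p+1).
    have h1 := (h 1 le_rfl hd).mul_left 2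
    refine Summable.of_nonneg_of_le (fun p => div_nonneg (hpos _ (hd2 p)).le (by positivity))
      (fun p => ?_) h1
    have h2 := hmono _ _ (hd2 p) (idx_bounds hc0 hc p le_rfl hd).1
    rw [pow_succ, ← div_div, mul_div_cancel₀ _ (by norm_num)]
    gcongr
  · intro h j hj hjd
    refine Summable.of_nonneg_of_le (fun p => div_nonneg (hpos _ ?_).le (by positivity))
      (fun p => ?_) ((summable_nat_add_iff 1).mpr h)
    · exact (hd2 p).trans (idx_bounds hc0 hc p hj hjd).1
    · have h1 := (idx_bounds hc0 hc p hj hjd)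
      have h2 := hmono _ _ ((hd2 p).trans h1.1) h1.2
      gcongr

/-- The contribution of one level to the weighted sum of the squares of the Schauder functions. -/
lemma sum_level_le (hpos : ∀ i, 1 ≤ i → 0 < lam i)
    (hmono : ∀ i k, 1 ≤ i → i ≤ k → lam i ≤ lam k) (m : ℕ) {s : ℝ} (hs : 0 ≤ s) :
    ∑ i ∈ Finset.Ico (d * 2 ^ m) (d * 2 ^ (m + 1)), lam (i + 1) * schauder (i / d + 1) s ^ 2 ≤
      2 * d * (lam (d * 2 ^ (m + 1)) / 2 ^ (m + 1)) := by
  have hd : 0 < d := NeZero.pos d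
  have hL : 0 < lam (d * 2 ^ (m + 1)) := hpos _ (Nat.mul_pos hd (by positivity))
  -- Only the Schauder function of this index, counted from zero, can be nonzero at s within the
  -- level. It occurs for the d values of i with quotient r, one for each coordinate.
  set r := 2 ^ m + ⌊s * 2 ^ m⌋₊
  have hterm : ∀ i ∈ Finset.Ico (d * 2 ^ m) (d * 2 ^ (m + 1)),
      lam (i + 1) * schauder (i / d + 1) s ^ 2 ≤
        if i ∈ Finset.Ico (d * r) (d * r + d) then lam (d * 2 ^ (m + 1)) * (1 / 2 ^ m) else 0 := by
    intro i hi
    rw [Finset.mem_Ico] at hi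
    have h1 : 2 ^ m ≤ i / d := by
      rw [Nat.le_div_iff_mul_le hd]; rw [mul_comm]; exact hi.1
    have h2 : i / d < 2 ^ (m + 1) := by
      rw [Nat.div_lt_iff_lt_mul hd, mul_comm]; exact hi.2
    obtain ⟨l, hl⟩ := Nat.exists_eq_add_of_le h1
    have hl' : l < 2 ^ m := by rw [pow_succ] at h2; omega
    rw [hl]
    split_ifs with hr
    · exact mul_le_mul (hmono _ _ (by omega) hi.2) (schauder_sq_le hl' hs) (sq_nonneg _) hL.le
    · rw [schauder_eq_zero hl' hs]
      · simp
      · rintro rfl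
        apply hr
        rw [Finset.mem_Ico]
        have h3 := Nat.div_add_mod i d
        have h4 := Nat.mod_lt i hd
        rw [hl] at h3
        change d * r + i % d = i at h3
        omega
  refine (Finset.sum_le_sum hterm).trans ?_
  rw [← Finset.sum_filter, Finset.sum_const, nsmul_eq_mul]
  have hcard : ((Finset.Ico (d * 2 ^ m) (d * 2 ^ (m + 1))).filter
      (fun i => i ∈ Finset.Ico (d * r) (d * r + d))).card ≤ d := by
    calc _ ≤ (Finset.Ico (d * r) (d * r + d)).card :=
          Finset.card_le_card fun i hi => (Finset.mem_filter.mp hi).2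
      _ = d := by simp
  calc _ ≤ (d : ℝ) * (lam (d * 2 ^ (m + 1)) * (1 / 2 ^ m)) := by
        gcongr
    _ = _ := by
        generalize lam (d * 2 ^ (m + 1)) = x
        rw [pow_succ]
        field_simp

/-- The bound is the tail of a convergent series and does not depend on s; this uniformity drives
the dyadic approximation. -/
lemma sum_levels_le (hpos : ∀ i, 1 ≤ i → 0 < lam i)
    (hmono : ∀ i k, 1 ≤ i → i ≤ k → lam i ≤ lam k)
    (hsum : Summable (fun p : ℕ => lam (d * 2 ^ p) / 2 ^ p)) (M N : ℕ) {s : ℝ} (hs : 0 ≤ s) :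
    ∑ i ∈ Finset.Ico (d * 2 ^ M) (d * 2 ^ (M + N)), lam (i + 1) * schauder (i / d + 1) s ^ 2 ≤
      2 * d * ∑' p : ℕ, lam (d * 2 ^ (p + M)) / 2 ^ (p + M) := by
  have hd : 0 < d := NeZero.pos d
  have hnn : ∀ p : ℕ, 0 ≤ lam (d * 2 ^ p) / 2 ^ p := fun p =>
    div_nonneg (hpos _ (Nat.mul_pos hd (by positivity))).le (by positivity)
  have h1 : ∀ N : ℕ, ∑ i ∈ Finset.Ico (d * 2 ^ M) (d * 2 ^ (M + N)),
      lam (i + 1) * schauder (i / d + 1) s ^ 2 ≤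
        2 * d * ∑ p ∈ Finset.range N, lam (d * 2 ^ (p + 1 + M)) / 2 ^ (p + 1 + M) := by
    intro N
    induction N with
    | zero => simp
    | succ N ih =>
      have hle1 : d * 2 ^ M ≤ d * 2 ^ (M + N) :=
        Nat.mul_le_mul_left _ (Nat.pow_le_pow_right (by norm_num) (by omega))
      have hle2 : d * 2 ^ (M + N) ≤ d * 2 ^ (M + (N + 1)) :=
        Nat.mul_le_mul_left _ (Nat.pow_le_pow_right (by norm_num) (by omega))
      rw [← Finset.sum_Ico_consecutive _ hle1 hle2, Finset.sum_range_succ, mul_add]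
      refine add_le_add ih ?_
      have := sum_level_le (d := d) hpos hmono (M + N) hs
      have e : N + 1 + M = M + N + 1 := by ring
      rw [e]
      exact this
  refine (h1 N).trans ?_
  have hsM := (summable_nat_add_iff M).mpr hsum
  have h2 : ∑ p ∈ Finset.range N, lam (d * 2 ^ (p + 1 + M)) / 2 ^ (p + 1 + M) ≤
      ∑ p ∈ Finset.range (N + 1), lam (d * 2 ^ (p + M)) / 2 ^ (p + M) := by
    rw [Finset.sum_range_succ']
    have := hnn (0 + M)
    linarith
  have h3 := hsM.sum_le_tsum (Finset.range (N + 1)) fun p _ => hnn (p + M)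
  exact mul_le_mul_of_nonneg_left (h2.trans h3) (by positivity)

/-- A series of nonnegative terms, cut at the beginning of a level. -/
lemma summable_and_tsum_le_of_levels {a : ℕ → ℝ} (ha : ∀ i, 0 ≤ a i) (M : ℕ) {τ : ℝ}
    (h : ∀ N, ∑ i ∈ Finset.Ico (d * 2 ^ M) (d * 2 ^ (M + N)), a i ≤ τ) :
    Summable a ∧ ∑' i, a i ≤ ∑ i ∈ Finset.range (d * 2 ^ M), a i + τ := by
  have hd : 0 < d := NeZero.pos d
  have hpart : ∀ n, ∑ i ∈ Finset.range n, a i ≤ ∑ i ∈ Finset.range (d * 2 ^ M), a i + τ := by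
    intro n
    have h1 : n ≤ d * 2 ^ (M + n) := by
      have h2 : n ≤ 2 ^ n := Nat.lt_two_pow_self.le
      have h3 : 2 ^ n ≤ 2 ^ (M + n) := Nat.pow_le_pow_right (by norm_num) (by omega)
      exact (h2.trans h3).trans (Nat.le_mul_of_pos_left _ hd)
    have h4 : d * 2 ^ M ≤ d * 2 ^ (M + n) :=
      Nat.mul_le_mul_left _ (Nat.pow_le_pow_right (by norm_num) (by omega))
    calc _ ≤ ∑ i ∈ Finset.range (d * 2 ^ (M + n)), a i :=
          Finset.sum_le_sum_of_subset_of_nonneg (Finset.range_subset_range.mpr h1)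
            fun i _ _ => ha i
      _ = ∑ i ∈ Finset.range (d * 2 ^ M), a i +
          ∑ i ∈ Finset.Ico (d * 2 ^ M) (d * 2 ^ (M + n)), a i :=
          (Finset.sum_range_add_sum_Ico _ h4).symm
      _ ≤ _ := by have := h n; linarith
  exact ⟨summable_of_sum_range_le ha hpart, Real.tsum_le_of_sum_range_le ha hpart⟩

end Summability

/-! ### Energies of cylindrical functions -/

section PartialDerivatives

variable {d : ℕ}

/-- The partial derivative of `f` in the `j`-th coordinate of its `k`-th variable. -/
def partialDeriv {ι : Type*} [Fintype ι] [DecidableEq ι] (f : (ι → E d) → ℝ)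
    (k : ι) (j : Fin d) (x : ι → E d) : ℝ :=
  fderiv ℝ f x (Pi.single k (EuclideanSpace.single j (1 : ℝ)))

lemma temperate_partialDeriv {ι : Type*} [Fintype ι] [DecidableEq ι]
    {f : (ι → E d) → ℝ} (hf : f.HasTemperateGrowth) (k : ι) (j : Fin d) :
    (partialDeriv f k j).HasTemperateGrowth := temperate_fderiv_apply hf _

/-- The square of the `L²`-norm of a sum. -/
lemma integral_sum_mul_self_le {X κ : Type*} [MeasurableSpace X] [Fintype κ]
    {m : Measure X} {u : κ → X → ℝ} (hu : ∀ k, MemLp (u k) 2 m) :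
    ∫ x, (∑ k, u k x) * (∑ k, u k x) ∂m ≤
      Fintype.card κ * ∑ k, ∫ x, u k x * u k x ∂m := by
  have hi : ∀ k, Integrable (fun x => u k x * u k x) m := fun k => (hu k).integrable_mul (hu k)
  rw [← integral_finsetSum _ fun k _ => hi k, ← integral_const_mul]
  have hs : MemLp (fun x => ∑ k, u k x) 2 m := memLp_finsetSum _ fun k _ => hu k
  refine integral_mono (hs.integrable_mul hs)
    ((integrable_finsetSum _ fun k _ => hi k).const_mul _) fun x => ?_
  have := sq_sum_le_card_mul_sum_sq (s := (Finset.univ : Finset κ)) (f := fun k => u k x)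
  simpa [sq] using this

lemma IsWeightedWiener.memLp_ev {ν μ : Measure (PathSpace d)} {φ : PathSpace d → ℝ} {C : ℝ}
    (h : IsWeightedWiener ν μ φ C) {ι : Type*} [Fintype ι] (s : ι → unitInterval)
    {f : (ι → E d) → ℝ} (hf : f.HasTemperateGrowth) : MemLp (fun γ => f (ev s γ)) 2 μ :=
  h.memLp_of_mem_Z (mem_Z_of_temperate s hf)

lemma exists_partialDeriv_bound {ι : Type*} [Fintype ι] [DecidableEq ι] (μ : Measure (PathSpace d))
    (s : ι → unitInterval) (f : (ι → E d) → ℝ) :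
    ∃ B, ∀ k j, ∫ γ, partialDeriv f k j (ev s γ) * partialDeriv f k j (ev s γ) ∂μ ≤ B := by
  refine ⟨∑ p : ι × Fin d, ∫ γ, partialDeriv f p.1 p.2 (ev s γ) *
    partialDeriv f p.1 p.2 (ev s γ) ∂μ, fun k j => ?_⟩
  exact Finset.single_le_sum (f := fun p : ι × Fin d => ∫ γ, partialDeriv f p.1 p.2 (ev s γ) *
    partialDeriv f p.1 p.2 (ev s γ) ∂μ)
    (fun p _ => integral_nonneg fun γ => mul_self_nonneg _) (Finset.mem_univ (k, j))

lemma IsWeightedWiener.tendsto_ev {ν μ : Measure (PathSpace d)} {φ : PathSpace d → ℝ} {C : ℝ}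
    (h : IsWeightedWiener ν μ φ C) {ι : Type*} [Fintype ι]
    {s : ι → unitInterval} {sn : ℕ → ι → unitInterval} (hs : ∀ i, Tendsto (fun n => sn n i) atTop
      (𝓝 (s i))) {f : (ι → E d) → ℝ} (hf : f.HasTemperateGrowth) :
    Tendsto (fun n => ∫ γ, (f (ev (sn n) γ) - f (ev s γ)) * (f (ev (sn n) γ) - f (ev s γ)) ∂μ)
      atTop (𝓝 0) :=
  tendsto_integral_mul_self (fun n => (h.memLp_ev (sn n) hf).sub (h.memLp_ev s hf))
    (h.tendsto_eLpNorm (h.wiener.tendsto_eLpNorm_ev_sub hs hf))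

/-- Bounds on the partial derivatives that are uniform along a convergent sequence of times. -/
lemma IsWeightedWiener.exists_partialDeriv_bound_of_tendsto {ν μ : Measure (PathSpace d)}
    {φ : PathSpace d → ℝ} {C : ℝ} (h : IsWeightedWiener ν μ φ C) {ι : Type*} [Fintype ι]
    [DecidableEq ι] {s : ι → unitInterval} {sn : ℕ → ι → unitInterval}
    (hs : ∀ i, Tendsto (fun n => sn n i) atTop (𝓝 (s i))) {f : (ι → E d) → ℝ}
    (hf : f.HasTemperateGrowth) :
    ∃ B, 0 ≤ B ∧ (∀ k j, ∫ γ, partialDeriv f k j (ev s γ) * partialDeriv f k j (ev s γ) ∂μ ≤ B) ∧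
      ∀ᶠ n in atTop, ∀ k j,
        ∫ γ, partialDeriv f k j (ev (sn n) γ) * partialDeriv f k j (ev (sn n) γ) ∂μ ≤ B := by
  obtain ⟨B, hB⟩ := exists_partialDeriv_bound μ s f
  -- From u² ≤ 2(u − v)² + 2v², once the integral of (u − v)² is below 1.
  refine ⟨2 + 2 * |B|, by positivity, fun k j => (hB k j).trans ?_, ?_⟩
  · have := le_abs_self B
    have := abs_nonneg B
    linarith
  · rw [eventually_all]
    intro k
    rw [eventually_all]
    intro j
    have hp := temperate_partialDeriv hf k j
    filter_upwards [(h.tendsto_ev hs hp).eventually (gt_mem_nhds one_pos)] with n hn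
    have h1 := integral_mul_self_le_sub (h.memLp_ev (sn n) hp) (h.memLp_ev s hp)
    have h2 := (hB k j).trans (le_abs_self B)
    simp only [Pi.sub_apply] at h1
    linarith

end PartialDerivatives

namespace IsWeightedWiener

variable {d : ℕ} [NeZero d] {ν μ : Measure (PathSpace d)} {φ : PathSpace d → ℝ} {C : ℝ}
  {lam : ℕ → ℝ}

/-- The chain rule gives a sum over the times of a Schauder value and a partial derivative;
Cauchy–Schwarz costs the number of times. All dependence on the level now sits in the Schauder
values. -/
lemma energy_ev_le (h : IsWeightedWiener ν μ φ C) {ι : Type*} [Fintype ι] [DecidableEq ι]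
    (s : ι → unitInterval) {f : (ι → E d) → ℝ} (hf : f.HasTemperateGrowth) {B : ℝ}
    (hB : ∀ k j, ∫ γ, partialDeriv f k j (ev s γ) * partialDeriv f k j (ev s γ) ∂μ ≤ B) (i : ℕ) :
    energy i μ (fun γ => f (ev s γ)) ≤
      Fintype.card ι * B * ∑ k, schauder (i / d + 1) (s k) ^ 2 := by
  unfold energy
  simp_rw [cmDeriv_ev_eq_sum i s hf]
  refine (integral_sum_mul_self_le (u := fun k γ => schauder (i / d + 1) (s k) *
    partialDeriv f k (Fin.ofNat d i) (ev s γ)) fun k =>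
    (h.memLp_ev s (temperate_partialDeriv hf k _)).const_mul _).trans ?_
  rw [mul_assoc]
  refine mul_le_mul_of_nonneg_left ?_ (by positivity)
  rw [Finset.mul_sum]
  refine Finset.sum_le_sum fun k _ => ?_
  have e : ∀ γ, schauder (i / d + 1) (s k) * partialDeriv f k (Fin.ofNat d i) (ev s γ) *
      (schauder (i / d + 1) (s k) * partialDeriv f k (Fin.ofNat d i) (ev s γ)) =
      schauder (i / d + 1) (s k) ^ 2 * (partialDeriv f k (Fin.ofNat d i) (ev s γ) *
        partialDeriv f k (Fin.ofNat d i) (ev s γ)) := fun γ => by ring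
  simp_rw [e]
  rw [integral_const_mul, mul_comm]
  exact mul_le_mul_of_nonneg_right (hB k _) (sq_nonneg _)

/-- Dyadic cylindrical functions have finite energy. -/
lemma finiteEnergy_of_mem_Y (h : IsWeightedWiener ν μ φ C) {F : PathSpace d → ℝ} (hF : F ∈ Y d) :
    FiniteEnergy lam μ F := by
  have hd : 0 < d := NeZero.pos d
  obtain ⟨n, s, f, hf, hs, rfl⟩ := exists_rep_of_mem_Y hF
  obtain ⟨m, hm⟩ := exists_common_level hs
  obtain ⟨B, hB⟩ := exists_partialDeriv_bound μ s f
  -- For i ≥ d 2^m the Schauder function has level at least m and vanishes at all the times, so the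
  -- series is a finite sum.
  refine summable_of_ne_finset_zero (s := Finset.range (d * 2 ^ m)) fun i hi => ?_
  rw [Finset.mem_range, not_lt] at hi
  have h1 : 2 ^ m ≤ i / d := by rw [Nat.le_div_iff_mul_le hd, mul_comm]; exact hi
  have h2 : 2 ≤ i / d + 1 := by
    have : 1 ≤ 2 ^ m := Nat.one_le_two_pow
    omega
  have hz : ∀ k, schauder (i / d + 1) (s k) = 0 := by
    intro k
    obtain ⟨m', l, hl, he⟩ := exists_level h2
    obtain ⟨q, hq⟩ := hm k
    rw [he]
    refine schauder_dyadic_eq_zero hl ?_ hq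
    have h3 : 2 ^ m < 2 ^ (m' + 1) := by rw [pow_succ]; omega
    have := (Nat.pow_lt_pow_iff_right (by norm_num : 1 < 2)).mp h3
    omega
  have h3 := h.energy_ev_le s hf hB i
  simp only [hz] at h3
  have h4 : energy i μ (fun γ => f (ev s γ)) = 0 :=
    le_antisymm (by simpa using h3) (energy_nonneg i μ _)
  rw [h4, mul_zero]

/-- Under the summability condition, cylindrical functions have finite energy. -/
lemma finiteEnergy_of_mem_Z (h : IsWeightedWiener ν μ φ C) (hpos : ∀ i, 1 ≤ i → 0 < lam i)
    (hmono : ∀ i k, 1 ≤ i → i ≤ k → lam i ≤ lam k)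
    (hsum : Summable (fun p : ℕ => lam (d * 2 ^ p) / 2 ^ p)) {F : PathSpace d → ℝ}
    (hF : F ∈ Z d) : FiniteEnergy lam μ F := by
  obtain ⟨n, s, f, hf, rfl⟩ := exists_rep_of_mem_Z hF
  obtain ⟨B, hB⟩ := exists_partialDeriv_bound μ s f
  -- Cutting at level 0 leaves the d indices i < d, which belong to H_1.
  have hsch : ∀ k, Summable fun i => lam (i + 1) * schauder (i / d + 1) (s k) ^ 2 := fun k =>
    (summable_and_tsum_le_of_levels (fun i => mul_nonneg (hpos _ (by omega)).le (sq_nonneg _)) 0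
      (fun N => sum_levels_le hpos hmono hsum 0 N (s k).2.1)).1
  refine Summable.of_nonneg_of_le
    (fun i => mul_nonneg (hpos _ (by omega)).le (energy_nonneg i μ _)) (fun i => ?_)
    ((summable_sum (s := Finset.univ) fun k _ => hsch k).mul_left (Fintype.card (Fin n) * B))
  have h1 := mul_le_mul_of_nonneg_left (h.energy_ev_le s hf hB i) (hpos (i + 1) (by omega)).le
  rw [← Finset.mul_sum]
  linarith

/-! ### Approximation of cylindrical functions by dyadic ones -/

/-- The largest dyadic time of level `n` below `t`. -/
def _root_.WienerForm.dyadicFloor (n : ℕ) (t : unitInterval) : unitInterval :=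
  ⟨⌊(t : ℝ) * 2 ^ n⌋₊ / 2 ^ n, by positivity, by
    rw [div_le_one (by positivity)]
    refine (Nat.floor_le (mul_nonneg t.2.1 (by positivity))).trans ?_
    have : (0 : ℝ) < 2 ^ n := by positivity
    nlinarith [t.2.2]⟩

lemma _root_.WienerForm.isDyadicTime_dyadicFloor (n : ℕ) (t : unitInterval) :
    IsDyadicTime (dyadicFloor n t) := ⟨n, ⌊(t : ℝ) * 2 ^ n⌋₊, rfl⟩

lemma _root_.WienerForm.tendsto_dyadicFloor (t : unitInterval) :
    Tendsto (fun n => dyadicFloor n t) atTop (𝓝 t) := by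
  rw [tendsto_subtype_rng]
  have h := (tendsto_nat_floor_mul_div_atTop (R := ℝ) t.2.1).comp
    (tendsto_pow_atTop_atTop_of_one_lt (one_lt_two (α := ℝ)))
  exact h

/-- Each summand splits as σ(s)p(s) − σ(s_n)p(s_n) = −σ(s_n)(p(s_n) − p(s)) + (σ(s) − σ(s_n))p(s),
with σ the Schauder function and p a partial derivative at the path. The first part is small by L²
continuity in the times, the second by continuity of σ. -/
lemma tendsto_energy_ev (h : IsWeightedWiener ν μ φ C) {ι : Type*} [Fintype ι] [DecidableEq ι]
    {s : ι → unitInterval} {sn : ℕ → ι → unitInterval} (hs : ∀ i, Tendsto (fun n => sn n i) atTop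
      (𝓝 (s i))) {f : (ι → E d) → ℝ} (hf : f.HasTemperateGrowth) (i : ℕ) :
    Tendsto (fun n => energy i μ ((fun γ => f (ev s γ)) - fun γ => f (ev (sn n) γ))) atTop
      (𝓝 0) := by
  set σ := schauder (i / d + 1)
  set j := Fin.ofNat d i
  set p : ι → (ι → E d) → ℝ := fun k => partialDeriv f k j
  have hp : ∀ k, (p k).HasTemperateGrowth := fun k => temperate_partialDeriv hf k j
  have hσ : ∀ k, Tendsto (fun n => σ (sn n k)) atTop (𝓝 (σ (s k))) := fun k =>
    ((continuous_schauder (i / d + 1) (Nat.le_add_left 1 _)).comp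
      continuous_subtype_val).continuousAt.tendsto.comp (hs k)
  let u : ℕ → ι ⊕ ι → PathSpace d → ℝ := fun n => Sum.elim
    (fun k γ => -σ (sn n k) * (p k (ev (sn n) γ) - p k (ev s γ)))
    (fun k γ => (σ (s k) - σ (sn n k)) * p k (ev s γ))
  have hu : ∀ n κ, MemLp (u n κ) 2 μ := by
    rintro n (k | k)
    · exact ((h.memLp_ev (sn n) (hp k)).sub (h.memLp_ev s (hp k))).const_mul _
    · exact (h.memLp_ev s (hp k)).const_mul _
  have hb : ∀ n, energy i μ ((fun γ => f (ev s γ)) - fun γ => f (ev (sn n) γ)) ≤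
      Fintype.card (ι ⊕ ι) * ∑ κ, ∫ γ, u n κ γ * u n κ γ ∂μ := by
    intro n
    have e : cmDeriv d i ((fun γ => f (ev s γ)) - fun γ => f (ev (sn n) γ)) =
        fun γ => ∑ κ, u n κ γ := by
      rw [cmDeriv_sub i (mem_Z_of_temperate s hf) (mem_Z_of_temperate (sn n) hf)]
      funext γ
      rw [Pi.sub_apply, cmDeriv_ev_eq_sum i s hf, cmDeriv_ev_eq_sum i (sn n) hf,
        Fintype.sum_sum_type, ← Finset.sum_sub_distrib, ← Finset.sum_add_distrib]
      refine Finset.sum_congr rfl fun k _ => ?_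
      simp only [u, p, σ, j, partialDeriv, Sum.elim_inl, Sum.elim_inr]
      ring
    unfold energy
    rw [e]
    exact integral_sum_mul_self_le (hu n)
  refine squeeze_zero (fun n => energy_nonneg i μ _) hb ?_
  have hlim : Tendsto (fun n => (Fintype.card (ι ⊕ ι) : ℝ) * ∑ κ, ∫ γ, u n κ γ * u n κ γ ∂μ) atTop
      (𝓝 ((Fintype.card (ι ⊕ ι) : ℝ) * ∑ _κ : ι ⊕ ι, 0)) := by
    refine (tendsto_finsetSum _ ?_).const_mul _
    rintro (k | k) -
    · have e : ∀ n, ∫ γ, u n (Sum.inl k) γ * u n (Sum.inl k) γ ∂μ = σ (sn n k) ^ 2 *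
          ∫ γ, (p k (ev (sn n) γ) - p k (ev s γ)) * (p k (ev (sn n) γ) - p k (ev s γ)) ∂μ := by
        intro n
        rw [← integral_const_mul]
        congr 1
        funext γ
        simp only [u, Sum.elim_inl]
        ring
      simp_rw [e]
      simpa using ((hσ k).pow 2).mul (h.tendsto_ev hs (hp k))
    · have e : ∀ n, ∫ γ, u n (Sum.inr k) γ * u n (Sum.inr k) γ ∂μ = (σ (s k) - σ (sn n k)) ^ 2 *
          ∫ γ, p k (ev s γ) * p k (ev s γ) ∂μ := by
        intro n
        rw [← integral_const_mul]
        congr 1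
        funext γ
        simp only [u, Sum.elim_inr]
        ring
      simp_rw [e]
      simpa using (((hσ k).const_sub (σ (s k))).pow 2).mul_const
        (∫ γ, p k (ev s γ) * p k (ev s γ) ∂μ)
  simpa using hlim

/-- Cut the series at a level M. The tail is at most K τ(M) for all large n, because both the
Schauder sums and the moments of the partial derivatives are bounded uniformly along the
approximation; the head is a finite sum of energies tending to zero. -/
theorem exists_dyadic_approx (h : IsWeightedWiener ν μ φ C) (hpos : ∀ i, 1 ≤ i → 0 < lam i)
    (hmono : ∀ i k, 1 ≤ i → i ≤ k → lam i ≤ lam k)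
    (hsum : Summable (fun p : ℕ => lam (d * 2 ^ p) / 2 ^ p)) {F : PathSpace d → ℝ}
    (hF : F ∈ Z d) : ∃ G : ℕ → PathSpace d → ℝ, (∀ n, G n ∈ Y d) ∧
      Tendsto (fun n => eLpNorm (F - G n) 2 μ) atTop (𝓝 0) ∧
      Tendsto (fun n => form lam μ (F - G n) (F - G n)) atTop (𝓝 0) := by
  obtain ⟨N, s, f, hf, rfl⟩ := exists_rep_of_mem_Z hF
  let sn : ℕ → Fin N → unitInterval := fun n k => dyadicFloor n (s k)
  have hs : ∀ k, Tendsto (fun n => sn n k) atTop (𝓝 (s k)) := fun k => tendsto_dyadicFloor (s k)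
  have hlam : ∀ i, 0 < lam (i + 1) := fun i => hpos _ (by omega)
  refine ⟨fun n γ => f (ev (sn n) γ),
    fun n => mem_Y_of_temperate (sn n) (fun k => isDyadicTime_dyadicFloor n (s k)) hf, ?_, ?_⟩
  · refine (h.tendsto_eLpNorm (h.wiener.tendsto_eLpNorm_ev_sub hs hf)).congr fun n => ?_
    exact eLpNorm_sub_comm _ _ _ _
  obtain ⟨B, hB0, hB, hBn⟩ := h.exists_partialDeriv_bound_of_tendsto hs hf
  -- The product of 2 N B from the energy bounds, N from the sum over the times, and 4 d from the
  -- level sums at the two sets of times.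
  set K : ℝ := 8 * d * N * N * B
  have hK : 0 ≤ K := by positivity
  set τ : ℕ → ℝ := fun M => ∑' p : ℕ, lam (d * 2 ^ (p + M)) / 2 ^ (p + M)
  have hτ : Tendsto τ atTop (𝓝 0) := tendsto_sum_nat_add (fun p => lam (d * 2 ^ p) / 2 ^ p)
  have hbound : ∀ M, ∀ᶠ n in atTop,
      form lam μ ((fun γ => f (ev s γ)) - fun γ => f (ev (sn n) γ))
        ((fun γ => f (ev s γ)) - fun γ => f (ev (sn n) γ)) ≤
      ∑ i ∈ Finset.range (d * 2 ^ M), lam (i + 1) *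
        energy i μ ((fun γ => f (ev s γ)) - fun γ => f (ev (sn n) γ)) + K * τ M := by
    intro M
    filter_upwards [hBn] with n hn
    rw [form_self_eq]
    refine (summable_and_tsum_le_of_levels
      (fun i => mul_nonneg (hlam i).le (energy_nonneg i μ _)) M fun L => ?_).2
    have hterm : ∀ i, lam (i + 1) *
        energy i μ ((fun γ => f (ev s γ)) - fun γ => f (ev (sn n) γ)) ≤
        2 * N * B * ∑ k, (lam (i + 1) * schauder (i / d + 1) (s k) ^ 2 +
          lam (i + 1) * schauder (i / d + 1) (sn n k) ^ 2) := by
      intro i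
      have h1 := h.energy_sub_le i (mem_Z_of_temperate s hf) (mem_Z_of_temperate (sn n) hf)
      have h2 := h.energy_ev_le s hf hB i
      have h3 := h.energy_ev_le (sn n) hf hn i
      rw [Fintype.card_fin] at h2 h3
      have h4 : energy i μ ((fun γ => f (ev s γ)) - fun γ => f (ev (sn n) γ)) ≤
          2 * N * B * (∑ k, schauder (i / d + 1) (s k) ^ 2 +
            ∑ k, schauder (i / d + 1) (sn n k) ^ 2) := by linarith
      refine (mul_le_mul_of_nonneg_left h4 (hlam i).le).trans (le_of_eq ?_)
      rw [Finset.sum_add_distrib, ← Finset.mul_sum, ← Finset.mul_sum]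
      ring
    refine (Finset.sum_le_sum fun i _ => hterm i).trans ?_
    rw [← Finset.mul_sum, Finset.sum_comm]
    have hk : ∀ k, ∑ i ∈ Finset.Ico (d * 2 ^ M) (d * 2 ^ (M + L)),
        (lam (i + 1) * schauder (i / d + 1) (s k) ^ 2 +
          lam (i + 1) * schauder (i / d + 1) (sn n k) ^ 2) ≤ 4 * d * τ M := by
      intro k
      rw [Finset.sum_add_distrib]
      have h1 := sum_levels_le (d := d) hpos hmono hsum M L (s k).2.1
      have h2 := sum_levels_le (d := d) hpos hmono hsum M L (sn n k).2.1
      linarith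
    refine (mul_le_mul_of_nonneg_left (Finset.sum_le_sum fun k _ => hk k)
      (by positivity)).trans (le_of_eq ?_)
    simp only [Finset.sum_const, Finset.card_univ, Fintype.card_fin, nsmul_eq_mul, K]
    ring
  rw [Metric.tendsto_atTop]
  intro ε hε
  have h1 : Tendsto (fun M => K * τ M) atTop (𝓝 0) := by simpa using hτ.const_mul K
  obtain ⟨M, hM⟩ := (h1.eventually (gt_mem_nhds (half_pos hε))).exists
  have h2 : Tendsto (fun n => ∑ i ∈ Finset.range (d * 2 ^ M), lam (i + 1) *
      energy i μ ((fun γ => f (ev s γ)) - fun γ => f (ev (sn n) γ))) atTop (𝓝 0) := by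
    have : Tendsto (fun n => ∑ i ∈ Finset.range (d * 2 ^ M), lam (i + 1) *
        energy i μ ((fun γ => f (ev s γ)) - fun γ => f (ev (sn n) γ))) atTop
        (𝓝 (∑ i ∈ Finset.range (d * 2 ^ M), lam (i + 1) * 0)) :=
      tendsto_finsetSum _ fun i _ => (h.tendsto_energy_ev hs hf i).const_mul _
    simpa using this
  obtain ⟨n₀, hn₀⟩ := eventually_atTop.mp
    ((h2.eventually (gt_mem_nhds (half_pos hε))).and (hbound M))
  refine ⟨n₀, fun n hn => ?_⟩
  obtain ⟨a, b⟩ := hn₀ n hn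
  rw [Real.dist_eq, sub_zero, abs_of_nonneg (form_self_nonneg hlam)]
  linarith

/-! ### Necessity of the summability condition -/

/-- The differences F − G_n tend to zero in L²(μ) and are Cauchy in each direction, so closability
of a single direction applies without knowing that F has finite energy. Lower semicontinuity
concludes. -/
lemma finiteEnergy_of_mem_closureDomain (h : IsWeightedWiener ν μ φ C)
    (hlam : ∀ i, 0 < lam (i + 1)) {F : PathSpace d → ℝ} (hF : F ∈ Z d)
    (hFY : F ∈ closureDomain μ (Y d) (form lam μ)) : FiniteEnergy lam μ F := by
  obtain ⟨-, G, hG⟩ := hFY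
  have eY : ∀ G ∈ Y d, FiniteEnergy lam μ G := fun G hG => h.finiteEnergy_of_mem_Y hG
  have hGZ : ∀ n, G n ∈ Z d := fun n => Y_subset_Z (hG.mem n)
  obtain ⟨B, -, hB⟩ := h.isApprox_form_bounded hlam Y_subset_Z eY hG
  refine (h.form_le_of_tendsto_energy hlam hF hGZ (fun n => eY _ (hG.mem n)) hB fun i => ?_).1
  refine h.tendsto_energy i (F := fun n => F - G n) (fun n => sub_mem_Z hF (hGZ n)) ?_ ?_
  · exact hG.tendsto.congr fun n => eLpNorm_sub_comm _ _ _ _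
  · have h1 := tendsto_energy_of_tendsto_form (A := fun p : ℕ × ℕ => G p.2 - G p.1) hlam
      (fun p => eY _ (sub_mem_Y (hG.mem p.2) (hG.mem p.1)))
      hG.cauchy_swap i
    refine h1.congr fun p => ?_
    rw [← sub_sub_sub_cancel_left (G p.1) (G p.2) F]
    rfl

/-- Test with the first coordinate of γ(1/3). Its derivatives are constants, namely values of
Schauder functions at 1/3, and one direction per level already has energy of order 2^(-m). -/
theorem summable_of_Z_subset (h : IsWeightedWiener ν μ φ C) (hpos : ∀ i, 1 ≤ i → 0 < lam i)
    (hmono : ∀ i k, 1 ≤ i → i ≤ k → lam i ≤ lam k)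
    (hZ : Z d ⊆ closureDomain μ (Y d) (form lam μ)) :
    Summable (fun p : ℕ => lam (d * 2 ^ p) / 2 ^ p) := by
  have hd : 0 < d := NeZero.pos d
  have hlam : ∀ i, 0 < lam (i + 1) := fun i => hpos _ (by omega)
  let t : unitInterval := ⟨1 / 3, by norm_num, by norm_num⟩
  let f : (Fin 1 → E d) → ℝ := fun x => x 0 0
  let L : (Fin 1 → E d) →L[ℝ] ℝ := (EuclideanSpace.proj (𝕜 := ℝ) (0 : Fin d)).comp
    (ContinuousLinearMap.proj (R := ℝ) (φ := fun _ : Fin 1 => E d) 0)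
  have hfL : f = L := rfl
  have hf : f.HasTemperateGrowth := L.hasTemperateGrowth
  set F : PathSpace d → ℝ := fun γ => f (ev (fun _ => t) γ) with hFdef
  have hF : F ∈ Z d := mem_Z_of_temperate _ hf
  have hfin : Summable _ := h.finiteEnergy_of_mem_closureDomain hlam hF (hZ hF)
  have henergy : ∀ m : ℕ, energy (d * (2 ^ m + 2 ^ m / 3)) μ F =
      1 / 2 ^ m / 9 * μ.real Set.univ := by
    intro m
    unfold energy
    have e : ∀ γ, cmDeriv d (d * (2 ^ m + 2 ^ m / 3)) F γ =
        schauder (2 ^ m + 2 ^ m / 3 + 1) (1 / 3) := by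
      intro γ
      rw [hFdef, cmDeriv_ev _ _ hf, hfL, ContinuousLinearMap.fderiv]
      have e2 : L (ev (fun _ => t) (schauderPath d (d * (2 ^ m + 2 ^ m / 3)))) =
        (S d (d * (2 ^ m + 2 ^ m / 3) + 1) (1 / 3)) 0 := rfl
      rw [e2, S_eq, Nat.mul_div_cancel_left _ hd]
      have e3 : Fin.ofNat d (d * (2 ^ m + 2 ^ m / 3)) = 0 := by
        apply Fin.ext
        simp [Fin.ofNat]
      rw [e3]
      simp
    simp_rw [e, ← sq, (schauder_one_third_sq m).2]
    rw [integral_const, smul_eq_mul, mul_comm]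
  -- The chosen directions are distinct, so they give a subseries of the convergent energy series.
  have hinj : Function.Injective (fun m : ℕ => d * (2 ^ m + 2 ^ m / 3)) := by
    have : StrictMono (fun m : ℕ => d * (2 ^ m + 2 ^ m / 3)) := by
      intro a b hab
      have h1 : 2 ^ a < 2 ^ b := Nat.pow_lt_pow_right (by norm_num) hab
      have h2 : 2 ^ a / 3 ≤ 2 ^ b / 3 := Nat.div_le_div_right h1.le
      exact Nat.mul_lt_mul_of_pos_left (by omega) hd
    exact this.injective
  have hsub := hfin.comp_injective hinj
  have hμ := h.measure_univ_pos
  have hsub' := hsub.mul_left (9 / μ.real Set.univ)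
  refine Summable.of_nonneg_of_le (fun p => div_nonneg
    (hpos _ (Nat.mul_pos hd (by positivity))).le (by positivity)) (fun m => ?_) hsub'
  simp only [Function.comp_apply]
  rw [henergy]
  have h1 : lam (d * 2 ^ m) ≤ lam (d * (2 ^ m + 2 ^ m / 3) + 1) := by
    refine hmono _ _ (Nat.mul_pos hd (by positivity)) ?_
    rw [mul_add]; omega
  calc lam (d * 2 ^ m) / 2 ^ m ≤ lam (d * (2 ^ m + 2 ^ m / 3) + 1) / 2 ^ m := by gcongr
    _ = _ := by field_simp

end IsWeightedWiener

end WienerForm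

/-! ### Assembly of the three statements -/

namespace WienerForm

variable {d : ℕ} [NeZero d] {ν μ : Measure (PathSpace d)} {φ : PathSpace d → ℝ} {C : ℝ}
  {lam : ℕ → ℝ}

lemma IsWeightedWiener.Z_subset_closureDomain (h : IsWeightedWiener ν μ φ C)
    (hlam : ∀ i, 0 < lam (i + 1)) (eZ : ∀ F ∈ Z d, FiniteEnergy lam μ F) :
    Z d ⊆ closureDomain μ (Z d) (form lam μ) := by
  intro F hF
  have hFF := sub_mem_Z hF hF
  have h0 : form lam μ (F - F) (F - F) = 0 := by
    rw [h.form_sub_left hlam hF hF hFF (eZ _ hF) (eZ _ hF) (eZ _ hFF), sub_self]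
  refine ⟨h.memLp_of_mem_Z hF, fun _ => F, fun _ => hF, ?_, ?_⟩
  · simp
  · simp only [h0, tendsto_const_nhds]

end WienerForm

end

theorem mainTheorem1 (d : ℕ) [NeZero d]
    (ν : MeasureTheory.Measure (WienerForm.PathSpace d)) (hν : WienerForm.IsWienerMeasure ν)
    (lam : ℕ → ℝ) (hlam_pos : ∀ i, 1 ≤ i → 0 < lam i)
    (hlam_mono : ∀ i k, 1 ≤ i → i ≤ k → lam i ≤ lam k)
    (φ : WienerForm.PathSpace d → ℝ) (hφ_meas : AEMeasurable φ ν)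
    (C : ℝ) (hφ : ∀ᵐ γ ∂ν, 0 < φ γ ∧ φ γ ≤ C)
    (hφ_int : ∀ f ∈ WienerForm.Z d, MeasureTheory.Integrable (fun γ => f γ / φ γ) ν)
    (μ : MeasureTheory.Measure (WienerForm.PathSpace d))
    (hμ : μ = ν.withDensity (fun γ => ENNReal.ofReal (φ γ)))
    (c : ℕ → ℕ) (hc_zero : c 0 = 0) (hc : ∀ q, c q = 0 ∨ c q = 1) :
    (WienerForm.FormWellDefined lam μ (WienerForm.Y d) ∧
      WienerForm.IsClosable μ (WienerForm.Y d) (WienerForm.form lam μ)) ∧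
    (WienerForm.SummabilityCond d lam c →
      WienerForm.FormWellDefined lam μ (WienerForm.Z d) ∧
      WienerForm.IsClosable μ (WienerForm.Z d) (WienerForm.form lam μ) ∧
      WienerForm.closureDomain μ (WienerForm.Z d) (WienerForm.form lam μ) =
        WienerForm.closureDomain μ (WienerForm.Y d) (WienerForm.form lam μ) ∧
      WienerForm.closureGraph μ (WienerForm.Z d) (WienerForm.form lam μ) =
        WienerForm.closureGraph μ (WienerForm.Y d) (WienerForm.form lam μ)) ∧
    (WienerForm.Z d ⊆ WienerForm.closureDomain μ (WienerForm.Y d) (WienerForm.form lam μ) ↔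
      WienerForm.SummabilityCond d lam c) := by
  have h : WienerForm.IsWeightedWiener ν μ φ C := ⟨hν, hφ_meas, hφ, hφ_int, hμ⟩
  have hlam : ∀ i, 0 < lam (i + 1) := fun i => hlam_pos _ (by omega)
  -- From here on the condition is used only through the series of λ_{d 2^p} / 2^p, in which the
  -- digits c_q no longer appear.
  have hcond := WienerForm.summabilityCond_iff (d := d) hlam_pos hlam_mono hc_zero hc
  have eY : ∀ F ∈ WienerForm.Y d, WienerForm.FiniteEnergy lam μ F :=
    fun F hF => h.finiteEnergy_of_mem_Y hF
  have eZ : WienerForm.SummabilityCond d lam c →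
      ∀ F ∈ WienerForm.Z d, WienerForm.FiniteEnergy lam μ F :=
    fun hs F hF => h.finiteEnergy_of_mem_Z hlam_pos hlam_mono (hcond.mp hs) hF
  have hclosure := fun hs => h.closure_eq hlam (eZ hs)
    fun F hF => h.exists_dyadic_approx hlam_pos hlam_mono (hcond.mp hs) hF
  refine ⟨⟨h.formWellDefined hlam WienerForm.Y_subset_Z eY,
    h.isClosable hlam WienerForm.Y_subset_Z
      (fun F hF G hG => WienerForm.sub_mem_Y hF hG) eY⟩, fun hs => ?_, fun hZ => ?_, fun hs => ?_⟩
  · exact ⟨h.formWellDefined hlam subset_rfl (eZ hs), h.isClosable hlam subset_rfl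
      (fun F hF G hG => WienerForm.sub_mem_Z hF hG) (eZ hs), hclosure hs⟩
  · exact hcond.mpr (h.summable_of_Z_subset hlam_pos hlam_mono hZ)
  · exact (h.Z_subset_closureDomain hlam (eZ hs)).trans (hclosure hs).1.subset
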